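/- **Setting and conventions.** Manifolds are smooth, finite-dimensional, Hausdorff, second countable and without boundary. For a Poisson manifold $(Z,\varpi)$ write $\varpi(\alpha,\beta)=\alpha(\varpi^\sharp\beta)$, $\{f,g\}=\varpi(df,dg)$, $X_f=\varpi^\sharp df$, and let $$\{\alpha,\beta\}=i_{\varpi^\sharp\beta}d\alpha-i_{\varpi^\sharp\alpha}d\beta+d(\varpi(\alpha,\beta))$$ be the bracket of 1-forms. Let $S\subset Z$ be a symplectic leaf which is an embedded submanifold, with symplectic form $\omega_S^\flat:TS\to T^*S$, $\omega_S^\flat(\varpi^\sharp\lambda)=\lambda|_{TS}$, and let $j:X\hookrightarrow S\subset Z$ be an embedded Lagrangian submanifold of $S$. Put $$E_X=(TX)^0\subset T^*Z|_X,\quad Z'=E_X^*=TZ|_X/TX\ \xrightarrow{\tau}\ X,\quad L_X=(TS)^0|_X\subset E_X,\quad L_X^*=TZ|_X/TS|_X,$$ let $l:Z'\to L_X^*$ be the canonical projection, and for a section $A$ of $E_X$ let $\overline A:Z'\to\mathbb R$ be the corresponding fibrewise linear function (similarly for sections of $L_X$). *Sternberg–Weinstein structure.* $\varpi'$ is the bivector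 field on $Z'$ whose bracket satisfies, for $f,g\in C^\infty(X)$ and sections $A,B$ of $E_X$ that are restrictions of 1-forms $\tilde A,\tilde B$ on $Z$, $$\{\tau^*f,\tau^*g\}'=0,\qquad \{\overline A,\tau^*f\}'=\tau^*\big((-\varpi^\sharp A)\cdot f\big),\qquad \{\overline A,\overline B\}'=\overline{\{\tilde A,\tilde B\}|_X}.$$ *Hamiltonian.* Let $H\in C^\infty(Z)$ with $dH|_X=0$. The vertical part of $T(dH)$ along $X$ (the Hessian of $H$) induces $t^VH:TS|_X/TX\to E_X$; composing with restriction to $TS$ gives $t^VH_0:TS|_X/TX\to(TX)^0\subset T^*S|_X$. Assume that $t^VH_0$ is invertible at every point of $X$, and set $$\alpha_H=t^VH\circ(t^VH_0)^{-1}\circ(-\omega_S^\flat|_{TX}):TX\to E_X .$$ Its curvature is the $L_X$-valued 2-form $\Phi^{\alpha_H}(U,V)=\{\alpha_HU,\alpha_HV\}-\alpha_H[U,V]$, for vector fields $U,V$ on $X$. The fibre $L_x$ carries the isotropy Lie bracket $[df,dg]=d\{f,g\}_x$, for $f,g\in C^\infty(Z)$ with $d_xf,d_xg\in L_x$. *The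 space $L_X^\pi$.* Let $L_X^\pi=T^*X\oplus_XL_X^*$, with projections $pr_1,pr_2$ to $T^*X$ and $L_X^*$, and let $\psi_H=(\alpha_H^*,l):Z'\to L_X^\pi$. The horizontal lift of $U\in\mathfrak X(X)$ to $L_X^*$ is $hor_H(U)=-l_*X_{\overline{\alpha_H(U)}}$, the Hamiltonian vector field being taken with respect to $\varpi'$; it is tensorial in $U$. The horizontal lift $hor_H^\pi$ of tangent vectors $Y$ of $T^*X$ to $L_X^\pi$ is determined by $pr_{1*}hor_H^\pi(Y)=Y$ and $pr_{2*}hor_H^\pi(Y)=hor_H(\pi_*Y)$, where $\pi:T^*X\to X$. Let $w_{T^*X}$ be the canonical Poisson tensor of $T^*X$, the inverse of $\omega=d\theta$ with $\theta$ the tautological 1-form, that is, $i_{w^\sharp\beta}\omega=\beta$; so $\{p_\nu,x^\mu\}=\delta^\mu_\nu$ in canonical coordinates. The restriction of a covector $a\in T^*_qL_X^\pi$, $q=(\xi,n)$ over $x\in X$, to the vertical space $T_x^*X\oplus L_x^*$ is a pair $(u_a,\lambda_a)\in T_xX\oplus L_x$. **Proposition.** The bivector field $\varpi'$, the isotropy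 brackets, the 2-form $\Phi^{\alpha_H}$ and the lifts $hor_H$, $hor^\pi_H$ exist and are uniquely determined by the conditions above, and $\psi_H$ is a diffeomorphism. The push-forward $\varpi_H=(\psi_H)_*\varpi'$ is $$\varpi_H=hor_H^\pi\circ w_{T^*X}+\overrightarrow{\Phi}^{\alpha_H}+\overleftarrow{w}_{L_X^*},$$ that is, for all $q=(\xi,n)\in L_X^\pi$ and $a,b\in T_q^*L_X^\pi$, $$\varpi_H(a,b)=w_{T^*X}\big(a\circ hor_H^\pi,\,b\circ hor_H^\pi\big)+\big\langle n,\Phi^{\alpha_H}(u_a,u_b)\big\rangle+\big\langle n,[\lambda_a,\lambda_b]\big\rangle ,$$ where $\overrightarrow{\Phi}^{\alpha_H}$ is the vertical bivector field built from the curvature and $\overleftarrow{w}_{L_X^*}$ is the fibrewise Lie–Poisson tensor of $L_X^*$. -/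

import Mathlib

open scoped Manifold ContDiff Bundle Topology
open Bundle
noncomputable section

theorem exists_splitting_of_injective {E E' : Type*} [NormedAddCommGroup E] [NormedSpace ℝ E]
    [FiniteDimensional ℝ E] [NormedAddCommGroup E'] [NormedSpace ℝ E'] [FiniteDimensional ℝ E']
    (A : E →L[ℝ] E') (hA : Function.Injective A) :
    ∃ (R : E' →L[ℝ] E)
      (P : E' →L[ℝ] EuclideanSpace ℝ (Fin (Module.finrank ℝ E' - Module.finrank ℝ E)))
      (σ : EuclideanSpace ℝ (Fin (Module.finrank ℝ E' - Module.finrank ℝ E)) →L[ℝ] E'),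
      (∀ u, R (A u) = u) ∧ (∀ u, P (A u) = 0) ∧ (∀ m, P (σ m) = m) ∧ (∀ m, R (σ m) = 0) ∧
        ∀ v, A (R v) + σ (P v) = v := by
  obtain ⟨R, hR⟩ := A.toLinearMap.exists_leftInverse_of_injective
    (LinearMap.ker_eq_bot.2 hA)
  have hRA : ∀ u, R (A u) = u := fun u => LinearMap.congr_fun hR u
  have hsurj : LinearMap.range R = ⊤ := LinearMap.range_eq_top.2 fun u => ⟨A u, hRA u⟩
  have hdim : Module.finrank ℝ (LinearMap.ker R) =
      Module.finrank ℝ (EuclideanSpace ℝ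
        (Fin (Module.finrank ℝ E' - Module.finrank ℝ E))) := by
    have h := R.finrank_range_add_finrank_ker
    rw [hsurj, finrank_top] at h
    rw [finrank_euclideanSpace_fin]
    omega
  let c := LinearEquiv.ofFinrankEq _ _ hdim
  let Q : E' →ₗ[ℝ] LinearMap.ker R :=
    LinearMap.codRestrict (LinearMap.ker R) (LinearMap.id - A.toLinearMap ∘ₗ R)
      (fun v => by simp [hRA])
  refine ⟨LinearMap.toContinuousLinearMap R, LinearMap.toContinuousLinearMap (c.toLinearMap ∘ₗ Q),
    LinearMap.toContinuousLinearMap ((LinearMap.ker R).subtype ∘ₗ c.symm.toLinearMap),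
    hRA, ?_, ?_, ?_, ?_⟩
  · intro u
    have : Q (A u) = 0 := by
      ext; simp [Q, hRA]
    simp [this]
  · intro m
    have : Q (c.symm m) = c.symm m := by
      ext
      have := (c.symm m).2
      rw [LinearMap.mem_ker] at this
      simp [Q, this]
    simp [this]
  · intro m
    exact (c.symm m).2
  · intro v
    simp [Q]

/-- A smooth immersion `M → N`. -/
structure SmoothImmersion (E M E' N : Type*) [NormedAddCommGroup E] [NormedSpace ℝ E]
    [TopologicalSpace M] [ChartedSpace E M] [NormedAddCommGroup E'] [NormedSpace ℝ E']
    [TopologicalSpace N] [ChartedSpace E' N] where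
  map : C^∞⟮𝓘(ℝ, E), M; 𝓘(ℝ, E'), N⟯
  injective_mfderiv : ∀ x, Function.Injective (mfderiv 𝓘(ℝ, E) 𝓘(ℝ, E') map x)

namespace SmoothImmersion
variable {E M E' N : Type*} [NormedAddCommGroup E] [NormedSpace ℝ E]
    [TopologicalSpace M] [ChartedSpace E M] [NormedAddCommGroup E'] [NormedSpace ℝ E']
    [TopologicalSpace N] [ChartedSpace E' N] (k : SmoothImmersion E M E' N)

/-- The derivative of the immersion. -/
def deriv (x : M) : TangentSpace 𝓘(ℝ, E) x →L[ℝ] TangentSpace 𝓘(ℝ, E') (k.map x) :=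
  mfderiv 𝓘(ℝ, E) 𝓘(ℝ, E') k.map x

/-- The image of `T_x M` in `T_{k x} N`. -/
def tangentImage (x : M) : Submodule ℝ (TangentSpace 𝓘(ℝ, E') (k.map x)) :=
  LinearMap.range (k.deriv x).toLinearMap

/-- The fiber `T_{k x} N / T_x M` of the normal bundle. -/
def NormalSpace (x : M) : Type _ := TangentSpace 𝓘(ℝ, E') (k.map x) ⧸ k.tangentImage x
deriving TopologicalSpace, AddCommGroup, IsTopologicalAddGroup, Module ℝ, ContinuousSMul ℝ

/-- The quotient map from the tangent space of `N` to the normal space. -/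
def proj (x : M) : TangentSpace 𝓘(ℝ, E') (k.map x) →L[ℝ] k.NormalSpace x :=
  ⟨(k.tangentImage x).mkQ, continuous_quot_mk⟩

/-- The model fiber of the normal bundle. -/
abbrev NormalFiber (_ : SmoothImmersion E M E' N) : Type :=
  EuclideanSpace ℝ (Fin (Module.finrank ℝ E' - Module.finrank ℝ E))

variable [IsManifold 𝓘(ℝ, E) ∞ M] [IsManifold 𝓘(ℝ, E') ∞ N]

/-- Trivializations of the tangent bundles. -/
abbrev trM (x₀ : M) := trivializationAt E (TangentSpace 𝓘(ℝ, E) (M := M)) x₀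
abbrev trN (x₀ : M) := trivializationAt E' (TangentSpace 𝓘(ℝ, E') (M := N)) (k.map x₀)

/-- The derivative of `k` in the trivializations of the tangent bundles at `x₀`, `k x₀`. -/
def coord (x₀ x : M) : E →L[ℝ] E' :=
  ((k.trN x₀).continuousLinearMapAt ℝ (k.map x)) ∘L k.deriv x ∘L ((trM (E := E) x₀).symmL ℝ x)

def coordBase (x₀ : M) : Set M :=
  (trM (E := E) x₀).baseSet ∩ k.map ⁻¹' (k.trN x₀).baseSet

theorem isOpen_coordBase (x₀ : M) : IsOpen (k.coordBase x₀) :=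
  (trM (E := E) x₀).open_baseSet.inter
    ((k.trN x₀).open_baseSet.preimage k.map.contMDiff.continuous)

theorem mem_coordBase (x₀ : M) : x₀ ∈ k.coordBase x₀ :=
  ⟨mem_baseSet_trivializationAt E (TangentSpace 𝓘(ℝ, E) (M := M)) x₀,
    mem_baseSet_trivializationAt E' (TangentSpace 𝓘(ℝ, E') (M := N)) (k.map x₀)⟩

theorem coord_change {x₀ x₁ x : M} (h₀ : x ∈ k.coordBase x₀) (h₁ : x ∈ k.coordBase x₁) :
    k.coord x₀ x = (((k.trN x₁).coordChangeL ℝ (k.trN x₀) (k.map x) : E' ≃L[ℝ] E') : E' →L[ℝ] E') ∘L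
      k.coord x₁ x ∘L (((trM (E := E) x₀).coordChangeL ℝ (trM (E := E) x₁) x : E ≃L[ℝ] E) : E →L[ℝ] E) := by
  ext v
  simp only [coord, ContinuousLinearMap.comp_apply, ContinuousLinearEquiv.coe_coe]
  rw [Trivialization.coordChangeL_apply _ _ ⟨h₁.2, h₀.2⟩,
    Trivialization.coordChangeL_apply _ _ ⟨h₀.1, h₁.1⟩]
  have e1 : (trM (E := E) x₁).symmL ℝ x ((trM (E := E) x₁)
      ⟨x, (trM (E := E) x₀).symm x v⟩).2 = (trM (E := E) x₀).symmL ℝ x v := by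
    rw [Trivialization.symmL_apply _ h₁.1, Trivialization.symmL_apply _ h₀.1]
    exact (trM (E := E) x₁).symm_apply_apply_mk h₁.1 _
  rw [e1, Trivialization.continuousLinearMapAt_apply_of_mem ℝ _ h₀.2,
    Trivialization.continuousLinearMapAt_apply_of_mem ℝ _ h₁.2]
  rw [(k.trN x₁).symm_apply_apply_mk h₁.2]

theorem contMDiffOn_coord (x₀ : M) :
    ContMDiffOn 𝓘(ℝ, E) 𝓘(ℝ, E →L[ℝ] E') ∞ (k.coord x₀) (k.coordBase x₀) := by
  intro x₁ h
  have h1 : ContMDiffAt 𝓘(ℝ, E) 𝓘(ℝ, E →L[ℝ] E') ∞ (k.coord x₁) x₁ :=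
    (k.map.contMDiff.contMDiffAt (x := x₁)).mfderiv_const (m := ∞) (by simp)
  have hN : ContMDiffAt 𝓘(ℝ, E) 𝓘(ℝ, E' →L[ℝ] E') ∞ (fun x => (((k.trN x₁).coordChangeL ℝ (k.trN x₀) (k.map x) : E' ≃L[ℝ] E') : E' →L[ℝ] E')) x₁ := by
    have := contMDiffAt_coordChangeL (n := ∞) (IB := 𝓘(ℝ, E')) (e := k.trN x₁) (e' := k.trN x₀) (x := k.map x₁) (k.mem_coordBase x₁).2 h.2
    exact this.comp x₁ k.map.contMDiff.contMDiffAt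
  have hM := contMDiffAt_coordChangeL (n := ∞) (IB := 𝓘(ℝ, E)) (e := trM (E := E) x₀) (e' := trM (E := E) x₁) (x := x₁) h.1 (k.mem_coordBase x₁).1
  refine ((hN.clm_comp (h1.clm_comp hM)).congr_of_eventuallyEq ?_).contMDiffWithinAt
  filter_upwards [(k.isOpen_coordBase x₀).mem_nhds h, (k.isOpen_coordBase x₁).mem_nhds (k.mem_coordBase x₁)] with x hx hx'
  exact k.coord_change hx hx'

theorem injective_coord {x₀ x : M} (h : x ∈ k.coordBase x₀) :
    Function.Injective (k.coord x₀ x) := by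
  intro u v huv
  have h1 : Function.Injective ((k.trN x₀).continuousLinearMapAt ℝ (k.map x)) :=
    Function.LeftInverse.injective fun y => Trivialization.symmL_continuousLinearMapAt _ h.2 y
  have h2 : Function.Injective ((trM (E := E) x₀).symmL ℝ x) :=
    Function.LeftInverse.injective fun y => Trivialization.continuousLinearMapAt_symmL _ h.1 y
  exact h2 (k.injective_mfderiv x (h1 huv))

variable [FiniteDimensional ℝ E] [FiniteDimensional ℝ E']

/-- A splitting of the exact sequence of `k.coord x₀ x₀` and its cokernel. -/
def splitR (x₀ : M) : E' →L[ℝ] E :=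
  (exists_splitting_of_injective _ (k.injective_coord (k.mem_coordBase x₀))).choose
def splitP (x₀ : M) : E' →L[ℝ] k.NormalFiber :=
  (exists_splitting_of_injective _ (k.injective_coord (k.mem_coordBase x₀))).choose_spec.choose
def splitS (x₀ : M) : k.NormalFiber →L[ℝ] E' :=
  (exists_splitting_of_injective _
    (k.injective_coord (k.mem_coordBase x₀))).choose_spec.choose_spec.choose

theorem split_spec (x₀ : M) :
    (∀ u, k.splitR x₀ (k.coord x₀ x₀ u) = u) ∧ (∀ u, k.splitP x₀ (k.coord x₀ x₀ u) = 0) ∧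
      (∀ m, k.splitP x₀ (k.splitS x₀ m) = m) ∧ (∀ m, k.splitR x₀ (k.splitS x₀ m) = 0) ∧
        ∀ v, k.coord x₀ x₀ (k.splitR x₀ v) + k.splitS x₀ (k.splitP x₀ v) = v :=
  (exists_splitting_of_injective _
    (k.injective_coord (k.mem_coordBase x₀))).choose_spec.choose_spec.choose_spec

def normalBase (x₀ : M) : Set M :=
  {x ∈ k.coordBase x₀ | IsUnit (k.splitR x₀ ∘L k.coord x₀ x)}

theorem mem_normalBase (x₀ : M) : x₀ ∈ k.normalBase x₀ := by
  refine ⟨k.mem_coordBase x₀, ?_⟩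
  have : k.splitR x₀ ∘L k.coord x₀ x₀ = 1 := by
    ext u; exact (k.split_spec x₀).1 u
  rw [this]; exact isUnit_one

theorem isOpen_normalBase (x₀ : M) : IsOpen (k.normalBase x₀) := by
  have := FiniteDimensional.complete ℝ E
  have h : ContinuousOn (fun x => k.splitR x₀ ∘L k.coord x₀ x) (k.coordBase x₀) :=
    continuousOn_const.clm_comp (k.contMDiffOn_coord x₀).continuousOn
  exact h.isOpen_inter_preimage (k.isOpen_coordBase x₀) Units.isOpen

/-- The projection of `E'` to the model fiber along the image of `k.coord x₀ x`. -/
def projAt (x₀ x : M) : E' →L[ℝ] k.NormalFiber :=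
  k.splitP x₀ ∘L (ContinuousLinearMap.id ℝ E' -
    k.coord x₀ x ∘L (Ring.inverse (k.splitR x₀ ∘L k.coord x₀ x)) ∘L k.splitR x₀)

theorem contMDiffOn_projAt (x₀ : M) :
    ContMDiffOn 𝓘(ℝ, E) 𝓘(ℝ, E' →L[ℝ] k.NormalFiber) ∞ (k.projAt x₀) (k.normalBase x₀) := by
  intro x hx
  have hA : ContMDiffWithinAt 𝓘(ℝ, E) 𝓘(ℝ, E →L[ℝ] E') ∞ (k.coord x₀) (k.normalBase x₀) x :=
    ((k.contMDiffOn_coord x₀) x hx.1).mono fun _ h => h.1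
  have hB : ContMDiffWithinAt 𝓘(ℝ, E) 𝓘(ℝ, E →L[ℝ] E) ∞
      (fun x => k.splitR x₀ ∘L k.coord x₀ x) (k.normalBase x₀) x :=
    contMDiffWithinAt_const.clm_comp hA
  have hI : ContMDiffWithinAt 𝓘(ℝ, E) 𝓘(ℝ, E →L[ℝ] E) ∞
      (fun x => Ring.inverse (k.splitR x₀ ∘L k.coord x₀ x)) (k.normalBase x₀) x := by
    have := FiniteDimensional.complete ℝ E
    obtain ⟨w, hw⟩ := hx.2
    have := (contDiffAt_ringInverse ℝ w (n := ∞)).contMDiffAt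
    rw [hw] at this
    exact this.comp_contMDiffWithinAt x hB
  exact contMDiffWithinAt_const.clm_comp
    (contMDiffWithinAt_const.sub (hA.clm_comp (hI.clm_comp contMDiffWithinAt_const)))

theorem projAt_splitS (x₀ x : M) (m : k.NormalFiber) : k.projAt x₀ x (k.splitS x₀ m) = m := by
  simp [projAt, (k.split_spec x₀).2.2.1, (k.split_spec x₀).2.2.2.1]

theorem projAt_coord {x₀ x : M} (h : x ∈ k.normalBase x₀) (u : E) :
    k.projAt x₀ x (k.coord x₀ x u) = 0 := by
  have : Ring.inverse (k.splitR x₀ ∘L k.coord x₀ x) (k.splitR x₀ (k.coord x₀ x u)) = u :=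
    DFunLike.congr_fun (Ring.inverse_mul_cancel _ h.2) u
  simp [projAt, this]

theorem mem_range_of_projAt_eq_zero {x₀ x : M} (h : x ∈ k.normalBase x₀) (v : E')
    (hv : k.projAt x₀ x v = 0) : ∃ u, k.coord x₀ x u = v := by
  set c := Ring.inverse (k.splitR x₀ ∘L k.coord x₀ x) (k.splitR x₀ v) with hc
  refine ⟨c, ?_⟩
  have h1 : k.splitR x₀ (k.coord x₀ x c) = k.splitR x₀ v := by
    have := DFunLike.congr_fun (Ring.mul_inverse_cancel _ h.2) (k.splitR x₀ v)
    simpa using this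
  have h2 : k.splitP x₀ (v - k.coord x₀ x c) = 0 := by simpa [projAt, ← hc] using hv
  have h3 := (k.split_spec x₀).2.2.2.2 (v - k.coord x₀ x c)
  rw [h2, map_sub (k.splitR x₀), h1, sub_self, map_zero, map_zero, add_zero] at h3
  exact (sub_eq_zero.1 h3.symm).symm

/-- The linear map from the normal space at `x` to the model fiber. -/
def normalLift (x₀ x : M) (h : x ∈ k.normalBase x₀) : k.NormalSpace x →ₗ[ℝ] k.NormalFiber :=
  (k.tangentImage x).liftQ
    (k.projAt x₀ x ∘L (k.trN x₀).continuousLinearMapAt ℝ (k.map x)).toLinearMap (by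
      rintro _ ⟨u, rfl⟩
      have e : (trM (E := E) x₀).symmL ℝ x ((trM (E := E) x₀).continuousLinearMapAt ℝ x u) = u :=
        Trivialization.symmL_continuousLinearMapAt _ h.1.1 u
      have := k.projAt_coord h ((trM (E := E) x₀).continuousLinearMapAt ℝ x u)
      simp only [coord, ContinuousLinearMap.comp_apply, e] at this
      exact this)

open Classical in
/-- The normal space in the trivialization around `x₀` (zero away from its base set). -/
def normalMap (x₀ x : M) : k.NormalSpace x →ₗ[ℝ] k.NormalFiber :=
  if h : x ∈ k.normalBase x₀ then k.normalLift x₀ x h else 0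

def normalInv (x₀ x : M) : k.NormalFiber →ₗ[ℝ] k.NormalSpace x :=
  (k.proj x).toLinearMap ∘ₗ ((k.trN x₀).symmL ℝ (k.map x) ∘L k.splitS x₀).toLinearMap

theorem normalMap_proj {x₀ x : M} (h : x ∈ k.normalBase x₀)
    (v : TangentSpace 𝓘(ℝ, E') (k.map x)) :
    k.normalMap x₀ x (k.proj x v) =
      k.projAt x₀ x ((k.trN x₀).continuousLinearMapAt ℝ (k.map x) v) := by
  rw [normalMap, dif_pos h]
  exact (k.tangentImage x).liftQ_apply _ v

theorem normalMap_normalInv {x₀ x : M} (h : x ∈ k.normalBase x₀) (m : k.NormalFiber) :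
    k.normalMap x₀ x (k.normalInv x₀ x m) = m := by
  refine (k.normalMap_proj h _).trans ?_
  have e := Trivialization.continuousLinearMapAt_symmL (R := ℝ) (k.trN x₀) h.1.2 (k.splitS x₀ m)
  exact (congrArg _ e).trans (k.projAt_splitS x₀ x m)

theorem normalMap_injective {x₀ x : M} (h : x ∈ k.normalBase x₀) :
    Function.Injective (k.normalMap x₀ x) := by
  rw [injective_iff_map_eq_zero]
  intro a ha
  obtain ⟨v, rfl⟩ : ∃ v, k.proj x v = a := (k.tangentImage x).mkQ_surjective a
  obtain ⟨u, hu⟩ := k.mem_range_of_projAt_eq_zero h _ ((k.normalMap_proj h v).symm.trans ha)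
  refine (Submodule.Quotient.mk_eq_zero _).2 ⟨(trM (E := E) x₀).symmL ℝ x u, ?_⟩
  have := congrArg ((k.trN x₀).symmL ℝ (k.map x)) hu
  rw [Trivialization.symmL_continuousLinearMapAt _ h.1.2, coord] at this
  rw [← this]
  exact (Trivialization.symmL_continuousLinearMapAt _ h.1.2 _).symm

theorem normalInv_normalMap {x₀ x : M} (h : x ∈ k.normalBase x₀) (a : k.NormalSpace x) :
    k.normalInv x₀ x (k.normalMap x₀ x a) = a :=
  k.normalMap_injective h (k.normalMap_normalInv h _)

/-- The local trivialization of the normal bundle of `k` around `x₀`. -/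
def normalTriv (x₀ : M) :
    Pretrivialization k.NormalFiber (π k.NormalFiber k.NormalSpace) where
  toFun p := (p.1, k.normalMap x₀ p.1 p.2)
  invFun q := ⟨q.1, k.normalInv x₀ q.1 q.2⟩
  source := TotalSpace.proj ⁻¹' k.normalBase x₀
  target := k.normalBase x₀ ×ˢ Set.univ
  map_source' p hp := ⟨hp, Set.mem_univ _⟩
  map_target' q hq := hq.1
  left_inv' p hp := by
    obtain ⟨x, a⟩ := p
    exact congrArg (TotalSpace.mk x) (k.normalInv_normalMap hp a)
  right_inv' q hq := by
    obtain ⟨x, m⟩ := q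
    exact congrArg (Prod.mk x) (k.normalMap_normalInv hq.1 m)
  open_target := (k.isOpen_normalBase x₀).prod isOpen_univ
  baseSet := k.normalBase x₀
  open_baseSet := k.isOpen_normalBase x₀
  source_eq := rfl
  target_eq := rfl
  proj_toFun _ _ := rfl

def normalCoordChange (x₀ x₁ x : M) : k.NormalFiber →L[ℝ] k.NormalFiber :=
  k.projAt x₁ x ∘L
    ((k.trN x₀).coordChangeL ℝ (k.trN x₁) (k.map x) : E' ≃L[ℝ] E').toContinuousLinearMap ∘L
      k.splitS x₀

theorem contMDiffOn_normalCoordChange (x₀ x₁ : M) :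
    ContMDiffOn 𝓘(ℝ, E) 𝓘(ℝ, k.NormalFiber →L[ℝ] k.NormalFiber) ∞ (k.normalCoordChange x₀ x₁)
      (k.normalBase x₀ ∩ k.normalBase x₁) := by
  have h1 := (k.contMDiffOn_projAt x₁).mono
    (Set.inter_subset_right (s := k.normalBase x₀) (t := k.normalBase x₁))
  have h2 := (contMDiffOn_coordChangeL (n := ∞) (IB := 𝓘(ℝ, E')) (k.trN x₀) (k.trN x₁)).comp
    (k.map.contMDiff.contMDiffOn (s := k.normalBase x₀ ∩ k.normalBase x₁))
    (fun x hx => ⟨hx.1.1.2, hx.2.1.2⟩)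
  exact h1.clm_comp (h2.clm_comp contMDiffOn_const)

theorem normalCoordChange_apply {x₀ x₁ x : M} (h : x ∈ k.normalBase x₀ ∩ k.normalBase x₁)
    (m : k.NormalFiber) :
    k.normalCoordChange x₀ x₁ x m =
      (k.normalTriv x₁ ⟨x, (k.normalTriv x₀).symm x m⟩).2 := by
  have e : (k.normalTriv x₀).symm x m = k.normalInv x₀ x m :=
    (Pretrivialization.symm_apply (k.normalTriv x₀) h.1 m)
  rw [e]
  refine Eq.trans ?_ (k.normalMap_proj h.2 _).symm
  simp only [normalCoordChange, ContinuousLinearMap.comp_apply, ContinuousLinearEquiv.coe_coe]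
  congr 1
  have h' : k.map x ∈ (k.trN x₀).baseSet ∩ (k.trN x₁).baseSet := ⟨h.1.1.2, h.2.1.2⟩
  rw [Trivialization.coordChangeL_apply _ _ h']
  refine (Trivialization.continuousLinearMapAt_apply_of_mem ℝ _ h'.2 _).symm.trans ?_
  rw [← Trivialization.symmL_apply (R := ℝ) _ h'.1]
  rfl

theorem continuous_normalMap {x₀ x : M} (h : x ∈ k.normalBase x₀) :
    Continuous (k.normalMap x₀ x) := by
  have hq : Topology.IsQuotientMap (k.proj x) := isQuotientMap_quotient_mk'
  rw [hq.continuous_iff]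
  refine (k.projAt x₀ x ∘L (k.trN x₀).continuousLinearMapAt ℝ (k.map x)).continuous.congr ?_
  exact fun v => (k.normalMap_proj h v).symm

theorem continuous_normalInv (x₀ x : M) : Continuous (k.normalInv x₀ x) := by
  have hq : Topology.IsQuotientMap (k.proj x) := isQuotientMap_quotient_mk'
  exact hq.continuous.comp ((k.trN x₀).symmL ℝ (k.map x) ∘L k.splitS x₀).continuous

/-- The normal bundle of an immersion as a smooth vector prebundle. -/
def normalPrebundle : VectorPrebundle ℝ k.NormalFiber k.NormalSpace where
  pretrivializationAtlas := Set.range k.normalTriv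
  pretrivialization_linear' := by
    rintro _ ⟨x₀, rfl⟩
    exact ⟨fun x _ => (k.normalMap x₀ x).isLinear⟩
  pretrivializationAt := k.normalTriv
  mem_base_pretrivializationAt := k.mem_normalBase
  pretrivialization_mem_atlas x := ⟨x, rfl⟩
  exists_coordChange := by
    rintro _ ⟨x₀, rfl⟩ _ ⟨x₁, rfl⟩
    exact ⟨k.normalCoordChange x₀ x₁, (k.contMDiffOn_normalCoordChange x₀ x₁).continuousOn,
      fun x hx m => k.normalCoordChange_apply hx m⟩
  totalSpaceMk_isInducing x := by
    have hl : Function.LeftInverse (fun q : M × k.NormalFiber => k.normalInv x x q.2)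
        (k.normalTriv x ∘ TotalSpace.mk x) :=
      fun a => k.normalInv_normalMap (k.mem_normalBase x) a
    exact (hl.isEmbedding ((k.continuous_normalInv x x).comp continuous_snd)
      (continuous_const.prodMk (k.continuous_normalMap (k.mem_normalBase x)))).isInducing

instance : k.normalPrebundle.IsContMDiff 𝓘(ℝ, E) ∞ where
  exists_contMDiffCoordChange := by
    rintro _ ⟨x₀, rfl⟩ _ ⟨x₁, rfl⟩
    exact ⟨k.normalCoordChange x₀ x₁, k.contMDiffOn_normalCoordChange x₀ x₁,
      fun x hx m => k.normalCoordChange_apply hx m⟩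

instance : TopologicalSpace (TotalSpace k.NormalFiber k.NormalSpace) :=
  k.normalPrebundle.totalSpaceTopology

instance : FiberBundle k.NormalFiber k.NormalSpace := k.normalPrebundle.toFiberBundle

instance : VectorBundle ℝ k.NormalFiber k.NormalSpace := k.normalPrebundle.toVectorBundle

instance : ContMDiffVectorBundle ∞ k.NormalFiber k.NormalSpace 𝓘(ℝ, E) :=
  k.normalPrebundle.contMDiffVectorBundle 𝓘(ℝ, E)

end SmoothImmersion

instance {E H M : Type*} [NormedAddCommGroup E] [NormedSpace ℝ E] [FiniteDimensional ℝ E]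
    [TopologicalSpace H] [TopologicalSpace M] [ChartedSpace H M] (I : ModelWithCorners ℝ E H)
    (p : M) : FiniteDimensional ℝ (TangentSpace I p) :=
  inferInstanceAs (FiniteDimensional ℝ E)

instance {E H M : Type*} [NormedAddCommGroup E] [NormedSpace ℝ E]
    [TopologicalSpace H] [TopologicalSpace M] [ChartedSpace H M] (I : ModelWithCorners ℝ E H)
    (p : M) : T2Space (TangentSpace I p) :=
  inferInstanceAs (T2Space E)

namespace SmoothImmersion

variable {E M E' N E'' N' : Type*} [NormedAddCommGroup E] [NormedSpace ℝ E]
    [TopologicalSpace M] [ChartedSpace E M] [NormedAddCommGroup E'] [NormedSpace ℝ E']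
    [TopologicalSpace N] [ChartedSpace E' N] [NormedAddCommGroup E''] [NormedSpace ℝ E'']
    [TopologicalSpace N'] [ChartedSpace E'' N']

/-- The fiber at `x` of the conormal bundle: the covectors that vanish on `dk(T_x M)`. -/
def Conormal (k : SmoothImmersion E M E' N) (x : M) : Submodule ℝ (TangentSpace 𝓘(ℝ, E') (k.map x) →L[ℝ] ℝ) where
  carrier := {l | ∀ u, l (k.deriv x u) = 0}
  add_mem' ha hb u := by simp [ha u, hb u]
  zero_mem' u := rfl
  smul_mem' c a ha u := by simp [ha u]

/-- The duality pairing of conormal covectors with normal vectors. -/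
def pairing (k : SmoothImmersion E M E' N) (x : M) :
    k.Conormal x →ₗ[ℝ] k.NormalSpace x →ₗ[ℝ] ℝ where
  toFun l := (k.tangentImage x).liftQ
    (l : TangentSpace 𝓘(ℝ, E') (k.map x) →L[ℝ] ℝ).toLinearMap (by rintro _ ⟨u, rfl⟩; exact l.2 u)
  map_add' l l' := by
    ext a
    obtain ⟨v, rfl⟩ := (k.tangentImage x).mkQ_surjective a
    rfl
  map_smul' c l := by
    ext a
    obtain ⟨v, rfl⟩ := (k.tangentImage x).mkQ_surjective a
    rfl

/-- The conormal covector that corresponds to a covector of the normal space. -/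
def toConormal (k : SmoothImmersion E M E' N) (x : M) (a : k.NormalSpace x →L[ℝ] ℝ) :
    k.Conormal x :=
  ⟨a.comp (k.proj x), fun u => by
    have h : k.proj x (k.deriv x u) = 0 := (Submodule.Quotient.mk_eq_zero _).2 ⟨u, rfl⟩
    rw [ContinuousLinearMap.comp_apply, h, map_zero]⟩

theorem comp_mfderiv (k' : SmoothImmersion E' N E'' N') (k : SmoothImmersion E M E' N) (x : M) :
    mfderiv 𝓘(ℝ, E) 𝓘(ℝ, E'') (k'.map.comp k.map) x = (k'.deriv (k.map x)).comp (k.deriv x) :=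
  mfderiv_comp x (k'.map.contMDiff.mdifferentiable (by simp) _)
    (k.map.contMDiff.mdifferentiable (by simp) _)

/-- The composition of immersions. -/
def comp (k' : SmoothImmersion E' N E'' N') (k : SmoothImmersion E M E' N) :
    SmoothImmersion E M E'' N' where
  map := k'.map.comp k.map
  injective_mfderiv x := by
    rw [comp_mfderiv]
    exact (k'.injective_mfderiv _).comp (k.injective_mfderiv x)

theorem comp_deriv (k' : SmoothImmersion E' N E'' N') (k : SmoothImmersion E M E' N) (x : M)
    (u : TangentSpace 𝓘(ℝ, E) x) :
    (k'.comp k).deriv x u = k'.deriv (k.map x) (k.deriv x u) :=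
  DFunLike.congr_fun (comp_mfderiv k' k x) u

/-- The projection from the normal space of `k' ∘ k` to the normal space of `k'`. -/
def normalProj (k' : SmoothImmersion E' N E'' N') (k : SmoothImmersion E M E' N) (x : M) :
    (k'.comp k).NormalSpace x →ₗ[ℝ] k'.NormalSpace (k.map x) :=
  ((k'.comp k).tangentImage x).liftQ (k'.proj (k.map x)).toLinearMap (by
    rintro _ ⟨u, rfl⟩
    exact (Submodule.Quotient.mk_eq_zero _).2 ⟨k.deriv x u, (comp_deriv k' k x u).symm⟩)

end SmoothImmersion

section Manifold

variable {E H : Type*} [NormedAddCommGroup E] [NormedSpace ℝ E] [TopologicalSpace H]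
  (I : ModelWithCorners ℝ E H) {M : Type*} [TopologicalSpace M] [ChartedSpace H M]

/-- The differential of a real function, as a covector. -/
def differential (f : M → ℝ) (p : M) : TangentSpace I p →L[ℝ] ℝ := mfderiv I 𝓘(ℝ, ℝ) f p

/-- The exterior derivative `dα(u, v)` of a 1-form at `p`, computed in the chart at `p`
(in which `T_p M` is the model space). -/
def exteriorDerivative (α : ∀ p : M, TangentSpace I p →L[ℝ] ℝ) (p : M) :
    TangentSpace I p →L[ℝ] TangentSpace I p →L[ℝ] ℝ :=
  let α' : E → E →L[ℝ] ℝ := fun y =>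
    (α ((extChartAt I p).symm y)).comp (mfderiv 𝓘(ℝ, E) I (extChartAt I p).symm y)
  let D : E →L[ℝ] E →L[ℝ] ℝ := fderiv ℝ α' (extChartAt I p p)
  (D - D.flip : E →L[ℝ] E →L[ℝ] ℝ)

/-- The Hessian of `f` at `p`, computed in the chart at `p`. It is used only at critical points
of `f`, where it is the vertical part of the tangent map of `df` and independent of the chart. -/
def hessian (f : M → ℝ) (p : M) : TangentSpace I p →L[ℝ] TangentSpace I p →L[ℝ] ℝ :=
  (fderiv ℝ (fderiv ℝ (f ∘ (extChartAt I p).symm)) (extChartAt I p p) : E →L[ℝ] E →L[ℝ] ℝ)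

variable (M) in
/-- A smooth bivector field `w`, given by `w♯ : T*M → TM`, where `w(α, β) = α (w♯ β)`. -/
structure BivectorField where
  sharp : ∀ p : M, (TangentSpace I p →L[ℝ] ℝ) →ₗ[ℝ] TangentSpace I p
  skew : ∀ (p : M) (α : TangentSpace I p →L[ℝ] ℝ), α (sharp p α) = 0
  smooth : ∀ f g : C^∞⟮I, M; 𝓘(ℝ, ℝ), ℝ⟯, ContMDiff I 𝓘(ℝ, ℝ) ∞
    fun p => differential I f p (sharp p (differential I g p))

/-- The bracket `{f, g} = w(df, dg)`. -/
def BivectorField.bracket {I : ModelWithCorners ℝ E H} (w : BivectorField I M) (f g : M → ℝ) (p : M) : ℝ :=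
  differential I f p (w.sharp p (differential I g p))

variable (M) in
/-- A Poisson structure: a bivector field whose bracket satisfies the Jacobi identity. -/
structure PoissonStructure extends BivectorField I M where
  jacobi : ∀ (f g h : C^∞⟮I, M; 𝓘(ℝ, ℝ), ℝ⟯) (p : M),
    toBivectorField.bracket f (toBivectorField.bracket g h) p +
      toBivectorField.bracket g (toBivectorField.bracket h f) p +
      toBivectorField.bracket h (toBivectorField.bracket f g) p = 0

variable (M) in
/-- Smooth vector fields. -/
abbrev VField [IsManifold I ∞ M] := Cₛ^∞⟮I; E, (TangentSpace I : M → Type _)⟯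

variable (M) in
/-- Smooth 1-forms. -/
abbrev OneForm [IsManifold I ∞ M] :=
  Cₛ^∞⟮I; E →L[ℝ] ℝ, fun p : M => TangentSpace I p →L[ℝ] Trivial M ℝ p⟯

variable (M) in
/-- The total space of the cotangent bundle. -/
abbrev CotangentSpace :=
  TotalSpace (E →L[ℝ] ℝ) fun p : M => TangentSpace I p →L[ℝ] Trivial M ℝ p

/-- The bracket of 1-forms on a Poisson manifold:
`{α, β} = i_{w♯β} dα - i_{w♯α} dβ + d(w(α, β))`. -/
def BivectorField.formBracket {I : ModelWithCorners ℝ E H} [IsManifold I ∞ M] (w : BivectorField I M)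
    (α β : OneForm I M) (p : M) : TangentSpace I p →L[ℝ] ℝ :=
  exteriorDerivative I α p (w.sharp p (β p)) - exteriorDerivative I β p (w.sharp p (α p)) +
    differential I (fun q => α q (w.sharp q (β q))) p

/-- The tautological 1-form `θ_ξ (V) = ξ (dπ V)` on the cotangent bundle. -/
def tautologicalForm [IsManifold I ∞ M] (ξ : CotangentSpace I M) :
    TangentSpace (I.prod 𝓘(ℝ, E →L[ℝ] ℝ)) ξ →L[ℝ] ℝ :=
  ξ.2.comp (mfderiv (I.prod 𝓘(ℝ, E →L[ℝ] ℝ)) I (TotalSpace.proj : CotangentSpace I M → M) ξ)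

/-- The canonical Poisson tensor `w` of the cotangent bundle: the inverse of the canonical
symplectic form `ω = dθ`, that is, `i_{w♯β} ω = β`. -/
def canonicalSharp [IsManifold I ∞ M] (ξ : CotangentSpace I M) :
    (TangentSpace (I.prod 𝓘(ℝ, E →L[ℝ] ℝ)) ξ →L[ℝ] ℝ) →L[ℝ]
      TangentSpace (I.prod 𝓘(ℝ, E →L[ℝ] ℝ)) ξ :=
  (exteriorDerivative (I.prod 𝓘(ℝ, E →L[ℝ] ℝ)) (tautologicalForm I) ξ).inverse

end Manifold

section VerticalLift

variable {EB HB B : Type*} [NormedAddCommGroup EB] [NormedSpace ℝ EB] [TopologicalSpace HB]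
  (IB : ModelWithCorners ℝ EB HB) [TopologicalSpace B] [ChartedSpace HB B]
  (F : Type*) [NormedAddCommGroup F] [NormedSpace ℝ F] {V : B → Type*}
  [TopologicalSpace (TotalSpace F V)] [∀ x, AddCommMonoid (V x)] [∀ x, Module ℝ (V x)]
  [∀ x, TopologicalSpace (V x)] [FiberBundle F V] [VectorBundle ℝ F V]

/-- The canonical map of the fiber `V x` onto the vertical tangent space at `t ∈ V x`: the
derivative of the inclusion of the fiber, which is identified linearly with `F`. -/
def verticalLift (t : TotalSpace F V) :
    V t.1 →L[ℝ] TangentSpace (IB.prod 𝓘(ℝ, F)) t :=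
  let e := trivializationAt F V t.1
  let i : F → TotalSpace F V := fun m => ⟨t.1, e.symm t.1 m⟩
  let D : F →L[ℝ] TangentSpace (IB.prod 𝓘(ℝ, F)) t :=
    mfderiv 𝓘(ℝ, F) (IB.prod 𝓘(ℝ, F)) i (e.continuousLinearMapAt ℝ t.1 t.2)
  D ∘L e.continuousLinearMapAt ℝ t.1

variable {IB F}

/-- The restriction of a covector at `t ∈ V x` to the vertical tangent space `V x`. -/
def verticalPart (t : TotalSpace F V) (a : TangentSpace (IB.prod 𝓘(ℝ, F)) t →L[ℝ] ℝ) :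
    V t.1 →L[ℝ] ℝ :=
  a ∘L verticalLift IB F t

end VerticalLift

/-- `w₂` is the push-forward `f_* w₁` of the bivector field `w₁` along `f`. -/
def IsPushforward {E H M E' H' M' : Type*} [NormedAddCommGroup E] [NormedSpace ℝ E]
    [TopologicalSpace H] {I : ModelWithCorners ℝ E H} [TopologicalSpace M] [ChartedSpace H M]
    [NormedAddCommGroup E'] [NormedSpace ℝ E'] [TopologicalSpace H'] {J : ModelWithCorners ℝ E' H'}
    [TopologicalSpace M'] [ChartedSpace H' M'] (f : M → M') (w₁ : BivectorField I M)
    (w₂ : BivectorField J M') : Prop :=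
  ∀ (t : M) (b : TangentSpace J (f t) →L[ℝ] ℝ),
    w₂.sharp (f t) b = mfderiv I J f t (w₁.sharp t (b.comp (mfderiv I J f t)))

section Poisson
universe uS
variable {EZ Z ES : Type*} {S : Type uS} {EX X : Type*}
  [NormedAddCommGroup EZ] [NormedSpace ℝ EZ] [TopologicalSpace Z] [ChartedSpace EZ Z]
  [NormedAddCommGroup ES] [NormedSpace ℝ ES] [TopologicalSpace S] [ChartedSpace ES S]
  [NormedAddCommGroup EX] [NormedSpace ℝ EX] [TopologicalSpace X] [ChartedSpace EX X]

/-- A connected injectively immersed manifold whose tangent spaces are the images of `w♯`. -/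
structure IsIntegralManifold (w : BivectorField 𝓘(ℝ, EZ) Z) (k : SmoothImmersion ES S EZ Z) :
    Prop where
  connected : ConnectedSpace S
  injective : Function.Injective k.map
  tangentImage_eq : ∀ s, k.tangentImage s = LinearMap.range (w.sharp (k.map s))

/-- A symplectic leaf: a maximal integral manifold of the characteristic distribution. -/
structure IsSymplecticLeaf (w : BivectorField 𝓘(ℝ, EZ) Z) (k : SmoothImmersion ES S EZ Z) :
    Prop extends IsIntegralManifold w k where
  maximal : ∀ (N : Type uS) [TopologicalSpace N] [ChartedSpace ES N] [IsManifold 𝓘(ℝ, ES) ∞ N]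
    (k' : SmoothImmersion ES N EZ Z), IsIntegralManifold w k' →
      (Set.range k'.map ∩ Set.range k.map).Nonempty → Set.range k'.map ⊆ Set.range k.map

namespace IsIntegralManifold

variable {w : BivectorField 𝓘(ℝ, EZ) Z} {k : SmoothImmersion ES S EZ Z}

/-- The map `T*Z → TS` induced by `w♯` at a point of the leaf. -/
def sharpToLeaf (h : IsIntegralManifold w k) (s : S) :
    (TangentSpace 𝓘(ℝ, EZ) (k.map s) →L[ℝ] ℝ) →ₗ[ℝ] TangentSpace 𝓘(ℝ, ES) s :=
  (LinearEquiv.ofInjective (k.deriv s).toLinearMap (k.injective_mfderiv s)).symm.toLinearMap ∘ₗ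
    LinearMap.codRestrict (k.tangentImage s) (w.sharp (k.map s))
      (fun l => by rw [h.tangentImage_eq]; exact ⟨l, rfl⟩)

theorem deriv_sharpToLeaf (h : IsIntegralManifold w k) (s : S)
    (l : TangentSpace 𝓘(ℝ, EZ) (k.map s) →L[ℝ] ℝ) :
    k.deriv s (h.sharpToLeaf s l) = w.sharp (k.map s) l := by
  have := LinearEquiv.apply_symm_apply
    (LinearEquiv.ofInjective (k.deriv s).toLinearMap (k.injective_mfderiv s))
    (LinearMap.codRestrict (k.tangentImage s) (w.sharp (k.map s))
      (fun l => by rw [h.tangentImage_eq]; exact ⟨l, rfl⟩) l)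
  exact congrArg Subtype.val this

theorem sharpToLeaf_surjective (h : IsIntegralManifold w k) (s : S) :
    Function.Surjective (h.sharpToLeaf s) := by
  intro u
  have : k.deriv s u ∈ LinearMap.range (w.sharp (k.map s)) := by
    rw [← h.tangentImage_eq]; exact ⟨u, rfl⟩
  obtain ⟨l, hl⟩ := this
  exact ⟨l, k.injective_mfderiv s ((h.deriv_sharpToLeaf s l).trans hl)⟩

theorem comp_deriv_eq (h : IsIntegralManifold w k) (s : S)
    {l l' : TangentSpace 𝓘(ℝ, EZ) (k.map s) →L[ℝ] ℝ}
    (hl : h.sharpToLeaf s l = h.sharpToLeaf s l') :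
    l.comp (k.deriv s) = l'.comp (k.deriv s) := by
  ext v
  obtain ⟨m, rfl⟩ := h.sharpToLeaf_surjective s v
  have e : ∀ l₀, l₀ (k.deriv s (h.sharpToLeaf s m)) = - m (k.deriv s (h.sharpToLeaf s l₀)) := by
    intro l₀
    rw [h.deriv_sharpToLeaf, h.deriv_sharpToLeaf]
    have := w.skew (k.map s) (l₀ + m)
    simp only [map_add, add_apply, w.skew] at this
    linarith
  simp only [ContinuousLinearMap.comp_apply]
  rw [e l, e l', hl]

/-- The symplectic form of the leaf, as `ω♭ : TS → T*S`. It is determined by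
`ω(w♯l, v) = l v` for covectors `l` of `Z` and tangent vectors `v` of the leaf. -/
def flat (h : IsIntegralManifold w k) (s : S) :
    TangentSpace 𝓘(ℝ, ES) s →ₗ[ℝ] TangentSpace 𝓘(ℝ, ES) s →L[ℝ] ℝ where
  toFun u := (Function.surjInv (h.sharpToLeaf_surjective s) u).comp (k.deriv s)
  map_add' u v := by
    rw [← ContinuousLinearMap.add_comp]
    exact h.comp_deriv_eq s (by simp [Function.surjInv_eq])
  map_smul' c u := by
    rw [RingHom.id_apply, ← ContinuousLinearMap.smul_comp]
    exact h.comp_deriv_eq s (by simp [Function.surjInv_eq])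

theorem flat_sharpToLeaf (h : IsIntegralManifold w k) (s : S)
    (l : TangentSpace 𝓘(ℝ, EZ) (k.map s) →L[ℝ] ℝ) :
    h.flat s (h.sharpToLeaf s l) = l.comp (k.deriv s) :=
  h.comp_deriv_eq s (Function.surjInv_eq _ _)

theorem flat_skew (h : IsIntegralManifold w k) (s : S) (u v : TangentSpace 𝓘(ℝ, ES) s) :
    h.flat s u v = - h.flat s v u := by
  obtain ⟨l, rfl⟩ := h.sharpToLeaf_surjective s u
  obtain ⟨m, rfl⟩ := h.sharpToLeaf_surjective s v
  rw [flat_sharpToLeaf, flat_sharpToLeaf]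
  simp only [ContinuousLinearMap.comp_apply]
  rw [h.deriv_sharpToLeaf, h.deriv_sharpToLeaf]
  have := w.skew (k.map s) (l + m)
  simp only [map_add, add_apply, w.skew] at this
  linarith

end IsIntegralManifold

variable (EZ Z ES S EX X) in
/-- A Lagrangian submanifold `X` of a symplectic leaf `S` of a Poisson manifold `Z`. The leaf is
an embedded submanifold of `Z`, and `X` is embedded in `S`. -/
structure LagrangianInLeaf where
  poisson : PoissonStructure 𝓘(ℝ, EZ) Z
  leaf : SmoothImmersion ES S EZ Z
  isLeaf : IsSymplecticLeaf poisson.toBivectorField leaf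
  leaf_isEmbedding : Topology.IsEmbedding leaf.map
  lag : SmoothImmersion EX X ES S
  lag_isEmbedding : Topology.IsEmbedding lag.map
  isLagrangian : ∀ (x : X) (v : TangentSpace 𝓘(ℝ, ES) (lag.map x)),
    v ∈ lag.tangentImage x ↔ ∀ u ∈ lag.tangentImage x, isLeaf.flat (lag.map x) v u = 0

namespace LagrangianInLeaf

variable (D : LagrangianInLeaf EZ Z ES S EX X)

/-- The Poisson bivector field of `Z`. -/
abbrev w : BivectorField 𝓘(ℝ, EZ) Z := D.poisson.toBivectorField

/-- The inclusion `j : X → Z`. -/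
def incl : SmoothImmersion EX X EZ Z := D.leaf.comp D.lag

/-- `E_X = (TX)⁰ ⊆ T*Z|_X`. -/
abbrev EFiber (x : X) : Submodule ℝ (TangentSpace 𝓘(ℝ, EZ) (D.incl.map x) →L[ℝ] ℝ) :=
  D.incl.Conormal x

/-- `L_X = (TS)⁰|_X ⊆ T*Z|_X`. -/
abbrev LFiber (x : X) : Submodule ℝ (TangentSpace 𝓘(ℝ, EZ) (D.incl.map x) →L[ℝ] ℝ) :=
  D.leaf.Conormal (D.lag.map x)

/-- The fibers of `E_X* = TZ|_X / TX`. -/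
abbrev EDual : X → Type _ := D.incl.NormalSpace

/-- The fibers of `L_X* = TZ|_X / TS|_X`. -/
abbrev LDual : X → Type _ := D.lag.map *ᵖ D.leaf.NormalSpace

/-- The symplectic form as a map `ω♭ : TX → (TX)⁰ ⊆ T*S`. -/
def flatX (x : X) : TangentSpace 𝓘(ℝ, EX) x →ₗ[ℝ] D.lag.Conormal x :=
  LinearMap.codRestrict (D.lag.Conormal x)
    (D.isLeaf.flat (D.lag.map x) ∘ₗ (D.lag.deriv x).toLinearMap)
    (fun u u' => (D.isLagrangian x _).1 ⟨u, rfl⟩ _ ⟨u', rfl⟩)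

theorem neg_sharp_mem (x : X) (l : D.EFiber x) :
    -(D.w.sharp (D.incl.map x) l) ∈ D.incl.tangentImage x := by
  have h := D.isLeaf.toIsIntegralManifold
  have e := h.deriv_sharpToLeaf (D.lag.map x) l.1
  have : h.sharpToLeaf (D.lag.map x) l.1 ∈ D.lag.tangentImage x := by
    rw [D.isLagrangian]
    rintro _ ⟨u, rfl⟩
    refine (DFunLike.congr_fun (h.flat_sharpToLeaf (D.lag.map x) l.1) _).trans ?_
    exact (congrArg l.1 (D.leaf.comp_deriv D.lag x u).symm).trans (l.2 u)
  obtain ⟨u, hu⟩ := this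
  refine Submodule.neg_mem _ ⟨u, ?_⟩
  refine Eq.trans ?_ e
  rw [← hu]
  exact D.leaf.comp_deriv D.lag x u

/-- The anchor `-w♯ : E_X → TX`. -/
def anchor (x : X) : D.EFiber x →ₗ[ℝ] TangentSpace 𝓘(ℝ, EX) x :=
  (LinearEquiv.ofInjective (D.incl.deriv x).toLinearMap
      (D.incl.injective_mfderiv x)).symm.toLinearMap ∘ₗ
    LinearMap.codRestrict (D.incl.tangentImage x)
      (-(D.w.sharp (D.incl.map x)) ∘ₗ (D.EFiber x).subtype) (D.neg_sharp_mem x)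

/-- The restriction of covectors `(TX)⁰ ⊆ T*Z → (TX)⁰ ⊆ T*S`. -/
def restrictToLeaf (x : X) : D.EFiber x →ₗ[ℝ] D.lag.Conormal x where
  toFun l := ⟨l.1.comp (D.leaf.deriv (D.lag.map x)), fun u =>
    (congrArg l.1 (D.leaf.comp_deriv D.lag x u).symm).trans (l.2 u)⟩
  map_add' _ _ := rfl
  map_smul' _ _ := rfl

variable [IsManifold 𝓘(ℝ, EZ) ∞ Z]

/-- A Hamiltonian with `dH = 0` along `X`. -/
structure CriticalFunction where
  toFun : C^∞⟮𝓘(ℝ, EZ), Z; 𝓘(ℝ, ℝ), ℝ⟯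
  critical : ∀ x, differential 𝓘(ℝ, EZ) toFun (D.incl.map x) = 0

namespace CriticalFunction

variable {D} (H : D.CriticalFunction)

theorem fderiv_localRep_eq_zero (x : X) :
    ∀ᶠ x' in 𝓝 x, fderiv ℝ (H.toFun ∘ (extChartAt 𝓘(ℝ, EZ) (D.incl.map x)).symm)
      (extChartAt 𝓘(ℝ, EZ) (D.incl.map x) (D.incl.map x')) = 0 := by
  have hc : ContinuousAt D.incl.map x := D.incl.map.contMDiff.continuous.continuousAt
  filter_upwards [hc (extChartAt_source_mem_nhds (I := 𝓘(ℝ, EZ)) (D.incl.map x))] with x' hx'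
  set φ := extChartAt 𝓘(ℝ, EZ) (D.incl.map x)
  have h1 : MDifferentiableAt 𝓘(ℝ, EZ) 𝓘(ℝ, ℝ) H.toFun (φ.symm (φ (D.incl.map x'))) :=
    H.toFun.contMDiff.mdifferentiable (by simp) _
  have h2 : MDifferentiableAt 𝓘(ℝ, EZ) 𝓘(ℝ, EZ) φ.symm (φ (D.incl.map x')) :=
    ((contMDiffOn_extChartAt_symm (n := ∞) (I := 𝓘(ℝ, EZ)) (D.incl.map x)).contMDiffAt
      ((isOpen_extChartAt_target (I := 𝓘(ℝ, EZ)) (D.incl.map x)).mem_nhds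
        (φ.map_source hx'))).mdifferentiableAt (by simp)
  have h3 := mfderiv_comp _ h1 h2
  rw [mfderiv_eq_fderiv] at h3
  refine h3.trans ?_
  have h4 : mfderiv 𝓘(ℝ, EZ) 𝓘(ℝ, ℝ) H.toFun (φ.symm (φ (D.incl.map x'))) = 0 := by
    rw [φ.left_inv hx']; exact H.critical x'
  rw [h4]
  exact ContinuousLinearMap.zero_comp _

theorem contDiffAt_localRep (z : Z) :
    ContDiffAt ℝ ∞ (H.toFun ∘ (extChartAt 𝓘(ℝ, EZ) z).symm) (extChartAt 𝓘(ℝ, EZ) z z) := by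
  refine contMDiffAt_iff_contDiffAt.1 (ContMDiffAt.comp _ H.toFun.contMDiff.contMDiffAt ?_)
  exact (contMDiffOn_extChartAt_symm (n := ∞) (I := 𝓘(ℝ, EZ)) z).contMDiffAt
    ((isOpen_extChartAt_target (I := 𝓘(ℝ, EZ)) z).mem_nhds (mem_extChartAt_target z))

theorem hessian_deriv (x : X) (u : TangentSpace 𝓘(ℝ, EX) x) :
    hessian 𝓘(ℝ, EZ) H.toFun (D.incl.map x) (D.incl.deriv x u) = 0 := by
  set φ := extChartAt 𝓘(ℝ, EZ) (D.incl.map x)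
  set F := fderiv ℝ (H.toFun ∘ φ.symm)
  have hF : DifferentiableAt ℝ F (φ (D.incl.map x)) :=
    ((H.contDiffAt_localRep _).fderiv_right (m := 1) (by norm_cast)).differentiableAt (by simp)
  have hφ : MDifferentiableAt 𝓘(ℝ, EZ) 𝓘(ℝ, EZ) φ (D.incl.map x) :=
    (contMDiffAt_extChartAt (n := ∞) (I := 𝓘(ℝ, EZ))).mdifferentiableAt (by simp)
  have hj : MDifferentiableAt 𝓘(ℝ, EX) 𝓘(ℝ, EZ) D.incl.map x :=
    D.incl.map.contMDiff.mdifferentiable (by simp) _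
  have h0 : (F ∘ φ) ∘ D.incl.map =ᶠ[𝓝 x] fun _ => (0 : EZ →L[ℝ] ℝ) := H.fderiv_localRep_eq_zero x
  have h1 : mfderiv 𝓘(ℝ, EX) 𝓘(ℝ, EZ →L[ℝ] ℝ) ((F ∘ φ) ∘ D.incl.map) x = 0 :=
    h0.mfderiv_eq.trans mfderiv_const
  rw [mfderiv_comp x (hF.mdifferentiableAt.comp _ hφ) hj,
    mfderiv_comp _ hF.mdifferentiableAt hφ, mfderiv_extChartAt_self, mfderiv_eq_fderiv] at h1
  exact DFunLike.congr_fun h1 u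

theorem hessian_symm (z : Z) (u v : TangentSpace 𝓘(ℝ, EZ) z) :
    hessian 𝓘(ℝ, EZ) H.toFun z u v = hessian 𝓘(ℝ, EZ) H.toFun z v u :=
  ((H.contDiffAt_localRep z).isSymmSndFDerivAt (by simp; exact WithTop.coe_le_coe.2 le_top)) u v

/-- The vertical part of `T(dH)` on `TS|_X`. -/
def tVTangent (x : X) : TangentSpace 𝓘(ℝ, ES) (D.lag.map x) →ₗ[ℝ] D.EFiber x :=
  LinearMap.codRestrict (D.EFiber x)
    ((hessian 𝓘(ℝ, EZ) H.toFun (D.incl.map x)).toLinearMap ∘ₗ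
      (D.leaf.deriv (D.lag.map x)).toLinearMap)
    (fun _ u => (H.hessian_symm (D.incl.map x) _ _).trans
      (DFunLike.congr_fun (H.hessian_deriv x u) _))

theorem tVTangent_deriv (x : X) (u : TangentSpace 𝓘(ℝ, EX) x) :
    H.tVTangent x (D.lag.deriv x u) = 0 := by
  refine Subtype.ext (Eq.trans ?_ (H.hessian_deriv x u))
  exact congrArg (hessian 𝓘(ℝ, EZ) H.toFun (D.incl.map x)) (D.leaf.comp_deriv D.lag x u).symm

/-- The bundle map `t^V H : TS|_X / TX → E_X` induced by the vertical part of `T(dH)`. -/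
def tV (x : X) : D.lag.NormalSpace x →ₗ[ℝ] D.EFiber x :=
  (D.lag.tangentImage x).liftQ (M₂ := D.EFiber x) (τ₁₂ := RingHom.id ℝ) (H.tVTangent x) (by
    rintro _ ⟨u, rfl⟩
    exact LinearMap.mem_ker.2 (H.tVTangent_deriv x u))

/-- The composition `t^V H_0 : TS|_X / TX → (TX)⁰ ⊆ T*S` of `t^V H` with the restriction to `TS`. -/
def tV₀ (x : X) : D.lag.NormalSpace x →ₗ[ℝ] D.lag.Conormal x :=
  D.restrictToLeaf x ∘ₗ H.tV x

end CriticalFunction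


/-- A Hamiltonian with `dH = 0` along `X` and invertible `t^V H_0`. -/
structure AdmissibleHamiltonian extends D.CriticalFunction where
  bijective_tV₀ : ∀ x, Function.Bijective (toCriticalFunction.tV₀ x)

namespace AdmissibleHamiltonian

/-- `α_H = t^V H ∘ (t^V H_0)⁻¹ ∘ (-ω♭) : TX → E_X`. -/
def alpha {D : LagrangianInLeaf EZ Z ES S EX X} (H : D.AdmissibleHamiltonian) (x : X) :
    TangentSpace 𝓘(ℝ, EX) x →ₗ[ℝ] D.EFiber x :=
  H.tV x ∘ₗ (LinearEquiv.ofBijective (H.tV₀ x) (H.bijective_tV₀ x)).symm.toLinearMap ∘ₗ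
    D.flatX x ∘ₗ (-LinearMap.id)

end AdmissibleHamiltonian

variable [FiniteDimensional ℝ EZ] [FiniteDimensional ℝ ES] [FiniteDimensional ℝ EX]
  [IsManifold 𝓘(ℝ, ES) ∞ S] [IsManifold 𝓘(ℝ, EX) ∞ X]

/-- The total space `Z'` of the vector bundle `E_X* = TZ|_X / TX`. -/
abbrev EStar : Type _ := TotalSpace D.incl.NormalFiber D.EDual

/-- The total space of the vector bundle `L_X* = TZ|_X / TS|_X`. -/
abbrev LStar : Type _ := TotalSpace D.leaf.NormalFiber D.LDual

/-- The total space of the vector bundle `L_X^π = T*X ⊕ L_X*`. -/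
abbrev LPi : Type _ :=
  TotalSpace ((EX →L[ℝ] ℝ) × D.leaf.NormalFiber)
    ((fun x : X => TangentSpace 𝓘(ℝ, EX) x →L[ℝ] Trivial X ℝ x) ×ᵇ D.LDual)

/-- The model of the manifold `Z' = E_X*`. -/
abbrev IEStar := 𝓘(ℝ, EX).prod 𝓘(ℝ, D.incl.NormalFiber)

/-- The model of the manifold `L_X*`. -/
abbrev ILStar := 𝓘(ℝ, EX).prod 𝓘(ℝ, D.leaf.NormalFiber)

/-- The model of the manifold `T*X`. -/
abbrev ICot (_ : LagrangianInLeaf EZ Z ES S EX X) := 𝓘(ℝ, EX).prod 𝓘(ℝ, EX →L[ℝ] ℝ)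

/-- The model of the manifold `L_X^π`. -/
abbrev ILPi := 𝓘(ℝ, EX).prod 𝓘(ℝ, (EX →L[ℝ] ℝ) × D.leaf.NormalFiber)

/-- The projection `l : Z' = TZ|_X / TX → L_X* = TZ|_X / TS|_X`, dual to `L_X ⊆ E_X`. -/
def toLStar (t : D.EStar) : D.LStar := ⟨t.1, D.leaf.normalProj D.lag t.1 t.2⟩

/-- The natural projection `pr₁ : L_X^π → T*X`. -/
def pr₁ (q : D.LPi) : CotangentSpace 𝓘(ℝ, EX) X := ⟨q.1, q.2.1⟩

/-- The natural projection `pr₂ : L_X^π → L_X*`. -/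
def pr₂ (q : D.LPi) : D.LStar := ⟨q.1, q.2.2⟩

/-- The fiberwise linear function `bar A : Z' → ℝ` of a section `A` of `E_X`. -/
def bar (A : ∀ x, D.EFiber x) (t : D.EStar) : ℝ := D.incl.pairing t.1 (A t.1) t.2

/-- The Sternberg-Weinstein structure on `Z' = E_X*`: the bivector field whose bracket is dual to
the Lie algebroid `E_X`, whose anchor is `-w♯` and whose bracket is the restriction to `X` of the
bracket of 1-forms of `Z`. -/
structure IsSternbergWeinstein (w' : BivectorField D.IEStar D.EStar) : Prop where
  bracket_base_base : ∀ (f g : C^∞⟮𝓘(ℝ, EX), X; 𝓘(ℝ, ℝ), ℝ⟯) (t : D.EStar),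
    w'.bracket (fun s => f s.1) (fun s => g s.1) t = 0
  bracket_bar_base : ∀ (A : OneForm 𝓘(ℝ, EZ) Z) (hA : ∀ x, A (D.incl.map x) ∈ D.EFiber x)
    (f : C^∞⟮𝓘(ℝ, EX), X; 𝓘(ℝ, ℝ), ℝ⟯) (t : D.EStar),
    w'.bracket (D.bar fun x => ⟨A (D.incl.map x), hA x⟩) (fun s => f s.1) t =
      differential 𝓘(ℝ, EX) f t.1 (D.anchor t.1 ⟨A (D.incl.map t.1), hA t.1⟩)
  bracket_bar_bar : ∀ (A B : OneForm 𝓘(ℝ, EZ) Z) (hA : ∀ x, A (D.incl.map x) ∈ D.EFiber x)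
    (hB : ∀ x, B (D.incl.map x) ∈ D.EFiber x) (x : X)
    (v : TangentSpace 𝓘(ℝ, EZ) (D.incl.map x)),
    w'.bracket (D.bar fun x => ⟨A (D.incl.map x), hA x⟩)
        (D.bar fun x => ⟨B (D.incl.map x), hB x⟩) ⟨x, D.incl.proj x v⟩ =
      D.w.formBracket A B (D.incl.map x) v

/-- The Lie brackets `[df, dg] = d{f, g}` of the isotropy Lie algebras `L_x`, `x ∈ X`. -/
def IsIsotropyBracket (br : ∀ x, D.LFiber x →ₗ[ℝ] D.LFiber x →ₗ[ℝ] D.LFiber x) : Prop :=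
  ∀ (x : X) (f g : C^∞⟮𝓘(ℝ, EZ), Z; 𝓘(ℝ, ℝ), ℝ⟯)
    (hf : differential 𝓘(ℝ, EZ) f (D.incl.map x) ∈ D.LFiber x)
    (hg : differential 𝓘(ℝ, EZ) g (D.incl.map x) ∈ D.LFiber x),
    (br x ⟨_, hf⟩ ⟨_, hg⟩ : TangentSpace 𝓘(ℝ, EZ) (D.incl.map x) →L[ℝ] ℝ) =
      differential 𝓘(ℝ, EZ) (D.w.bracket f g) (D.incl.map x)

namespace AdmissibleHamiltonian

variable {D} (H : D.AdmissibleHamiltonian)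

/-- The curvature `Φ(𝒳₁, 𝒳₂) = {α_H 𝒳₁, α_H 𝒳₂} - α_H [𝒳₁, 𝒳₂] ∈ L_X` of `α_H`. -/
def IsCurvature (Φ : ∀ x, TangentSpace 𝓘(ℝ, EX) x →ₗ[ℝ] TangentSpace 𝓘(ℝ, EX) x →ₗ[ℝ] D.LFiber x) :
    Prop :=
  ∀ (U V : VField 𝓘(ℝ, EX) X) (A B : OneForm 𝓘(ℝ, EZ) Z),
    (∀ x, A (D.incl.map x) = H.alpha x (U x)) → (∀ x, B (D.incl.map x) = H.alpha x (V x)) →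
    ∀ x, (Φ x (U x) (V x) : TangentSpace 𝓘(ℝ, EZ) (D.incl.map x) →L[ℝ] ℝ) =
      D.w.formBracket A B (D.incl.map x) -
        H.alpha x (VectorField.mlieBracket 𝓘(ℝ, EX) U V x)

/-- The map `ψ_H = (α_H*, l) : Z' → L_X^π`. -/
def psi (t : D.EStar) : D.LPi :=
  ⟨t.1, LinearMap.toContinuousLinearMap
    ((D.incl.pairing t.1).flip t.2 ∘ₗ H.alpha t.1),
    (D.toLStar t).2⟩

/-- The horizontal lift `hor_H(𝒳) = -l_* X_{bar (α_H 𝒳)}` from `X` to `L_X*`, where the Hamiltonian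
vector field `X_f = w'♯ df` is the one of the Poisson structure of `Z'`. -/
def IsHor (w' : BivectorField D.IEStar D.EStar)
    (hor : ∀ n : D.LStar, TangentSpace 𝓘(ℝ, EX) n.1 →ₗ[ℝ] TangentSpace D.ILStar n) : Prop :=
  ∀ (U : VField 𝓘(ℝ, EX) X) (t : D.EStar),
    hor (D.toLStar t) (U t.1) = -mfderiv D.IEStar D.ILStar D.toLStar t
      (w'.sharp t (differential D.IEStar (D.bar fun x => H.alpha x (U x)) t))

end AdmissibleHamiltonian

/-- The horizontal lift `hor_H^π` from `T*X` to `L_X^π`: `pr₁_* (hor_H^π Y) = Y` and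
`pr₂_* (hor_H^π Y) = hor_H (π_* Y)`, where `π : T*X → X`. -/
def IsHorPi (hor : ∀ n : D.LStar, TangentSpace 𝓘(ℝ, EX) n.1 →ₗ[ℝ] TangentSpace D.ILStar n)
    (horPi : ∀ q : D.LPi, TangentSpace D.ICot (D.pr₁ q) →L[ℝ] TangentSpace D.ILPi q) : Prop :=
  ∀ (q : D.LPi) (Y : TangentSpace D.ICot (D.pr₁ q)),
    mfderiv D.ILPi D.ICot D.pr₁ q (horPi q Y) = Y ∧
    mfderiv D.ILPi D.ILStar D.pr₂ q (horPi q Y) =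
      hor (D.pr₂ q) (mfderiv D.ICot 𝓘(ℝ, EX)
        (TotalSpace.proj : CotangentSpace 𝓘(ℝ, EX) X → X) (D.pr₁ q) Y)


/-- The part in `T_x X` of a covector of `L_X^π`: the restriction of the covector to the vertical
tangent space `T_x* X` of `T*X`. -/
def cotangentPart (q : D.LPi) (a : TangentSpace D.ILPi q →L[ℝ] ℝ) : TangentSpace 𝓘(ℝ, EX) q.1 :=
  (Module.evalEquiv ℝ (TangentSpace 𝓘(ℝ, EX) q.1)).symm
    ((verticalPart q a ∘L ContinuousLinearMap.inl ℝ (TangentSpace 𝓘(ℝ, EX) q.1 →L[ℝ] ℝ)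
      (D.LDual q.1)).toLinearMap ∘ₗ LinearMap.toContinuousLinearMap.toLinearMap)

/-- The part in `L_x` of a covector of `L_X^π`: the restriction of the covector to the vertical
tangent space `L_x*` of `L_X*`. -/
def isotropyPart (q : D.LPi) (a : TangentSpace D.ILPi q →L[ℝ] ℝ) : D.LFiber q.1 :=
  D.leaf.toConormal (D.lag.map q.1) (verticalPart q a ∘L
    ContinuousLinearMap.inr ℝ (TangentSpace 𝓘(ℝ, EX) q.1 →L[ℝ] ℝ) (D.LDual q.1))

/-- The horizontal lift `hor_H^π ∘ w_{T*X}` of the canonical Poisson tensor of `T*X`. -/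
def liftedCanonicalTensor
    (horPi : ∀ q : D.LPi, TangentSpace D.ICot (D.pr₁ q) →L[ℝ] TangentSpace D.ILPi q)
    (q : D.LPi) (a b : TangentSpace D.ILPi q →L[ℝ] ℝ) : ℝ :=
  (a.comp (horPi q)) (canonicalSharp 𝓘(ℝ, EX) (D.pr₁ q) (b.comp (horPi q)))

/-- The vertical bivector of an `L_X`-valued 2-form `Φ` on `X`: constant along the fibers in the
two directions of `T*X`, and linear in the point of `L_X*`. -/
def verticalTensor
    (Φ : ∀ x, TangentSpace 𝓘(ℝ, EX) x →ₗ[ℝ] TangentSpace 𝓘(ℝ, EX) x →ₗ[ℝ] D.LFiber x)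
    (q : D.LPi) (a b : TangentSpace D.ILPi q →L[ℝ] ℝ) : ℝ :=
  D.leaf.pairing (D.lag.map q.1) (Φ q.1 (D.cotangentPart q a) (D.cotangentPart q b)) q.2.2

/-- The fiberwise Lie-Poisson tensor of `L_X*`: `w(df, dg)(n) = ⟨n, [d_n f, d_n g]⟩`. -/
def liePoissonTensor (br : ∀ x, D.LFiber x →ₗ[ℝ] D.LFiber x →ₗ[ℝ] D.LFiber x)
    (q : D.LPi) (a b : TangentSpace D.ILPi q →L[ℝ] ℝ) : ℝ :=
  D.leaf.pairing (D.lag.map q.1) (br q.1 (D.isotropyPart q a) (D.isotropyPart q b)) q.2.2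

end LagrangianInLeaf
end Poisson

end

/-! Every tensor in the statement is determined by its values on a spanning family of covectors, and
all the covectors needed come from global functions on `Z`. Because `X` and `S` are embedded, each
element of `E_X` (of `L_X`) over a point is `dG` for a smooth function `G` that vanishes on `X` (on
`S`); this is `SmoothImmersion.exists_vanishing_function`. On exact forms the bracket of 1-forms is
`d{F,G}`, and `{F,G}` again vanishes on `X`, since Hamiltonian fields of functions vanishing on `X`
are tangent to `X`. The covectors of `Z'` are then the differentials of `f ∘ τ + bar dG`, and the
Sternberg–Weinstein tensor is defined by its values on them. It is well defined by
`symbolBracket_of_covector_eq_zero`: if `f ∘ τ + bar A` is critical at `t`, then `A` vanishes at the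
base point, `{A,B}` reduces to a first derivative of `A`, and this cancels the term with `df`.

The Hamiltonian enters through one observation. Where `dH = 0`, the differential of `{H,F}` is the
Hessian of `H` applied to `X_F`. So along all of `X` the differential of `{H,F}` lies in the image
of `t^V H`, which is the image of `α_H`. Since `α_H` splits the anchor `-w♯`, these functions,
called horizontal, realise every value of `α_H` (`exists_horizontal`). Smoothness of `ψ_H` and the
existence of the curvature and of the horizontal lift are obtained by testing on them. By the Jacobi
identity, `[field K, field K'] = field {K,K'}` (`mlieBracket_field`), and the curvature on such
fields is the `L_X` component of `d{K,K'}` in `E_X = α_H(TX) ⊕ L_X`.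

For the final formula, covectors of `L_X^π` are differentials of (momentum of `field K`) + `f` +
`bar G`, with `K` horizontal and `G` vanishing on `S`; `ψ_H` pulls them back to the differential of
`f ∘ τ + bar d(K + G)` (`piCovector_comp_psi`). In the bracket of two of these, `{K,K'}` contributes
the canonical bracket of momenta through its `α_H` part and the curvature through its `L_X` part.
The terms of `K` with `f` and `G` are the horizontal lift, and `{G,G'}` is the isotropy bracket. -/

noncomputable section

set_option linter.unusedSectionVars false

/-! ### Smooth families of linear maps and linear equations. -/

section Smoothness

variable {E H M : Type*} [NormedAddCommGroup E] [NormedSpace ℝ E] [TopologicalSpace H]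
  {I : ModelWithCorners ℝ E H} [TopologicalSpace M] [ChartedSpace H M]
  {V W : Type*} [NormedAddCommGroup V] [NormedSpace ℝ V] [NormedAddCommGroup W] [NormedSpace ℝ W]

/-- In finite dimension `T q` is a sum of rank-one maps with fixed coordinate functionals and
coefficients `T q (b i)`, so only the values on a basis matter. -/
theorem ContMDiffAt.clm_of_forall_apply [FiniteDimensional ℝ V] {n : WithTop ℕ∞}
    {T : M → V →L[ℝ] W} {p : M}
    (h : ∀ v, ContMDiffAt I 𝓘(ℝ, W) n (fun q => T q v) p) :
    ContMDiffAt I 𝓘(ℝ, V →L[ℝ] W) n T p := by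
  let b := Module.finBasis ℝ V
  have e : T = fun q => ∑ i, ContinuousLinearMap.smulRightL ℝ V W
      (LinearMap.toContinuousLinearMap (b.coord i)) (T q (b i)) := by
    funext q
    ext v
    conv_lhs => rw [← b.sum_repr v, map_sum]
    simp
  rw [e]
  refine contMDiffAt_finsetSum fun i _ => ?_
  exact (ContinuousLinearMap.contMDiffAt _).comp p (h (b i))

/-- The solution of a smooth family of linear equations is smooth. -/
theorem ContMDiffAt.of_clm_apply [CompleteSpace V] [CompleteSpace W] {n : WithTop ℕ∞}
    {T : M → V →L[ℝ] W} {y : M → V} {p : M} (hT : ContMDiffAt I 𝓘(ℝ, V →L[ℝ] W) n T p)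
    (hb : Function.Bijective (T p))
    (h : ContMDiffAt I 𝓘(ℝ, W) n (fun q => T q (y q)) p) :
    ContMDiffAt I 𝓘(ℝ, V) n y p := by
  let e : V ≃L[ℝ] W := ContinuousLinearEquiv.ofBijective (T p)
    (LinearMap.ker_eq_bot.2 hb.1) (LinearMap.range_eq_top.2 hb.2)
  have he : (e : V →L[ℝ] W) = T p := ContinuousLinearEquiv.coe_ofBijective ..
  have hi : ContMDiffAt I 𝓘(ℝ, W →L[ℝ] V) n (fun q => (T q).inverse) p := by
    have := (contDiffAt_map_inverse (n := n) e).contMDiffAt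
    rw [he] at this
    exact this.comp p hT
  refine (hi.clm_apply h).congr_of_eventuallyEq ?_
  -- `inverse` is zero at maps that are not invertible. Invertible maps form an open set, so near
  -- `p` it is the true inverse.
  have := hT.continuousAt.preimage_mem_nhds (he ▸ ContinuousLinearEquiv.nhds e)
  filter_upwards [this] with q ⟨e', he'⟩
  rw [← he']
  simp

/-- The solution is `(T q).inverse (z q)`. It solves the equation only near `p`, where invertibility
persists. -/
theorem ContMDiffAt.exists_clm_apply_eq [CompleteSpace V] [CompleteSpace W] {n : WithTop ℕ∞}
    {T : M → V →L[ℝ] W} {z : M → W} {p : M} (hT : ContMDiffAt I 𝓘(ℝ, V →L[ℝ] W) n T p)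
    (hb : Function.Bijective (T p)) (h : ContMDiffAt I 𝓘(ℝ, W) n z p) :
    ∃ y : M → V, ContMDiffAt I 𝓘(ℝ, V) n y p ∧ ∀ᶠ q in 𝓝 p, T q (y q) = z q := by
  let e : V ≃L[ℝ] W := ContinuousLinearEquiv.ofBijective (T p)
    (LinearMap.ker_eq_bot.2 hb.1) (LinearMap.range_eq_top.2 hb.2)
  have he : (e : V →L[ℝ] W) = T p := ContinuousLinearEquiv.coe_ofBijective ..
  have key : ∀ᶠ q in 𝓝 p, T q ((T q).inverse (z q)) = z q := by
    have := hT.continuousAt.preimage_mem_nhds (he ▸ ContinuousLinearEquiv.nhds e)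
    filter_upwards [this] with q ⟨e', he'⟩
    rw [← he']
    simp
  exact ⟨_, hT.of_clm_apply hb (h.congr_of_eventuallyEq key), key⟩

end Smoothness

/-! ### Differentials of functions. -/

section Functions

variable {E H M : Type*} [NormedAddCommGroup E] [NormedSpace ℝ E] [TopologicalSpace H]
  {I : ModelWithCorners ℝ E H} [TopologicalSpace M] [ChartedSpace H M]

theorem differential_congr {f g : M → ℝ} {p : M} (h : f =ᶠ[𝓝 p] g) :
    differential I f p = differential I g p :=
  h.mfderiv_eq

theorem differential_const (c : ℝ) (p : M) : differential I (fun _ : M => c) p = 0 :=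
  mfderiv_const

theorem differential_add {f g : M → ℝ} {p : M} (hf : MDifferentiableAt I 𝓘(ℝ, ℝ) f p)
    (hg : MDifferentiableAt I 𝓘(ℝ, ℝ) g p) :
    differential I (fun q => f q + g q) p = differential I f p + differential I g p :=
  mfderiv_add hf hg

theorem differential_neg (f : M → ℝ) (p : M) :
    differential I (fun q => - f q) p = - differential I f p :=
  mfderiv_neg

theorem differential_const_smul {f : M → ℝ} {p : M} (c : ℝ)
    (hf : MDifferentiableAt I 𝓘(ℝ, ℝ) f p) :
    differential I (fun q => c * f q) p = c • differential I f p :=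
  const_smul_mfderiv hf c

variable {E' H' M' : Type*} [NormedAddCommGroup E'] [NormedSpace ℝ E'] [TopologicalSpace H']
  {I' : ModelWithCorners ℝ E' H'} [TopologicalSpace M'] [ChartedSpace H' M']

theorem differential_comp {f : M' → ℝ} {g : M → M'} {p : M}
    (hf : MDifferentiableAt I' 𝓘(ℝ, ℝ) f (g p)) (hg : MDifferentiableAt I I' g p) :
    differential I (fun q => f (g q)) p = (differential I' f (g p)).comp (mfderiv I I' g p) :=
  mfderiv_comp p hf hg

theorem ContMDiffMap.mdiffAt (f : C^∞⟮I, M; I', M'⟯) (p : M) : MDifferentiableAt I I' f p :=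
  f.contMDiff.mdifferentiable (by simp) p

/-- The differential at `p` as a linear map on smooth functions. -/
def differentialAt (I : ModelWithCorners ℝ E H) (p : M) :
    C^∞⟮I, M; 𝓘(ℝ, ℝ), ℝ⟯ →ₗ[ℝ] TangentSpace I p →L[ℝ] ℝ where
  toFun f := differential I f p
  map_add' f g := differential_add (f.mdiffAt p) (g.mdiffAt p)
  map_smul' c f := differential_const_smul c (f.mdiffAt p)

@[simp] theorem differentialAt_apply (p : M) (f : C^∞⟮I, M; 𝓘(ℝ, ℝ), ℝ⟯) :
    differentialAt I p f = differential I f p := rfl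

end Functions

/-! ### Global functions with prescribed differential at a point. -/

section Bump

variable {E M : Type*} [NormedAddCommGroup E] [NormedSpace ℝ E] [FiniteDimensional ℝ E]
  [TopologicalSpace M] [ChartedSpace E M] [IsManifold 𝓘(ℝ, E) ∞ M] [T2Space M]

/-- A function that is smooth on a chart can be cut off to a smooth function, which agrees with the
given one near the centre and vanishes outside of a given neighbourhood. -/
theorem exists_contMDiffMap_cutoff {p : M} {f : E → ℝ} {s : Set E} (hs : s ∈ 𝓝 (extChartAt 𝓘(ℝ, E) p p))
    (hf : ContDiffOn ℝ ∞ f s) {u : Set M} (hu : u ∈ 𝓝 p) :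
    ∃ (χ : M → ℝ) (g : C^∞⟮𝓘(ℝ, E), M; 𝓘(ℝ, ℝ), ℝ⟯),
      (∀ q, g q = χ q * f (extChartAt 𝓘(ℝ, E) p q)) ∧
      (∀ᶠ q in 𝓝 p, g q = f (extChartAt 𝓘(ℝ, E) p q)) ∧ ∀ q, q ∉ u → χ q = 0 := by
  obtain ⟨s', hs's, hs'o, hs'⟩ := mem_nhds_iff.1 hs
  have hu' : u ∩ ((chartAt E p).source ∩ extChartAt 𝓘(ℝ, E) p ⁻¹' s') ∈ 𝓝 p :=
    Filter.inter_mem hu (Filter.inter_mem (chart_source_mem_nhds E p)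
      ((continuousAt_extChartAt p).preimage_mem_nhds (hs'o.mem_nhds hs')))
  obtain ⟨χ, -, hχ⟩ := (SmoothBumpFunction.nhds_basis_tsupport (I := 𝓘(ℝ, E)) p).mem_iff.1 hu'
  have hg : ContMDiff 𝓘(ℝ, E) 𝓘(ℝ, ℝ) ∞ fun q => χ q * f (extChartAt 𝓘(ℝ, E) p q) := by
    -- Smoothness has to be checked only on the closed support of the cutoff, which lies in the
    -- chart and in the region where `f` is smooth.
    refine contMDiff_of_tsupport fun q hq => ?_
    have hq' := hχ (tsupport_mul_subset_left hq)
    have h1 : ContMDiffAt 𝓘(ℝ, E) 𝓘(ℝ, E) ∞ (extChartAt 𝓘(ℝ, E) p) q :=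
      contMDiffAt_extChartAt' hq'.2.1
    have h2 : ContMDiffAt 𝓘(ℝ, E) 𝓘(ℝ, ℝ) ∞ f (extChartAt 𝓘(ℝ, E) p q) :=
      (hf.contDiffAt (Filter.mem_of_superset (hs'o.mem_nhds hq'.2.2) hs's)).contMDiffAt
    exact χ.contMDiffAt.mul (h2.comp q h1)
  refine ⟨χ, ⟨_, hg⟩, fun q => rfl, ?_, fun q hq => ?_⟩
  · filter_upwards [χ.eventuallyEq_one] with q hq
    change χ q * f (extChartAt 𝓘(ℝ, E) p q) = _
    rw [hq, Pi.one_apply, one_mul]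
  · by_contra h
    exact hq (hχ (subset_tsupport _ h)).1

/-- Cut off the linear function `c` of the chart at `p`; that chart has the identity as its
derivative at `p`. -/
theorem exists_differential_eq (p : M) (c : TangentSpace 𝓘(ℝ, E) p →L[ℝ] ℝ) :
    ∃ f : C^∞⟮𝓘(ℝ, E), M; 𝓘(ℝ, ℝ), ℝ⟯, differential 𝓘(ℝ, E) f p = c := by
  let c' : E →L[ℝ] ℝ := c
  obtain ⟨χ, g, -, hg, -⟩ := exists_contMDiffMap_cutoff (p := p) (f := c') Filter.univ_mem
    c'.contDiff.contDiffOn Filter.univ_mem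
  refine ⟨g, (differential_congr hg).trans ?_⟩
  refine (differential_comp (I' := 𝓘(ℝ, E)) (f := c') (g := extChartAt 𝓘(ℝ, E) p)
    c'.mdifferentiableAt (mdifferentiableAt_extChartAt (mem_chart_source _ _))).trans ?_
  rw [mfderiv_extChartAt_self]
  refine (ContinuousLinearMap.comp_id _).trans ?_
  exact c'.mfderiv_eq

/-- A linear choice of smooth functions with prescribed differential at a point. -/
theorem exists_linear_differential_eq (p : M) :
    ∃ F : (TangentSpace 𝓘(ℝ, E) p →L[ℝ] ℝ) →ₗ[ℝ] C^∞⟮𝓘(ℝ, E), M; 𝓘(ℝ, ℝ), ℝ⟯,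
      ∀ c, differential 𝓘(ℝ, E) (F c) p = c := by
  obtain ⟨F, hF⟩ := (differentialAt 𝓘(ℝ, E) p).exists_rightInverse_of_surjective
    (LinearMap.range_eq_top.2 (exists_differential_eq p))
  exact ⟨F, LinearMap.congr_fun hF⟩

end Bump

/-! ### Covector fields in local trivializations and frames of exact forms. -/

section Forms

variable {E H M : Type*} [NormedAddCommGroup E] [NormedSpace ℝ E] [TopologicalSpace H]
  {I : ModelWithCorners ℝ E H} [TopologicalSpace M] [ChartedSpace H M] [IsManifold I ∞ M]

/-- A field of covectors in the trivialization of the tangent bundle around `p`. -/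
def formCoord (p : M) (α : ∀ q : M, TangentSpace I q →L[ℝ] ℝ) (q : M) : E →L[ℝ] ℝ :=
  (α q).comp ((trivializationAt E (TangentSpace I) p).symmL ℝ q)

/-- The tangent space at `p` is the model space read in the chart at `p`, which is also the chart of
this trivialization; the coordinate change is trivial. -/
theorem tangent_symmL_self (p : M) (v : E) :
    (trivializationAt E (TangentSpace I) p).symmL ℝ p v = v := by
  rw [TangentBundle.symmL_trivializationAt_eq_core (mem_chart_source H p)]
  exact (tangentBundleCore I M).coordChange_self _ _ (mem_chart_source H p) v

theorem tangent_continuousLinearMapAt_self (p : M) (v : TangentSpace I p) :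
    (trivializationAt E (TangentSpace I) p).continuousLinearMapAt ℝ p v = v := by
  rw [TangentBundle.continuousLinearMapAt_trivializationAt_eq_core (mem_chart_source H p)]
  exact (tangentBundleCore I M).coordChange_self _ _ (mem_chart_source H p) v

theorem formCoord_self (p : M) (α : ∀ q : M, TangentSpace I q →L[ℝ] ℝ) : formCoord p α p = α p := by
  ext v
  exact congrArg (α p) (tangent_symmL_self p v)

theorem formCoord_apply {p q : M} (α : ∀ q : M, TangentSpace I q →L[ℝ] ℝ)
    (hq : q ∈ (chartAt H p).source) (v : TangentSpace I q) :
    formCoord p α q ((trivializationAt E (TangentSpace I) p).continuousLinearMapAt ℝ q v) = α q v :=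
  congrArg (α q) (Trivialization.symmL_continuousLinearMapAt _ (by simpa using hq) v)

theorem inCoordinates_eq_formCoord (p : M) (α : ∀ q : M, TangentSpace I q →L[ℝ] ℝ) (q : M) :
    ContinuousLinearMap.inCoordinates E (TangentSpace I) ℝ (Trivial M ℝ) p q p q (α q) =
      formCoord p α q := by
  ext v
  simp [ContinuousLinearMap.inCoordinates, formCoord]

theorem contMDiffAt_formCoord_iff {α : ∀ q : M, TangentSpace I q →L[ℝ] ℝ} {p : M} :
    ContMDiffAt I (I.prod 𝓘(ℝ, E →L[ℝ] ℝ)) ∞ (fun q => (⟨q, α q⟩ : CotangentSpace I M)) p ↔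
      ContMDiffAt I 𝓘(ℝ, E →L[ℝ] ℝ) ∞ (formCoord p α) p := by
  rw [contMDiffAt_hom_bundle]
  exact ⟨fun h => h.2.congr_of_eventuallyEq
    (.of_forall fun q => (inCoordinates_eq_formCoord p α q).symm), fun h =>
    ⟨contMDiffAt_id, h.congr_of_eventuallyEq (.of_forall fun q => inCoordinates_eq_formCoord p α q)⟩⟩

theorem OneForm.contMDiffAt_formCoord (A : OneForm I M) (p : M) :
    ContMDiffAt I 𝓘(ℝ, E →L[ℝ] ℝ) ∞ (formCoord p fun q => A q) p :=
  contMDiffAt_formCoord_iff.1 (A.contMDiff p)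

theorem contMDiffAt_formCoord_differential {f : M → ℝ} {p : M} (hf : ContMDiffAt I 𝓘(ℝ, ℝ) ∞ f p) :
    ContMDiffAt I 𝓘(ℝ, E →L[ℝ] ℝ) ∞ (formCoord p (differential I f)) p := by
  have h := hf.mfderiv_const (m := ∞) (by simp)
  refine h.congr_of_eventuallyEq (Filter.Eventually.of_forall fun q => ?_)
  ext v
  simp [inTangentCoordinates, ContinuousLinearMap.inCoordinates, formCoord]
  rfl

/-- The exact 1-form `df`. -/
def exactForm (f : C^∞⟮I, M; 𝓘(ℝ, ℝ), ℝ⟯) : OneForm I M where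
  toFun := differential I f
  contMDiff_toFun p :=
    contMDiffAt_formCoord_iff.2 (contMDiffAt_formCoord_differential (f.contMDiff p))

variable {V : Type*} [NormedAddCommGroup V] [NormedSpace ℝ V] [FiniteDimensional ℝ V]
  (F : V →ₗ[ℝ] C^∞⟮I, M; 𝓘(ℝ, ℝ), ℝ⟯) {p : M}

/-- The differentials of the functions `F a` in the trivialization around `p`. -/
def frameCoord (p q : M) : V →L[ℝ] E →L[ℝ] ℝ :=
  LinearMap.toContinuousLinearMap
    { toFun := fun a => formCoord p (differential I (F a)) q
      map_add' := fun a b => by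
        have := map_add (differentialAt I q ∘ₗ F) a b
        ext v
        exact DFunLike.congr_fun this _
      map_smul' := fun c a => by
        have := map_smul (differentialAt I q ∘ₗ F) c a
        ext v
        exact DFunLike.congr_fun this _ }

theorem frameCoord_apply (p q : M) (a : V) :
    frameCoord F p q a = formCoord p (differential I (F a)) q := rfl

theorem contMDiffAt_frameCoord (p : M) :
    ContMDiffAt I 𝓘(ℝ, V →L[ℝ] E →L[ℝ] ℝ) ∞ (frameCoord F p) p :=
  .clm_of_forall_apply fun a => contMDiffAt_formCoord_differential ((F a).contMDiff p)

variable {F}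

/-- Solve for the coefficients of `α` in the frame `dF_a`: the frame is a basis at `p`, so the
linear system is invertible there. This reduces assertions on covector fields to exact forms. -/
theorem exists_eq_differential [FiniteDimensional ℝ E]
    (hF : Function.Bijective fun a => differential I (F a) p)
    {α : ∀ q : M, TangentSpace I q →L[ℝ] ℝ}
    (hα : ContMDiffAt I 𝓘(ℝ, E →L[ℝ] ℝ) ∞ (formCoord p α) p) :
    ∃ a : M → V, ContMDiffAt I 𝓘(ℝ, V) ∞ a p ∧ ∀ᶠ q in 𝓝 p, α q = differential I (F (a q)) q := by
  have hb : Function.Bijective (frameCoord F p p) := by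
    have : (frameCoord F p p : V → _) = fun a => differential I (F a) p :=
      funext fun a => formCoord_self p _
    rw [this]; exact hF
  have := FiniteDimensional.complete ℝ V
  obtain ⟨a, ha, hae⟩ := (contMDiffAt_frameCoord F p).exists_clm_apply_eq hb hα
  refine ⟨a, ha, ?_⟩
  filter_upwards [hae, chart_source_mem_nhds H p] with q hq hqs
  ext v
  rw [← formCoord_apply α hqs, ← hq, frameCoord_apply, formCoord_apply _ hqs]

/-- A vector field is smooth if sufficiently many functions have smooth derivatives along it. -/
theorem contMDiffAt_section_of_differential [FiniteDimensional ℝ E]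
    (hF : Function.Bijective fun a => differential I (F a) p)
    {U : ∀ q : M, TangentSpace I q}
    (hU : ∀ a, ContMDiffAt I 𝓘(ℝ, ℝ) ∞ (fun q => differential I (F a) q (U q)) p) :
    ContMDiffAt I (I.prod 𝓘(ℝ, E)) ∞ (fun q => (⟨q, U q⟩ : TangentBundle I M)) p := by
  -- In coordinates the vector field solves `T q y = (a ↦ dF_a (U q))`, where `T` is the transposed
  -- frame. It is injective at `p` because the `dF_a` exhaust the covectors, and bijective by
  -- dimension.
  let T : M → E →L[ℝ] V →L[ℝ] ℝ := fun q => (frameCoord F p q).flip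
  have hT : ContMDiffAt I 𝓘(ℝ, E →L[ℝ] V →L[ℝ] ℝ) ∞ T p :=
    .clm_of_forall_apply fun e => .clm_of_forall_apply fun a =>
      ((contMDiffAt_frameCoord F p).clm_apply contMDiffAt_const).clm_apply contMDiffAt_const
  have hfr : ∀ a, frameCoord F p p a = differential I (F a) p := fun a => formCoord_self p _
  have hinj : Function.Injective (T p) := by
    rw [injective_iff_map_eq_zero]
    intro e he
    by_contra hne
    obtain ⟨c, hc⟩ := SeparatingDual.exists_ne_zero (R := ℝ) hne
    obtain ⟨a, ha⟩ := hF.2 c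
    exact hc ((DFunLike.congr_fun ((hfr a).trans ha) e).symm.trans (DFunLike.congr_fun he a))
  have hdim : Module.finrank ℝ E = Module.finrank ℝ (V →L[ℝ] ℝ) := by
    let L : V ≃ₗ[ℝ] E →L[ℝ] ℝ := LinearEquiv.ofBijective (frameCoord F p p).toLinearMap
      (by
        have : (frameCoord F p p : V → _) = fun a => differential I (F a) p := funext hfr
        exact this ▸ hF)
    rw [← (LinearMap.toContinuousLinearMap (𝕜 := ℝ) (E := V) (F' := ℝ)).finrank_eq,
      Subspace.dual_finrank_eq, L.finrank_eq,
      ← (LinearMap.toContinuousLinearMap (𝕜 := ℝ) (E := E) (F' := ℝ)).finrank_eq,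
      Subspace.dual_finrank_eq]
  have hb : Function.Bijective (T p) := ⟨hinj,
    (LinearMap.injective_iff_surjective_of_finrank_eq_finrank (f := (T p).toLinearMap) hdim).1 hinj⟩
  have hy := hT.of_clm_apply hb (y := fun q =>
    (trivializationAt E (TangentSpace I) p).continuousLinearMapAt ℝ q (U q)) (by
    refine .clm_of_forall_apply fun a => (hU a).congr_of_eventuallyEq ?_
    filter_upwards [chart_source_mem_nhds H p] with q hq
    exact formCoord_apply _ hq _)
  refine (contMDiffAt_section _).2 (hy.congr_of_eventuallyEq ?_)
  filter_upwards [chart_source_mem_nhds H p] with q hq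
  exact (Trivialization.continuousLinearMapAt_apply_of_mem ℝ _ (by simpa using hq) _).symm

/-- The pairing of two covector fields by a family of bilinear forms is smooth if it is smooth on
the members of a frame of exact forms. -/
theorem contMDiffAt_sharp_of_frame [FiniteDimensional ℝ E]
    (hF : Function.Bijective fun a => differential I (F a) p)
    {w : ∀ q : M, (TangentSpace I q →L[ℝ] ℝ) →ₗ[ℝ] TangentSpace I q}
    (hw : ∀ a b, ContMDiffAt I 𝓘(ℝ, ℝ) ∞
      (fun q => differential I (F a) q (w q (differential I (F b) q))) p)
    {α β : ∀ q : M, TangentSpace I q →L[ℝ] ℝ}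
    (hα : ContMDiffAt I 𝓘(ℝ, E →L[ℝ] ℝ) ∞ (formCoord p α) p)
    (hβ : ContMDiffAt I 𝓘(ℝ, E →L[ℝ] ℝ) ∞ (formCoord p β) p) :
    ContMDiffAt I 𝓘(ℝ, ℝ) ∞ (fun q => α q (w q (β q))) p := by
  obtain ⟨a, ha, hae⟩ := exists_eq_differential hF hα
  obtain ⟨b, hb, hbe⟩ := exists_eq_differential hF hβ
  -- The Gram matrix of the pairing in the frame; the pairing of `α` and `β` is `Q` evaluated on
  -- their smooth coefficients.
  let Q : M → V →L[ℝ] V →L[ℝ] ℝ := fun q => LinearMap.toContinuousLinearMap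
    (LinearMap.toContinuousLinearMap.toLinearMap ∘ₗ
      LinearMap.mk₂ ℝ (fun a b => differential I (F a) q (w q (differential I (F b) q)))
      (fun a a' b => DFunLike.congr_fun (map_add (differentialAt I q ∘ₗ F) a a') _)
      (fun c a b => DFunLike.congr_fun (map_smul (differentialAt I q ∘ₗ F) c a) _)
      (fun a b b' => by
        have := map_add (w q ∘ₗ differentialAt I q ∘ₗ F) b b'
        exact (congrArg (differential I (F a) q) this).trans (map_add _ _ _))
      (fun c a b => by
        have := map_smul (w q ∘ₗ differentialAt I q ∘ₗ F) c b
        exact (congrArg (differential I (F a) q) this).trans (map_smul _ _ _)))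
  have hQ : ContMDiffAt I 𝓘(ℝ, V →L[ℝ] V →L[ℝ] ℝ) ∞ Q p :=
    .clm_of_forall_apply fun a => .clm_of_forall_apply fun b => hw a b
  refine ((hQ.clm_apply ha).clm_apply hb).congr_of_eventuallyEq ?_
  filter_upwards [hae, hbe] with q h1 h2
  rw [h1, h2]
  rfl

end Forms

/-! ### The product rule for pairings of vector-valued functions. -/

section ProductRule

variable {E H M : Type*} [NormedAddCommGroup E] [NormedSpace ℝ E] [TopologicalSpace H]
  {I : ModelWithCorners ℝ E H} [TopologicalSpace M] [ChartedSpace H M]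
  {V : Type*} [NormedAddCommGroup V] [NormedSpace ℝ V]

variable (I) in
/-- The derivative of a function with values in a normed space. -/
def valueDeriv (f : M → V) (p : M) : TangentSpace I p →L[ℝ] V := mfderiv I 𝓘(ℝ, V) f p

theorem valueDeriv_eq [I.Boundaryless] {f : M → V} {p : M}
    (hf : MDifferentiableAt I 𝓘(ℝ, V) f p) :
    valueDeriv I f p = (fderiv ℝ (f ∘ (extChartAt I p).symm) (extChartAt I p p) : E →L[ℝ] V) := by
  have h := hf.mfderiv
  have h2 : fderivWithin ℝ (writtenInExtChartAt I 𝓘(ℝ, V) p f) (Set.range I) (extChartAt I p p) =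
      fderiv ℝ (f ∘ (extChartAt I p).symm) (extChartAt I p p) := by
    rw [I.range_eq_univ, fderivWithin_univ]
    rfl
  exact h.trans h2

theorem valueDeriv_clm_apply {W : Type*} [NormedAddCommGroup W] [NormedSpace ℝ W]
    {c : M → V →L[ℝ] W} {s : M → V} {p : M}
    (hc : MDifferentiableAt I 𝓘(ℝ, V →L[ℝ] W) c p) (hs : MDifferentiableAt I 𝓘(ℝ, V) s p)
    (v : TangentSpace I p) :
    valueDeriv I (fun q => c q (s q)) p v =
      c p (valueDeriv I s p v) + valueDeriv I c p v (s p) := by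
  have h := HasFDerivWithinAt.clm_apply (𝕜 := ℝ) (c := c ∘ (extChartAt I p).symm)
    (u := s ∘ (extChartAt I p).symm) hc.hasMFDerivAt.2 hs.hasMFDerivAt.2
  simp only [Function.comp_apply, extChartAt_to_inv] at h
  let s' : E →L[ℝ] V := valueDeriv I s p
  let c' : E →L[ℝ] V →L[ℝ] W := valueDeriv I c p
  have h' : HasMFDerivAt I 𝓘(ℝ, W) (fun q => c q (s q)) p ((c p).comp s' + c'.flip (s p)) :=
    ⟨hc.hasMFDerivAt.1.clm_apply hs.hasMFDerivAt.1, h⟩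
  exact DFunLike.congr_fun h'.mfderiv v

theorem differential_clm_apply {c : M → V →L[ℝ] ℝ} {s : M → V} {p : M}
    (hc : MDifferentiableAt I 𝓘(ℝ, V →L[ℝ] ℝ) c p) (hs : MDifferentiableAt I 𝓘(ℝ, V) s p)
    (v : TangentSpace I p) :
    differential I (fun q => c q (s q)) p v =
      c p (valueDeriv I s p v) + valueDeriv I c p v (s p) :=
  valueDeriv_clm_apply hc hs v

end ProductRule

/-! ### The exterior derivative as an antisymmetrised derivative of coordinates. -/

section ExteriorDerivative

variable {E H M : Type*} [NormedAddCommGroup E] [NormedSpace ℝ E] [TopologicalSpace H]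
  {I : ModelWithCorners ℝ E H} [I.Boundaryless]
  [TopologicalSpace M] [ChartedSpace H M] [IsManifold I ∞ M]

/-- The derivative at `p` of a field of covectors, in the chart at `p`. -/
def formDeriv (α : ∀ q : M, TangentSpace I q →L[ℝ] ℝ) (p : M) :
    TangentSpace I p →L[ℝ] TangentSpace I p →L[ℝ] ℝ :=
  valueDeriv I (formCoord p α) p

/-- The tangent trivialization around `p` is the derivative of the inverse chart, so `formCoord p
α`, read in the chart, is the coordinate form whose derivative is antisymmetrised in
`exteriorDerivative`. -/
theorem exteriorDerivative_apply {α : ∀ q : M, TangentSpace I q →L[ℝ] ℝ} {p : M}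
    (hα : ContMDiffAt I 𝓘(ℝ, E →L[ℝ] ℝ) ∞ (formCoord p α) p) (u v : TangentSpace I p) :
    exteriorDerivative I α p u v = formDeriv α p u v - formDeriv α p v u := by
  set φ := extChartAt I p
  have h1 : valueDeriv I (formCoord p α) p =
      fderiv ℝ (fun y : E => ((α (φ.symm y)).comp (mfderiv 𝓘(ℝ, E) I φ.symm y) : E →L[ℝ] ℝ))
        (φ p) := by
    refine (valueDeriv_eq (hα.mdifferentiableAt (by simp))).trans ?_
    refine Filter.EventuallyEq.fderiv_eq ?_
    filter_upwards [extChartAt_target_mem_nhds (I := I) p] with y hy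
    have hs : φ.symm y ∈ (chartAt H p).source := by
      rw [← extChartAt_source I]; exact φ.map_target hy
    refine (congrArg (fun L : E →L[ℝ] TangentSpace I (φ.symm y) => (α (φ.symm y)).comp L)
      (TangentBundle.symmL_trivializationAt hs)).trans ?_
    rw [I.range_eq_univ, mfderivWithin_univ, φ.right_inv hy]
  unfold formDeriv
  rw [h1]
  rfl

theorem formDeriv_add {α β : ∀ q : M, TangentSpace I q →L[ℝ] ℝ} {p : M}
    (hα : ContMDiffAt I 𝓘(ℝ, E →L[ℝ] ℝ) ∞ (formCoord p α) p)
    (hβ : ContMDiffAt I 𝓘(ℝ, E →L[ℝ] ℝ) ∞ (formCoord p β) p) :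
    formDeriv (fun q => α q + β q) p = formDeriv α p + formDeriv β p :=
  mfderiv_add (hα.mdifferentiableAt (by simp)) (hβ.mdifferentiableAt (by simp))

/-- By the chain rule the coordinate form of `df` is the Fréchet derivative of `f` in the chart. -/
theorem formDeriv_differential {f : M → ℝ} {p : M} (hf : ContMDiff I 𝓘(ℝ, ℝ) ∞ f) :
    formDeriv (differential I f) p = hessian I f p := by
  set φ := extChartAt I p
  have hα := contMDiffAt_formCoord_differential (hf p)
  refine (valueDeriv_eq (hα.mdifferentiableAt (by simp))).trans ?_
  refine Filter.EventuallyEq.fderiv_eq ?_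
  filter_upwards [extChartAt_target_mem_nhds (I := I) p] with y hy
  have hs : φ.symm y ∈ (chartAt H p).source := by
    rw [← extChartAt_source I]; exact φ.map_target hy
  refine (congrArg (fun L : E →L[ℝ] TangentSpace I (φ.symm y) =>
    (differential I f (φ.symm y)).comp L) (TangentBundle.symmL_trivializationAt hs)).trans ?_
  rw [I.range_eq_univ, mfderivWithin_univ, φ.right_inv hy]
  have := mfderiv_comp (I := 𝓘(ℝ, E)) (I' := I) (I'' := 𝓘(ℝ, ℝ)) (g := f) (f := φ.symm) y
    (hf.mdifferentiable (by simp) _) (by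
      have := mdifferentiableWithinAt_extChartAt_symm (I := I) (x := p) hy
      rwa [I.range_eq_univ, mdifferentiableWithinAt_univ] at this)
  rw [mfderiv_eq_fderiv] at this
  exact this.symm

/-- The second derivative of a smooth function is symmetric. -/
theorem formDeriv_differential_symm {f : M → ℝ} {p : M} (hf : ContMDiff I 𝓘(ℝ, ℝ) ∞ f)
    (u v : TangentSpace I p) :
    formDeriv (differential I f) p u v = formDeriv (differential I f) p v u := by
  set φ := extChartAt I p
  have hs : ContDiffAt ℝ ∞ (f ∘ φ.symm) (φ p) := by
    refine contMDiffAt_iff_contDiffAt.1 (ContMDiffAt.comp _ hf.contMDiffAt ?_)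
    have := contMDiffWithinAt_extChartAt_symm_range (n := ∞) (I := I) p (mem_extChartAt_target p)
    rwa [I.range_eq_univ, contMDiffWithinAt_univ] at this
  rw [formDeriv_differential hf]
  exact (hs.isSymmSndFDerivAt (by simp; exact WithTop.coe_le_coe.2 le_top)) u v

theorem exteriorDerivative_differential {f : M → ℝ} (hf : ContMDiff I 𝓘(ℝ, ℝ) ∞ f) (p : M)  :
    exteriorDerivative I (differential I f) p = 0 := by
  ext u v
  rw [exteriorDerivative_apply (contMDiffAt_formCoord_differential (hf p)),
    formDeriv_differential_symm hf, sub_self]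
  rfl

theorem exteriorDerivative_add {α β : ∀ q : M, TangentSpace I q →L[ℝ] ℝ} {p : M}
    (hα : ContMDiffAt I 𝓘(ℝ, E →L[ℝ] ℝ) ∞ (formCoord p α) p)
    (hβ : ContMDiffAt I 𝓘(ℝ, E →L[ℝ] ℝ) ∞ (formCoord p β) p) :
    exteriorDerivative I (fun q => α q + β q) p =
      exteriorDerivative I α p + exteriorDerivative I β p := by
  ext u v
  have h := hα.add hβ
  rw [exteriorDerivative_apply h, formDeriv_add hα hβ]
  simp only [add_apply, exteriorDerivative_apply hα, exteriorDerivative_apply hβ]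
  ring

end ExteriorDerivative

/-! ### The bracket of 1-forms. -/

section FormBracket

variable {E M : Type*} [NormedAddCommGroup E] [NormedSpace ℝ E] [FiniteDimensional ℝ E]
  [TopologicalSpace M] [ChartedSpace E M] [IsManifold 𝓘(ℝ, E) ∞ M]
  (w : BivectorField 𝓘(ℝ, E) M)

theorem BivectorField.skew' {E H : Type*} [NormedAddCommGroup E] [NormedSpace ℝ E]
    [TopologicalSpace H] {I : ModelWithCorners ℝ E H} {M : Type*} [TopologicalSpace M]
    [ChartedSpace H M] (w : BivectorField I M) (p : M) (α β : TangentSpace I p →L[ℝ] ℝ) :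
    α (w.sharp p β) = - β (w.sharp p α) := by
  have := w.skew p (α + β)
  simp only [map_add, add_apply, w.skew] at this
  linarith

theorem BivectorField.formBracket_skew (A B : OneForm 𝓘(ℝ, E) M) (p : M) :
    w.formBracket A B p = - w.formBracket B A p := by
  have h : differential 𝓘(ℝ, E) (fun q => A q (w.sharp q (B q))) p =
      - differential 𝓘(ℝ, E) (fun q => B q (w.sharp q (A q))) p := by
    rw [← differential_neg]
    congr 1
    exact funext fun q => w.skew' q _ _
  simp only [BivectorField.formBracket, h]
  abel

variable [T2Space M]

theorem exists_differential_frame (p : M) :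
    ∃ F : (E →L[ℝ] ℝ) →ₗ[ℝ] C^∞⟮𝓘(ℝ, E), M; 𝓘(ℝ, ℝ), ℝ⟯,
      Function.Bijective fun a => differential 𝓘(ℝ, E) (F a) p := by
  obtain ⟨F, hF⟩ := exists_linear_differential_eq (E := E) p
  have h : (fun a => differential 𝓘(ℝ, E) (F a) p) = id := funext hF
  exact ⟨F, h ▸ Function.bijective_id⟩

/-- A bivector field is smooth by definition only on differentials of global functions. Such
differentials contain a frame near each point, which extends the smoothness to all covector fields.
-/
theorem BivectorField.contMDiffAt_sharp {α β : ∀ q : M, TangentSpace 𝓘(ℝ, E) q →L[ℝ] ℝ} {p : M}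
    (hα : ContMDiffAt 𝓘(ℝ, E) 𝓘(ℝ, E →L[ℝ] ℝ) ∞ (formCoord p α) p)
    (hβ : ContMDiffAt 𝓘(ℝ, E) 𝓘(ℝ, E →L[ℝ] ℝ) ∞ (formCoord p β) p) :
    ContMDiffAt 𝓘(ℝ, E) 𝓘(ℝ, ℝ) ∞ (fun q => α q (w.sharp q (β q))) p := by
  obtain ⟨F, hF⟩ := exists_differential_frame (E := E) p
  exact contMDiffAt_sharp_of_frame hF (fun a b => w.smooth (F a) (F b) p) hα hβ

/-- The bracket `{f, g}` as a smooth function. -/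
def BivectorField.bracketMap (f g : C^∞⟮𝓘(ℝ, E), M; 𝓘(ℝ, ℝ), ℝ⟯) :
    C^∞⟮𝓘(ℝ, E), M; 𝓘(ℝ, ℝ), ℝ⟯ := ⟨w.bracket f g, w.smooth f g⟩

/-- Both terms with an exterior derivative vanish because `d ∘ d = 0`. -/
theorem BivectorField.formBracket_exact (f g : C^∞⟮𝓘(ℝ, E), M; 𝓘(ℝ, ℝ), ℝ⟯) (p : M) :
    w.formBracket (exactForm f) (exactForm g) p = differential 𝓘(ℝ, E) (w.bracket f g) p := by
  have h1 := exteriorDerivative_differential f.contMDiff p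
  have h2 := exteriorDerivative_differential g.contMDiff p
  simp only [BivectorField.formBracket]
  change exteriorDerivative 𝓘(ℝ, E) (differential 𝓘(ℝ, E) f) p _ -
    exteriorDerivative 𝓘(ℝ, E) (differential 𝓘(ℝ, E) g) p _ + _ = _
  rw [h1, h2]
  simp
  rfl

theorem BivectorField.formBracket_add_left (A A' B : OneForm 𝓘(ℝ, E) M) (p : M) :
    w.formBracket (A + A') B p = w.formBracket A B p + w.formBracket A' B p := by
  have hA := A.contMDiffAt_formCoord p
  have hA' := A'.contMDiffAt_formCoord p
  have hB := B.contMDiffAt_formCoord p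
  have h1 := exteriorDerivative_add hA hA'
  have h2 := differential_add ((w.contMDiffAt_sharp hA hB).mdifferentiableAt (by simp))
    ((w.contMDiffAt_sharp hA' hB).mdifferentiableAt (by simp))
  have h3 : (fun q => (A + A') q (w.sharp q (B q))) =
    fun q => A q (w.sharp q (B q)) + A' q (w.sharp q (B q)) := rfl
  have h4 : w.sharp p ((A + A') p) = w.sharp p (A p) + w.sharp p (A' p) := map_add _ _ _
  simp only [BivectorField.formBracket]
  rw [h3, h2, h4, map_add]
  change exteriorDerivative 𝓘(ℝ, E) (fun q => A q + A' q) p _ - _ + _ = _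
  rw [h1]
  simp only [add_apply]
  abel

/-- The vector field `w♯ B` is smooth. -/
theorem BivectorField.contMDiff_sharp (B : OneForm 𝓘(ℝ, E) M) :
    ContMDiff 𝓘(ℝ, E) (𝓘(ℝ, E).prod 𝓘(ℝ, E)) ∞
      (fun q => (⟨q, w.sharp q (B q)⟩ : TangentBundle 𝓘(ℝ, E) M)) := by
  intro p
  obtain ⟨F, hF⟩ := exists_differential_frame (E := E) p
  exact contMDiffAt_section_of_differential hF fun a =>
    w.contMDiffAt_sharp (contMDiffAt_formCoord_differential ((F a).contMDiff p))
      (B.contMDiffAt_formCoord p)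

/-- The bracket of a 1-form that vanishes at `p`. -/
theorem BivectorField.formBracket_of_eq_zero {A B : OneForm 𝓘(ℝ, E) M} {p : M} (hA : A p = 0)
    (v : TangentSpace 𝓘(ℝ, E) p) :
    w.formBracket A B p v = formDeriv (fun q => A q) p (w.sharp p (B p)) v := by
  have hAc := A.contMDiffAt_formCoord p
  set s : M → E := fun q =>
    (trivializationAt E (TangentSpace 𝓘(ℝ, E)) p).continuousLinearMapAt ℝ q (w.sharp q (B q))
  have hs : ContMDiffAt 𝓘(ℝ, E) 𝓘(ℝ, E) ∞ s p := by
    refine ((contMDiffAt_section _).1 (w.contMDiff_sharp B p)).congr_of_eventuallyEq ?_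
    filter_upwards [chart_source_mem_nhds E p] with q hq
    exact Trivialization.continuousLinearMapAt_apply_of_mem ℝ _ (by simpa using hq) _
  have h1 : differential 𝓘(ℝ, E) (fun q => A q (w.sharp q (B q))) p =
      differential 𝓘(ℝ, E) (fun q => formCoord p (fun q => A q) q (s q)) p := by
    refine differential_congr ?_
    filter_upwards [chart_source_mem_nhds E p] with q hq
    exact (formCoord_apply _ hq _).symm
  -- Product rule for `A (w♯ B)`: as `A` vanishes at `p`, only the derivative of `A` survives.
  have h2 := differential_clm_apply (hAc.mdifferentiableAt (by simp))
    (hs.mdifferentiableAt (by simp)) v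
  have h3 : formCoord p (fun q => A q) p = 0 := (formCoord_self _ _).trans hA
  have h4 : s p = w.sharp p (B p) := tangent_continuousLinearMapAt_self _ _
  rw [h3, h4] at h2
  have h5 := exteriorDerivative_apply hAc (w.sharp p (B p)) v
  simp only [BivectorField.formBracket, add_apply, sub_apply]
  -- The surviving term is `DA(v)(w♯ B)`; it cancels the second half of `dA(w♯ B, v)` and leaves
  -- `DA(w♯ B)(v)`.
  rw [h1, h2, h5, hA, map_zero, map_zero]
  simp only [formDeriv, zero_apply, zero_add]
  rw [sub_zero]
  exact sub_add_cancel (G := ℝ) _ _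

end FormBracket

/-! ### Functions vanishing on an embedded submanifold. -/

section Slice

variable {E M E' N : Type*} [NormedAddCommGroup E] [NormedSpace ℝ E] [FiniteDimensional ℝ E]
  [NormedAddCommGroup E'] [NormedSpace ℝ E'] [FiniteDimensional ℝ E']

/-- A function with a given differential that vanishes on the image of an immersion. -/
theorem exists_function_vanishing_of_injective {κ : E → E'} {u₀ : E}
    (hκ : ∀ᶠ u in 𝓝 u₀, ContDiffAt ℝ ∞ κ u) {A : E →L[ℝ] E'} (hA : HasFDerivAt κ A u₀)
    (hi : Function.Injective A) {ℓ : E' →L[ℝ] ℝ} (hℓ : ∀ u, ℓ (A u) = 0) :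
    ∃ (G : E' → ℝ) (s : Set E'), s ∈ 𝓝 (κ u₀) ∧ ContDiffOn ℝ ∞ G s ∧ HasFDerivAt G ℓ (κ u₀) ∧
      ∀ᶠ u in 𝓝 u₀, G (κ u) = 0 := by
  have := FiniteDimensional.complete ℝ E
  obtain ⟨R, -, -, hR, -⟩ := exists_splitting_of_injective A hi
  -- With `R` a left inverse of `A`, `R ∘ κ` has the identity as derivative at `u₀`. With its local
  -- inverse `e.symm`, the map `y ↦ κ (e.symm (R y))` retracts a neighbourhood onto the image of
  -- `κ`.
  set f : E → E := fun u => R (κ u) with hf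
  have hfc : ∀ᶠ u in 𝓝 u₀, ContDiffAt ℝ ∞ f u := hκ.mono fun u hu => R.contDiff.contDiffAt.comp u hu
  have hf' : HasFDerivAt f ((ContinuousLinearEquiv.refl ℝ E : E ≃L[ℝ] E) : E →L[ℝ] E) u₀ := by
    have h := R.hasFDerivAt.comp u₀ hA
    have e : R.comp A = ((ContinuousLinearEquiv.refl ℝ E : E ≃L[ℝ] E) : E →L[ℝ] E) := by
      ext u; exact hR u
    rwa [e] at h
  set e := hfc.self_of_nhds.toOpenPartialHomeomorph f hf' (by simp)
  have hes : u₀ ∈ e.source := hfc.self_of_nhds.mem_toOpenPartialHomeomorph_source hf' (by simp)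
  have hef : ∀ u, e u = f u := fun u => rfl
  have heu : e.symm (f u₀) = u₀ := e.left_inv hes
  -- The local inverse has to be smooth on a whole neighbourhood, so the derivative of `f` must be
  -- invertible at nearby points too.
  have hinv : ∀ᶠ u in 𝓝 u₀, ∃ L : E ≃L[ℝ] E, HasFDerivAt f (L : E →L[ℝ] E) u := by
    have hc : ContinuousAt (fderiv ℝ f) u₀ :=
      (hfc.self_of_nhds.fderiv_right (m := 0) (by simp)).continuousAt
    have hn := hc.preimage_mem_nhds (hf'.fderiv ▸ ContinuousLinearEquiv.nhds _)
    filter_upwards [hn, hfc] with u ⟨L, hL⟩ hu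
    exact ⟨L, hL ▸ (hu.differentiableAt (by simp)).hasFDerivAt⟩
  have hy : Filter.Tendsto (fun y => e.symm (R y)) (𝓝 (κ u₀)) (𝓝 u₀) := by
    have h1 : ContinuousAt e.symm (R (κ u₀)) := e.continuousAt_symm (e.map_source hes)
    have h2 : ContinuousAt (fun y => e.symm (R y)) (κ u₀) :=
      ContinuousAt.comp (g := e.symm) h1 R.continuous.continuousAt
    have h3 : Filter.Tendsto (fun y => e.symm (R y)) (𝓝 (κ u₀)) (𝓝 (e.symm (R (κ u₀)))) := h2
    rwa [show e.symm (R (κ u₀)) = u₀ from heu] at h3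
  have hsymm : ∀ᶠ y in 𝓝 (κ u₀), ContDiffAt ℝ ∞ e.symm (R y) ∧ ContDiffAt ℝ ∞ κ (e.symm (R y)) := by
    have ht : ∀ᶠ y in 𝓝 (κ u₀), R y ∈ e.target :=
      R.continuous.continuousAt.preimage_mem_nhds (e.open_target.mem_nhds (e.map_source hes))
    filter_upwards [ht, hy.eventually hκ, hy.eventually hfc, hy.eventually hinv] with y h1 h2 h3 h4
    obtain ⟨L, hL⟩ := h4
    exact ⟨e.contDiffAt_symm h1 hL h3, h2⟩
  have hG : ∀ᶠ y in 𝓝 (κ u₀), ContDiffAt ℝ ∞ (fun y => ℓ (y - κ (e.symm (R y)))) y := by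
    filter_upwards [hsymm] with y hy
    exact ℓ.contDiff.contDiffAt.comp y (contDiffAt_id.sub
      (hy.2.comp y (hy.1.comp y R.contDiff.contDiffAt)))
  -- Apply `ℓ` to the displacement of `y` from its retraction; this displacement is zero on the
  -- image of `κ`.
  refine ⟨fun y => ℓ (y - κ (e.symm (R y))), _, hG,
    fun y (hy : ContDiffAt ℝ ∞ _ y) => hy.contDiffWithinAt, ?_, ?_⟩
  · have h1 : HasFDerivAt (fun y => e.symm (R y)) _ (κ u₀) :=
      ((hsymm.self_of_nhds.1.comp (κ u₀) R.contDiff.contDiffAt).differentiableAt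
        (by simp)).hasFDerivAt
    have h2 : HasFDerivAt κ A (e.symm (R (κ u₀))) := by
      rw [show e.symm (R (κ u₀)) = u₀ from heu]; exact hA
    have h3 := ℓ.hasFDerivAt.comp (κ u₀) ((hasFDerivAt_id (κ u₀)).sub (h2.comp (κ u₀) h1))
    -- The derivative of the retraction takes values in the range of `A`, where `ℓ` vanishes.
    exact h3.congr_fderiv (by ext v; simp [hℓ])
  · filter_upwards [e.open_source.mem_nhds hes] with u hu
    have : e.symm (R (κ u)) = u := e.left_inv hu
    rw [this, sub_self, map_zero]

variable [TopologicalSpace M] [ChartedSpace E M] [IsManifold 𝓘(ℝ, E) ∞ M]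
  [TopologicalSpace N] [ChartedSpace E' N] [IsManifold 𝓘(ℝ, E') ∞ N] [T2Space N]

/-- A conormal covector of an embedded submanifold is the differential of a smooth function that
vanishes on the submanifold. -/
theorem SmoothImmersion.exists_vanishing_function (k : SmoothImmersion E M E' N)
    (hk : Topology.IsEmbedding k.map) (x : M) (ℓ : k.Conormal x) :
    ∃ G : C^∞⟮𝓘(ℝ, E'), N; 𝓘(ℝ, ℝ), ℝ⟯, (∀ y, G (k.map y) = 0) ∧
      differential 𝓘(ℝ, E') G (k.map x) = ℓ := by
  set φ := extChartAt 𝓘(ℝ, E') (k.map x)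
  set ψ := extChartAt 𝓘(ℝ, E) x
  let κ : E → E' := fun u => φ (k.map (ψ.symm u))
  have hkc := k.map.contMDiff.continuous
  have hψt : ∀ᶠ u in 𝓝 (ψ x), u ∈ ψ.target := extChartAt_target_mem_nhds x
  have hψc : Filter.Tendsto ψ.symm (𝓝 (ψ x)) (𝓝 x) := by
    have := continuousAt_extChartAt_symm (I := 𝓘(ℝ, E)) x
    rwa [ContinuousAt, extChartAt_to_inv] at this
  have hφs : ∀ᶠ x' in 𝓝 x, k.map x' ∈ φ.source :=
    hkc.continuousAt.preimage_mem_nhds (extChartAt_source_mem_nhds (I := 𝓘(ℝ, E')) (k.map x))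
  have hκ : ∀ᶠ u in 𝓝 (ψ x), ContDiffAt ℝ ∞ κ u := by
    filter_upwards [hψt, hψc.eventually hφs] with u h1 h2
    refine contMDiffAt_iff_contDiffAt.1 (ContMDiffAt.comp (I' := 𝓘(ℝ, E')) u
      (contMDiffAt_extChartAt' (by rwa [← extChartAt_source 𝓘(ℝ, E')]))
      (k.map.contMDiff.contMDiffAt.comp u ?_))
    exact (contMDiffOn_extChartAt_symm x).contMDiffAt
      ((isOpen_extChartAt_target (I := 𝓘(ℝ, E)) x).mem_nhds h1)
  let A : E →L[ℝ] E' := k.deriv x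
  have hA : HasFDerivAt κ A (ψ x) := by
    have h := ((k.map.mdiffAt x).hasMFDerivAt).2
    have h' := h.hasFDerivAt (by simp)
    exact h'
  let ℓ' : E' →L[ℝ] ℝ := ℓ.1
  have hκx : κ (ψ x) = φ (k.map x) := by simp only [κ, ψ, extChartAt_to_inv]
  obtain ⟨G, s, hs, hGs, hGd, hG0⟩ := exists_function_vanishing_of_injective hκ hA
    (k.injective_mfderiv x) (ℓ := ℓ') ℓ.2
  rw [hκx] at hs hGd
  have hnear : ∀ᶠ x' in 𝓝 x, G (φ (k.map x')) = 0 := by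
    have hψx : Filter.Tendsto ψ (𝓝 x) (𝓝 (ψ x)) := continuousAt_extChartAt x
    filter_upwards [hψx.eventually hG0, extChartAt_source_mem_nhds (I := 𝓘(ℝ, E)) x] with x' h1 h2
    have : ψ.symm (ψ x') = x' := ψ.left_inv h2
    simpa only [κ, this] using h1
  -- Here the embedding matters: some neighbourhood of `k x` in `N` meets the submanifold only in
  -- points where `G` vanishes. The cutoff is zero outside this neighbourhood, so the product
  -- vanishes on all of `M`.
  rw [hk.isInducing.nhds_eq_comap, Filter.eventually_comap] at hnear
  obtain ⟨χ, g, hg, hge, hχ⟩ := exists_contMDiffMap_cutoff hs hGs hnear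
  refine ⟨g, fun y => ?_, (differential_congr hge).trans ?_⟩
  · rw [hg]
    by_cases hy : k.map y ∈ {b | ∀ a, k.map a = b → G (φ (k.map a)) = 0}
    · have : G (φ (k.map y)) = 0 := hy y rfl
      exact mul_eq_zero_of_right _ this
    · exact mul_eq_zero_of_left (hχ _ hy) _
  · refine (differential_comp (I' := 𝓘(ℝ, E')) (f := G) (g := φ)
      hGd.differentiableAt.mdifferentiableAt
      (mdifferentiableAt_extChartAt (mem_chart_source _ _))).trans ?_
    rw [mfderiv_extChartAt_self]
    refine (ContinuousLinearMap.comp_id _).trans ?_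
    exact (mfderiv_eq_fderiv).trans hGd.fderiv

end Slice

/-! ### Derivatives computed in the chart at a point. -/

section ChartSelf

variable {E H M : Type*} [NormedAddCommGroup E] [NormedSpace ℝ E] [TopologicalSpace H]
  {I : ModelWithCorners ℝ E H} [TopologicalSpace M] [ChartedSpace H M] [IsManifold I ∞ M]
  {E' H' N : Type*} [NormedAddCommGroup E'] [NormedSpace ℝ E'] [TopologicalSpace H']
  {J : ModelWithCorners ℝ E' H'} [TopologicalSpace N] [ChartedSpace H' N] [IsManifold J ∞ N]
  {W : Type*} [NormedAddCommGroup W] [NormedSpace ℝ W]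

/-- The derivative of a map that is given by `g` in the charts. -/
theorem mfderiv_apply_of_chart {f : M → N} {g : M → E'} {p : M} {q : N} (hq : f p = q)
    (hf : MDifferentiableAt I J f p)
    (h : ∀ᶠ p' in 𝓝 p, extChartAt J q (f p') = g p') (v : TangentSpace I p) :
    (mfderiv I J f p v : E') = valueDeriv I g p v := by
  have h1 := mfderiv_comp_apply_of_eq p (g := extChartAt J q) (I' := J) (I'' := 𝓘(ℝ, E'))
    (mdifferentiableAt_extChartAt (mem_chart_source _ q)) hf hq v
  have h2 : mfderiv I 𝓘(ℝ, E') (extChartAt J q ∘ f) p = mfderiv I 𝓘(ℝ, E') g p :=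
    Filter.EventuallyEq.mfderiv_eq h
  have h3 : (mfderiv J 𝓘(ℝ, E') (extChartAt J q) q) (mfderiv I J f p v) = (mfderiv I J f p v : E') :=
    DFunLike.congr_fun (mfderiv_extChartAt_self (I := J) (x := q)) _
  have h4 := DFunLike.congr_fun h2 v
  exact (h3.symm.trans h1.symm).trans h4

/-- The derivative at `p` of a function of the chart at `p`. -/
theorem valueDeriv_comp_extChartAt (g : E →L[ℝ] W) (p : M) (v : TangentSpace I p) :
    valueDeriv I (fun q => g (extChartAt I p q)) p v = g v := by
  have h1 := mfderiv_comp_apply p (g := g) (f := extChartAt I p) (I' := 𝓘(ℝ, E))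
    (I'' := 𝓘(ℝ, W)) g.mdifferentiableAt
    (mdifferentiableAt_extChartAt (mem_chart_source _ p)) v
  have h2 : mfderiv I 𝓘(ℝ, E) (extChartAt I p) p v = (v : E) :=
    DFunLike.congr_fun (mfderiv_extChartAt_self (I := I) (x := p)) _
  refine h1.trans ?_
  rw [h2]
  exact DFunLike.congr_fun g.mfderiv_eq v

end ChartSelf

/-! ### Tangent vectors and covectors of total spaces. -/

section VectorBundle

variable {EB HB B : Type*} [NormedAddCommGroup EB] [NormedSpace ℝ EB] [TopologicalSpace HB]
  {IB : ModelWithCorners ℝ EB HB} [TopologicalSpace B] [ChartedSpace HB B] [IsManifold IB ∞ B]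
  {F : Type*} [NormedAddCommGroup F] [NormedSpace ℝ F] {V : B → Type*}
  [TopologicalSpace (TotalSpace F V)] [∀ x, AddCommMonoid (V x)] [∀ x, Module ℝ (V x)]
  [∀ x, TopologicalSpace (V x)] [FiberBundle F V] [VectorBundle ℝ F V]
  [ContMDiffVectorBundle ∞ F V IB]

theorem extChartAt_totalSpace_apply (t s : TotalSpace F V) :
    extChartAt (IB.prod 𝓘(ℝ, F)) t s =
      (extChartAt IB t.1 (trivializationAt F V t.1 s).1, (trivializationAt F V t.1 s).2) := by
  rw [FiberBundle.extChartAt]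
  rfl

/-- The derivative of the projection of a vector bundle. -/
theorem mfderiv_proj_apply (t : TotalSpace F V) (v : TangentSpace (IB.prod 𝓘(ℝ, F)) t) :
    (mfderiv (IB.prod 𝓘(ℝ, F)) IB (TotalSpace.proj : TotalSpace F V → B) t v : EB) =
      (v : EB × F).1 := by
  refine (mfderiv_apply_of_chart (E' := EB) (q := t.1) (f := (TotalSpace.proj : TotalSpace F V → B)) rfl
    ((contMDiff_proj V (IB := IB) (n := ∞)).mdifferentiable (by simp) t) (g := fun s =>
      (ContinuousLinearMap.fst ℝ EB F) (extChartAt (IB.prod 𝓘(ℝ, F)) t s)) ?_ v).trans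
    (valueDeriv_comp_extChartAt (W := EB) _ t v)
  have : ∀ᶠ s : TotalSpace F V in 𝓝 t, s ∈ (trivializationAt F V t.1).source :=
    (trivializationAt F V t.1).open_source.mem_nhds ((trivializationAt F V t.1).mem_source.2 (mem_baseSet_trivializationAt F V t.1))
  filter_upwards [this] with s hs
  rw [extChartAt_totalSpace_apply]
  exact congrArg _ ((trivializationAt F V t.1).coe_fst hs).symm

theorem valueDeriv_trivialization (t : TotalSpace F V) (v : TangentSpace (IB.prod 𝓘(ℝ, F)) t) :
    valueDeriv (IB.prod 𝓘(ℝ, F)) (fun s : TotalSpace F V => (trivializationAt F V t.1 s).2) t v =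
      (v : EB × F).2 := by
  have h := valueDeriv_comp_extChartAt (I := IB.prod 𝓘(ℝ, F)) (ContinuousLinearMap.snd ℝ EB F) t v
  refine Eq.trans ?_ h
  congr 2

theorem contMDiff_fiberInclusion (x : B) :
    ContMDiff 𝓘(ℝ, F) (IB.prod 𝓘(ℝ, F)) ∞
      (fun m : F => (⟨x, (trivializationAt F V x).symm x m⟩ : TotalSpace F V)) := by
  intro m
  refine contMDiffAt_totalSpace.2 ⟨contMDiffAt_const, ?_⟩
  refine contMDiffAt_id.congr_of_eventuallyEq (.of_forall fun m' => ?_)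
  exact congrArg Prod.snd ((trivializationAt F V x).apply_mk_symm
    (mem_baseSet_trivializationAt F V x) m')

/-- The vertical lift in the chart at `t`. -/
theorem verticalLift_apply (t : TotalSpace F V) (v : V t.1) :
    (verticalLift IB F t v : EB × F) =
      (0, (trivializationAt F V t.1).continuousLinearMapAt ℝ t.1 v) := by
  have hx := mem_baseSet_trivializationAt F V t.1
  set e := trivializationAt F V t.1
  set m₀ := e.continuousLinearMapAt ℝ t.1 t.2
  have hm : (⟨t.1, e.symm t.1 m₀⟩ : TotalSpace F V) = t :=
    congrArg (TotalSpace.mk t.1)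
      ((e.symmL_apply (R := ℝ) hx m₀).symm.trans (e.symmL_continuousLinearMapAt hx t.2))
  let g : F → EB × F := fun m => (extChartAt IB t.1 t.1, m)
  have h := mfderiv_apply_of_chart (I := 𝓘(ℝ, F)) (J := IB.prod 𝓘(ℝ, F)) (g := g) hm
    ((contMDiff_fiberInclusion (IB := IB) t.1).mdifferentiable (by simp) m₀) (.of_forall fun m => by
      rw [extChartAt_totalSpace_apply, (trivializationAt F V t.1).apply_mk_symm hx])
      (e.continuousLinearMapAt ℝ t.1 v)
  refine h.trans ?_
  have hg : HasFDerivAt g (ContinuousLinearMap.inr ℝ EB F) m₀ := by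
    have := (hasFDerivAt_const (𝕜 := ℝ) (extChartAt IB t.1 t.1) m₀).prodMk (hasFDerivAt_id m₀)
    exact this
  have h2 : valueDeriv 𝓘(ℝ, F) g m₀ = ContinuousLinearMap.inr ℝ EB F :=
    mfderiv_eq_fderiv.trans hg.fderiv
  exact DFunLike.congr_fun h2 _

/-- A covector that vanishes on the vertical space comes from the base. -/
theorem exists_eq_comp_mfderiv_proj {t : TotalSpace F V}
    {a : TangentSpace (IB.prod 𝓘(ℝ, F)) t →L[ℝ] ℝ} (ha : verticalPart t a = 0) :
    ∃ c : TangentSpace IB t.1 →L[ℝ] ℝ,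
      a = c.comp (mfderiv (IB.prod 𝓘(ℝ, F)) IB (TotalSpace.proj : TotalSpace F V → B) t) := by
  let a' : EB × F →L[ℝ] ℝ := a
  let c' : EB →L[ℝ] ℝ := a'.comp (ContinuousLinearMap.inl ℝ EB F)
  -- Every vector `(0, m)` of the chart is a vertical lift, so the hypothesis removes the fibre
  -- component of `a`.
  have h0 : ∀ m : F, a' (0, m) = 0 := by
    intro m
    have hx := mem_baseSet_trivializationAt F V t.1
    have h1 := DFunLike.congr_fun ha ((trivializationAt F V t.1).symmL ℝ t.1 m)
    have h2 := verticalLift_apply (IB := IB) t ((trivializationAt F V t.1).symmL ℝ t.1 m)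
    rw [Trivialization.continuousLinearMapAt_symmL _ hx] at h2
    exact (congrArg a' h2).symm.trans h1
  have h1 : ∀ v : EB × F, a' v = c' v.1 := fun v => by
    have h2 : v = (v.1, 0) + (0, v.2) := by simp
    calc a' v = a' ((v.1, 0) + (0, v.2)) := by rw [← h2]
      _ = a' (v.1, 0) := by rw [map_add, h0, add_zero]
  refine ⟨c', ?_⟩
  ext v
  exact (h1 v).trans (congrArg c' (mfderiv_proj_apply t v)).symm

theorem mfderiv_proj_surjective (t : TotalSpace F V) :
    Function.Surjective (mfderiv (IB.prod 𝓘(ℝ, F)) IB (TotalSpace.proj : TotalSpace F V → B) t) :=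
  fun u => ⟨((u, 0) : EB × F), mfderiv_proj_apply t _⟩

/-- The vertical part of the differential of a function that is affine on the fiber. -/
theorem verticalPart_differential {N : TotalSpace F V → ℝ} {t : TotalSpace F V}
    (hN : MDifferentiableAt (IB.prod 𝓘(ℝ, F)) 𝓘(ℝ, ℝ) N t) (ℓ : V t.1 →L[ℝ] ℝ) (c : ℝ)
    (h : ∀ v, N ⟨t.1, v⟩ = ℓ v + c) : verticalPart t (differential (IB.prod 𝓘(ℝ, F)) N t) = ℓ := by
  have hx := mem_baseSet_trivializationAt F V t.1
  set e := trivializationAt F V t.1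
  set m₀ := e.continuousLinearMapAt ℝ t.1 t.2
  have hm : (⟨t.1, e.symm t.1 m₀⟩ : TotalSpace F V) = t :=
    congrArg (TotalSpace.mk t.1)
      ((e.symmL_apply (R := ℝ) hx m₀).symm.trans (e.symmL_continuousLinearMapAt hx t.2))
  ext v
  have h1 := mfderiv_comp_apply_of_eq m₀ hN
    ((contMDiff_fiberInclusion (IB := IB) t.1).mdifferentiable (by simp) m₀) hm
      (e.continuousLinearMapAt ℝ t.1 v)
  refine h1.symm.trans ?_
  let ℓ' : F →L[ℝ] ℝ := ℓ.comp (e.symmL ℝ t.1)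
  -- In the linear fibre coordinate `N` is a continuous linear functional plus a constant.
  have h2 : (N ∘ fun m : F => (⟨t.1, e.symm t.1 m⟩ : TotalSpace F V)) = fun m => ℓ' m + c := by
    funext m
    exact (h _).trans (congrArg (fun v => ℓ v + c) (e.symmL_apply (R := ℝ) hx m).symm)
  have h3 : mfderiv 𝓘(ℝ, F) 𝓘(ℝ, ℝ) (fun m => ℓ' m + c) m₀ = ℓ' :=
    mfderiv_eq_fderiv.trans (ℓ'.hasFDerivAt.add_const c).fderiv
  refine (congrArg (fun f => mfderiv 𝓘(ℝ, F) 𝓘(ℝ, ℝ) f m₀ (e.continuousLinearMapAt ℝ t.1 v)) h2).trans ?_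
  refine (DFunLike.congr_fun h3 _).trans ?_
  exact congrArg ℓ (e.symmL_continuousLinearMapAt (R := ℝ) hx v)

theorem verticalPart_comp_proj (t : TotalSpace F V) (c : TangentSpace IB t.1 →L[ℝ] ℝ) :
    verticalPart t (c.comp (mfderiv (IB.prod 𝓘(ℝ, F)) IB
      (TotalSpace.proj : TotalSpace F V → B) t)) = 0 := by
  ext v
  have h := (mfderiv_proj_apply (IB := IB) t (verticalLift IB F t v)).trans
    (congrArg Prod.fst (verticalLift_apply (IB := IB) t v))
  exact (congrArg c h).trans (map_zero c)

end VectorBundle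

/-! ### The Lie bracket of vector fields in coordinates. -/

section LieBracket

variable {E H M : Type*} [NormedAddCommGroup E] [NormedSpace ℝ E] [TopologicalSpace H]
  {I : ModelWithCorners ℝ E H} [I.Boundaryless]
  [TopologicalSpace M] [ChartedSpace H M] [IsManifold I ∞ M]

/-- A vector field in the trivialization of the tangent bundle around `p`. -/
def vecCoord (p : M) (U : ∀ q : M, TangentSpace I q) (q : M) : E :=
  (trivializationAt E (TangentSpace I) p).continuousLinearMapAt ℝ q (U q)

theorem vecCoord_self (p : M) (U : ∀ q : M, TangentSpace I q) : vecCoord p U p = U p :=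
  tangent_continuousLinearMapAt_self p (U p)

theorem contMDiffAt_vecCoord {U : ∀ q : M, TangentSpace I q} {p : M}
    (hU : ContMDiffAt I (I.prod 𝓘(ℝ, E)) ∞ (fun q => (⟨q, U q⟩ : TangentBundle I M)) p) :
    ContMDiffAt I 𝓘(ℝ, E) ∞ (vecCoord p U) p := by
  refine ((contMDiffAt_section _).1 hU).congr_of_eventuallyEq ?_
  filter_upwards [chart_source_mem_nhds H p] with q hq
  exact Trivialization.continuousLinearMapAt_apply_of_mem ℝ _ (by simpa using hq) _

/-- The pull-back of a field by the inverse chart is its coordinate expression in the tangent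
trivialization, and the chart has the identity as derivative at `p`; what remains is the bracket in
a vector space. -/
theorem mlieBracket_eq_valueDeriv {U V : ∀ q : M, TangentSpace I q} {p : M}
    (hU : ContMDiffAt I 𝓘(ℝ, E) ∞ (vecCoord p U) p)
    (hV : ContMDiffAt I 𝓘(ℝ, E) ∞ (vecCoord p V) p) :
    (VectorField.mlieBracket I U V p : E) =
      valueDeriv I (vecCoord p V) p (U p) - valueDeriv I (vecCoord p U) p (V p) := by
  set φ := extChartAt I p
  have key : ∀ W : ∀ q : M, TangentSpace I q,
      (VectorField.mpullbackWithin 𝓘(ℝ, E) I φ.symm W (Set.range I) : E → E) =ᶠ[𝓝 (φ p)]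
        vecCoord p W ∘ φ.symm := by
    intro W
    filter_upwards [extChartAt_target_mem_nhds (I := I) p] with y hy
    have hs : φ.symm y ∈ (chartAt H p).source := by
      rw [← extChartAt_source I]; exact φ.map_target hy
    have hb : φ.symm y ∈ (trivializationAt E (TangentSpace I) p).baseSet := by simpa using hs
    have h1 := TangentBundle.symmL_trivializationAt (I := I) hs
    rw [φ.right_inv hy] at h1
    have h2 : (mfderivWithin 𝓘(ℝ, E) I φ.symm (Set.range I) y).inverse =
        (trivializationAt E (TangentSpace I) p).continuousLinearMapAt ℝ (φ.symm y) := by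
      refine (congrArg ContinuousLinearMap.inverse h1.symm).trans ?_
      refine ContinuousLinearMap.inverse_eq ?_ ?_
      · ext v
        exact Trivialization.symmL_continuousLinearMapAt _ hb v
      · ext v
        exact Trivialization.continuousLinearMapAt_symmL _ hb v
    exact DFunLike.congr_fun h2 _
  have hfd : ∀ W : ∀ q : M, TangentSpace I q, ContMDiffAt I 𝓘(ℝ, E) ∞ (vecCoord p W) p →
      fderivWithin ℝ (VectorField.mpullbackWithin 𝓘(ℝ, E) I φ.symm W (Set.range I) : E → E)
        (φ.symm ⁻¹' Set.univ ∩ Set.range I) (φ p) = valueDeriv I (vecCoord p W) p := by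
    intro W hW
    have hs : φ.symm ⁻¹' Set.univ ∩ Set.range I = Set.univ := by
      rw [I.range_eq_univ, Set.preimage_univ, Set.univ_inter]
    rw [hs]
    refine (congrFun (fderivWithin_univ (𝕜 := ℝ) (E := E) (F := E)) (φ p)).trans ?_
    exact (key W).fderiv_eq.trans (valueDeriv_eq (hW.mdifferentiableAt (by simp))).symm
  have hval : ∀ W : ∀ q : M, TangentSpace I q,
      (VectorField.mpullbackWithin 𝓘(ℝ, E) I φ.symm W (Set.range I) (φ p) : E) = W p := by
    intro W
    refine (key W).self_of_nhds.trans ?_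
    change vecCoord p W (φ.symm (φ p)) = _
    rw [extChartAt_to_inv]
    exact vecCoord_self p W
  have h0 : (mfderiv I 𝓘(ℝ, E) φ p).inverse = ContinuousLinearMap.id ℝ E :=
    (congrArg ContinuousLinearMap.inverse (mfderiv_extChartAt_self (I := I) (x := p))).trans
      ContinuousLinearMap.inverse_id
  have h1 : VectorField.lieBracketWithin ℝ
      (VectorField.mpullbackWithin 𝓘(ℝ, E) I φ.symm U (Set.range I) : E → E)
      (VectorField.mpullbackWithin 𝓘(ℝ, E) I φ.symm V (Set.range I) : E → E)
      (φ.symm ⁻¹' Set.univ ∩ Set.range I) (φ p) =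
        (valueDeriv I (vecCoord p V) p (U p) - valueDeriv I (vecCoord p U) p (V p) : E) := by
    unfold VectorField.lieBracketWithin
    rw [hfd V hV, hfd U hU]
    exact congrArg₂ (fun u v : E => (valueDeriv I (vecCoord p V) p u : E) -
      valueDeriv I (vecCoord p U) p v) (hval U) (hval V)
  exact (DFunLike.congr_fun h0 _).trans h1

/-- In `U(Vf) - V(Uf)` the second derivatives of `f` cancel by symmetry, leaving `df` applied to the
coordinate bracket. -/
theorem differential_mlieBracket {U V : ∀ q : M, TangentSpace I q} {f : M → ℝ} {p : M}
    (hf : ContMDiff I 𝓘(ℝ, ℝ) ∞ f)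
    (hU : ContMDiffAt I (I.prod 𝓘(ℝ, E)) ∞ (fun q => (⟨q, U q⟩ : TangentBundle I M)) p)
    (hV : ContMDiffAt I (I.prod 𝓘(ℝ, E)) ∞ (fun q => (⟨q, V q⟩ : TangentBundle I M)) p) :
    differential I f p (VectorField.mlieBracket I U V p) =
      differential I (fun q => differential I f q (V q)) p (U p) -
        differential I (fun q => differential I f q (U q)) p (V p) := by
  have hf' := contMDiffAt_formCoord_differential (hf p)
  have key : ∀ W : ∀ q : M, TangentSpace I q,
      ContMDiffAt I (I.prod 𝓘(ℝ, E)) ∞ (fun q => (⟨q, W q⟩ : TangentBundle I M)) p →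
      ∀ v : TangentSpace I p, differential I (fun q => differential I f q (W q)) p v =
        (differential I f p : E →L[ℝ] ℝ) (valueDeriv I (vecCoord p W) p v) +
          formDeriv (differential I f) p v (W p) := by
    intro W hW v
    have h1 : differential I (fun q => differential I f q (W q)) p =
        differential I (fun q => formCoord p (differential I f) q (vecCoord p W q)) p := by
      refine differential_congr ?_
      filter_upwards [chart_source_mem_nhds H p] with q hq
      exact (formCoord_apply _ hq _).symm
    rw [h1, differential_clm_apply (hf'.mdifferentiableAt (by simp))
      ((contMDiffAt_vecCoord hW).mdifferentiableAt (by simp)), formCoord_self, vecCoord_self]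
    rfl
  rw [key U hU, key V hV, formDeriv_differential_symm hf]
  have h := congrArg (differential I f p : E →L[ℝ] ℝ)
    (mlieBracket_eq_valueDeriv (contMDiffAt_vecCoord hU) (contMDiffAt_vecCoord hV))
  refine h.trans ?_
  refine (map_sub (differential I f p : E →L[ℝ] ℝ) _ _).trans ?_
  exact (add_sub_add_right_eq_sub (G := ℝ) _ _ _).symm

end LieBracket

/-! ### The bundle projection in the trivializations of the tangent bundles. -/

section ProjCoord

variable {EB HB B : Type*} [NormedAddCommGroup EB] [NormedSpace ℝ EB] [TopologicalSpace HB]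
  {IB : ModelWithCorners ℝ EB HB} [TopologicalSpace B] [ChartedSpace HB B] [IsManifold IB ∞ B]
  {F : Type*} [NormedAddCommGroup F] [NormedSpace ℝ F] {V : B → Type*}
  [TopologicalSpace (TotalSpace F V)] [∀ x, AddCommMonoid (V x)] [∀ x, Module ℝ (V x)]
  [∀ x, TopologicalSpace (V x)] [FiberBundle F V] [VectorBundle ℝ F V]
  [ContMDiffVectorBundle ∞ F V IB]

/-- In bundle charts the projection is the first projection. The formula is needed at points `s`
near `t`, not only at `t`, because the tautological form is going to be differentiated. -/
theorem mfderiv_proj_symmL (t : TotalSpace F V) {s : TotalSpace F V}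
    (hs : s ∈ (chartAt (ModelProd HB F) t).source) (hs' : s.1 ∈ (chartAt HB t.1).source)
    (v : EB × F) :
    mfderiv (IB.prod 𝓘(ℝ, F)) IB (TotalSpace.proj : TotalSpace F V → B) s
      ((trivializationAt (EB × F) (TangentSpace (IB.prod 𝓘(ℝ, F)) (M := TotalSpace F V)) t).symmL
        ℝ s v) = (trivializationAt EB (TangentSpace IB) t.1).symmL ℝ s.1 v.1 := by
  have hproj : MDifferentiableAt (IB.prod 𝓘(ℝ, F)) IB (TotalSpace.proj : TotalSpace F V → B) s :=
    (contMDiff_proj V (IB := IB) (n := ∞)).mdifferentiable (by simp) s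
  let u : TangentSpace (IB.prod 𝓘(ℝ, F)) s :=
    (trivializationAt (EB × F) (TangentSpace (IB.prod 𝓘(ℝ, F)) (M := TotalSpace F V)) t).symmL ℝ s v
  let fst : EB × F →L[ℝ] EB := ContinuousLinearMap.fst ℝ EB F
  have hb : s.1 ∈ (trivializationAt EB (TangentSpace IB) t.1).baseSet := by simpa using hs'
  have h1 := mfderiv_comp_apply s (g := extChartAt IB t.1) (I' := IB) (I'' := 𝓘(ℝ, EB))
    (mdifferentiableAt_extChartAt hs') hproj u
  have h2 := mfderiv_comp_apply s (g := fst) (f := extChartAt (IB.prod 𝓘(ℝ, F)) t)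
    (I' := 𝓘(ℝ, EB × F)) (I'' := 𝓘(ℝ, EB)) fst.mdifferentiableAt
    (mdifferentiableAt_extChartAt hs) u
  have h3 : (extChartAt IB t.1 ∘ (TotalSpace.proj : TotalSpace F V → B)) =ᶠ[𝓝 s]
      (fst ∘ extChartAt (IB.prod 𝓘(ℝ, F)) t) := by
    have hsrc : s ∈ (trivializationAt F V t.1).source := by
      rw [FiberBundle.chartedSpace_chartAt] at hs
      exact hs.1
    filter_upwards [(trivializationAt F V t.1).open_source.mem_nhds hsrc] with s' hs'
    simp only [Function.comp_apply]
    rw [extChartAt_totalSpace_apply]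
    exact congrArg _ ((trivializationAt F V t.1).coe_fst hs').symm
  have h4 := DFunLike.congr_fun (h3.mfderiv_eq (I := IB.prod 𝓘(ℝ, F)) (I' := 𝓘(ℝ, EB))) u
  have h5 : mfderiv (IB.prod 𝓘(ℝ, F)) 𝓘(ℝ, EB × F) (extChartAt (IB.prod 𝓘(ℝ, F)) t) s u =
      (v : EB × F) := by
    refine (DFunLike.congr_fun (TangentBundle.continuousLinearMapAt_trivializationAt
      (I := IB.prod 𝓘(ℝ, F)) hs).symm u).trans ?_
    exact Trivialization.continuousLinearMapAt_symmL _ (by simpa using hs) v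
  have h6 : mfderiv IB 𝓘(ℝ, EB) (extChartAt IB t.1) s.1
      (mfderiv (IB.prod 𝓘(ℝ, F)) IB (TotalSpace.proj : TotalSpace F V → B) s u) = v.1 := by
    refine h1.symm.trans (h4.trans (h2.trans ?_))
    refine (congrArg _ h5).trans ?_
    exact DFunLike.congr_fun fst.mfderiv_eq v
  have h7 := DFunLike.congr_fun (TangentBundle.continuousLinearMapAt_trivializationAt (I := IB) hs')
    (mfderiv (IB.prod 𝓘(ℝ, F)) IB (TotalSpace.proj : TotalSpace F V → B) s u)
  have h8 := congrArg ((trivializationAt EB (TangentSpace IB) t.1).symmL ℝ s.1) (h7.trans h6)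
  rw [Trivialization.symmL_continuousLinearMapAt _ hb] at h8
  exact h8

end ProjCoord

/-! ### Inverting a nondegenerate form; forms with linearly transported coordinates. -/

section Abstract

/-- By dimension an injective `D` is an equivalence, so `inverse` does not take its default value
zero. -/
theorem ContinuousLinearMap.inverse_apply_of_injective {V : Type*} [NormedAddCommGroup V]
    [NormedSpace ℝ V] [FiniteDimensional ℝ V] (D : V →L[ℝ] V →L[ℝ] ℝ)
    (hinj : Function.Injective D) {s : V} {β : V →L[ℝ] ℝ} (hs : D s = β) : D.inverse β = s := by
  have hdim : Module.finrank ℝ V = Module.finrank ℝ (V →L[ℝ] ℝ) := by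
    rw [← (LinearMap.toContinuousLinearMap (𝕜 := ℝ) (E := V) (F' := ℝ)).finrank_eq,
      Subspace.dual_finrank_eq]
  have hsurj : Function.Surjective D :=
    (LinearMap.injective_iff_surjective_of_finrank_eq_finrank (f := D.toLinearMap) hdim).1 hinj
  have : CompleteSpace V := FiniteDimensional.complete ℝ _
  let e : V ≃L[ℝ] (V →L[ℝ] ℝ) := ContinuousLinearEquiv.ofBijective D
      (LinearMap.ker_eq_bot.2 hinj) (LinearMap.range_eq_top.2 hsurj)
  have he : (e : V →L[ℝ] V →L[ℝ] ℝ) = D := ContinuousLinearEquiv.coe_ofBijective ..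
  rw [← hs, ← he, ContinuousLinearMap.inverse_equiv]
  exact e.symm_apply_apply s

/-- Composition with the first projection. -/
def precompFst (E P : Type*) [NormedAddCommGroup E] [NormedSpace ℝ E] [NormedAddCommGroup P]
    [NormedSpace ℝ P] : (E →L[ℝ] ℝ) →L[ℝ] (E × P) →L[ℝ] ℝ :=
  (ContinuousLinearMap.compL ℝ (E × P) E ℝ).flip (ContinuousLinearMap.fst ℝ E P)

/-- The fixed linear map `L` passes through the derivative. The use is for the tautological form,
whose coordinates depend linearly on the fibre coordinate of `T*M`. -/
theorem exteriorDerivative_of_formCoord_eq {E H M : Type*} [NormedAddCommGroup E] [NormedSpace ℝ E]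
    [TopologicalSpace H] {I : ModelWithCorners ℝ E H} [I.Boundaryless]
    [TopologicalSpace M] [ChartedSpace H M] [IsManifold I ∞ M] {Q : Type*} [NormedAddCommGroup Q]
    [NormedSpace ℝ Q] (L : Q →L[ℝ] E →L[ℝ] ℝ) {α : ∀ q : M, TangentSpace I q →L[ℝ] ℝ} {p : M}
    {c : M → Q} (hc : ContMDiffAt I 𝓘(ℝ, Q) ∞ c p)
    (hf : formCoord p α =ᶠ[𝓝 p] fun q => L (c q)) (u v : TangentSpace I p) :
    exteriorDerivative I α p u v =
      L (valueDeriv I c p u) v - L (valueDeriv I c p v) u := by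
  have hL : ContMDiffAt I 𝓘(ℝ, E →L[ℝ] ℝ) ∞ (formCoord p α) p :=
    (L.contMDiffAt.comp p hc).congr_of_eventuallyEq hf
  have key : ∀ u : TangentSpace I p, formDeriv α p u = L (valueDeriv I c p u) := by
    intro u
    have h1 : mfderiv I 𝓘(ℝ, E →L[ℝ] ℝ) (formCoord p α) p =
        mfderiv I 𝓘(ℝ, E →L[ℝ] ℝ) (L ∘ c) p := hf.mfderiv_eq
    have h2 := mfderiv_comp_apply p (g := L) (f := c) (I' := 𝓘(ℝ, Q))
      L.mdifferentiableAt (hc.mdifferentiableAt (by simp)) u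
    have h3 := DFunLike.congr_fun (L.mfderiv_eq (x := c p)) (valueDeriv I c p u)
    exact ((DFunLike.congr_fun h1 u).trans h2).trans h3
  exact (exteriorDerivative_apply hL u v).trans (congrArg₂ (· - ·)
    (DFunLike.congr_fun (key u) v) (DFunLike.congr_fun (key v) u))

end Abstract

/-! ### The canonical Poisson tensor of the cotangent bundle. -/

section Canonical

variable {E M : Type*} [NormedAddCommGroup E] [NormedSpace ℝ E]
  [TopologicalSpace M] [ChartedSpace E M] [IsManifold 𝓘(ℝ, E) ∞ M]

/-- The fiber coordinate of a covector in the trivialization around `ξ`. -/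
def cotangentCoord (ξ η : CotangentSpace 𝓘(ℝ, E) M) : E →L[ℝ] ℝ :=
  (trivializationAt (E →L[ℝ] ℝ)
    (fun p : M => TangentSpace 𝓘(ℝ, E) p →L[ℝ] Trivial M ℝ p) ξ.1 η).2

theorem cotangentCoord_eq (ξ η : CotangentSpace 𝓘(ℝ, E) M) (v : E) :
    cotangentCoord ξ η v =
      η.2 ((trivializationAt E (TangentSpace 𝓘(ℝ, E)) ξ.1).symmL ℝ η.1 v) := by
  unfold cotangentCoord
  rw [hom_trivializationAt_apply]
  simp [ContinuousLinearMap.inCoordinates]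

theorem contMDiffAt_cotangentCoord (ξ : CotangentSpace 𝓘(ℝ, E) M) :
    ContMDiffAt (𝓘(ℝ, E).prod 𝓘(ℝ, E →L[ℝ] ℝ)) 𝓘(ℝ, E →L[ℝ] ℝ) ∞ (cotangentCoord ξ) ξ :=
  (contMDiffAt_totalSpace.1 (contMDiffAt_id (x := ξ))).2

theorem cotangentCoord_self (ξ : CotangentSpace 𝓘(ℝ, E) M) (v : E) :
    cotangentCoord ξ ξ v = ξ.2 v := by
  rw [cotangentCoord_eq]
  exact congrArg ξ.2 (tangent_symmL_self ξ.1 v)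

theorem valueDeriv_cotangentCoord (ξ : CotangentSpace 𝓘(ℝ, E) M)
    (v : TangentSpace (𝓘(ℝ, E).prod 𝓘(ℝ, E →L[ℝ] ℝ)) ξ) :
    valueDeriv (𝓘(ℝ, E).prod 𝓘(ℝ, E →L[ℝ] ℝ)) (cotangentCoord ξ) ξ v =
      (v : E × (E →L[ℝ] ℝ)).2 :=
  valueDeriv_trivialization ξ v

theorem eventually_mem_chart_cotangent (ξ : CotangentSpace 𝓘(ℝ, E) M) :
    ∀ᶠ η in 𝓝 ξ, η.1 ∈ (chartAt E ξ.1).source :=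
  (FiberBundle.continuous_proj _ _).continuousAt.preimage_mem_nhds
    (chart_source_mem_nhds E ξ.1)

/-- The coordinate formula `θ = p dx`: the fibre coordinate applied to the base component. -/
theorem formCoord_tautologicalForm (ξ : CotangentSpace 𝓘(ℝ, E) M) :
    formCoord ξ (tautologicalForm 𝓘(ℝ, E)) =ᶠ[𝓝 ξ]
      fun η => (cotangentCoord ξ η).comp (ContinuousLinearMap.fst ℝ E (E →L[ℝ] ℝ)) := by
  filter_upwards [eventually_mem_chart_cotangent ξ,
    chart_source_mem_nhds (ModelProd E (E →L[ℝ] ℝ)) ξ] with η h1 h2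
  ext v
  · exact (congrArg η.2 (mfderiv_proj_symmL ξ h2 h1 _)).trans (cotangentCoord_eq ξ η _).symm
  · exact (congrArg η.2 (mfderiv_proj_symmL ξ h2 h1 _)).trans (cotangentCoord_eq ξ η _).symm

/-- This is `dp ∧ dx`; the sign fixes the convention `{p, x} = 1` for the inverse. -/
theorem exteriorDerivative_tautologicalForm (ξ : CotangentSpace 𝓘(ℝ, E) M)
    (u v : TangentSpace (𝓘(ℝ, E).prod 𝓘(ℝ, E →L[ℝ] ℝ)) ξ) :
    exteriorDerivative (𝓘(ℝ, E).prod 𝓘(ℝ, E →L[ℝ] ℝ)) (tautologicalForm 𝓘(ℝ, E)) ξ u v =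
      (u : E × (E →L[ℝ] ℝ)).2 (v : E × (E →L[ℝ] ℝ)).1 -
        (v : E × (E →L[ℝ] ℝ)).2 (u : E × (E →L[ℝ] ℝ)).1 := by
  have hc := contMDiffAt_cotangentCoord ξ
  have hf := formCoord_tautologicalForm ξ
  have h := exteriorDerivative_of_formCoord_eq (precompFst E (E →L[ℝ] ℝ)) hc hf u v
  rw [valueDeriv_cotangentCoord, valueDeriv_cotangentCoord] at h
  exact h

variable [FiniteDimensional ℝ E]

/-- The form `dp ∧ dx` is nondegenerate, as testing against `(e, 0)` and `(0, c)` shows; hence any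
solution of `i_s ω = β` is the value of the inverse. -/
theorem canonicalSharp_eq {ξ : CotangentSpace 𝓘(ℝ, E) M}
    {β : TangentSpace (𝓘(ℝ, E).prod 𝓘(ℝ, E →L[ℝ] ℝ)) ξ →L[ℝ] ℝ} (s : E × (E →L[ℝ] ℝ))
    (h : ∀ v : E × (E →L[ℝ] ℝ), s.2 v.1 - v.2 s.1 = β v) :
    (canonicalSharp 𝓘(ℝ, E) ξ β : E × (E →L[ℝ] ℝ)) = s := by
  refine ContinuousLinearMap.inverse_apply_of_injective (V := E × (E →L[ℝ] ℝ))
    (exteriorDerivative (𝓘(ℝ, E).prod 𝓘(ℝ, E →L[ℝ] ℝ)) (tautologicalForm 𝓘(ℝ, E)) ξ) ?_ ?_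
  · refine (injective_iff_map_eq_zero _).2 ?_
    rintro ⟨y, p⟩ hu
    have hD : ∀ v : E × (E →L[ℝ] ℝ), p v.1 - v.2 y = 0 := fun v =>
      (exteriorDerivative_tautologicalForm ξ (y, p) v).symm.trans (DFunLike.congr_fun hu v)
    have h1 : p = 0 := by
      ext e
      simpa using hD (e, 0)
    have h2 : y = 0 := by
      by_contra hne
      obtain ⟨c, hc⟩ := SeparatingDual.exists_ne_zero (R := ℝ) hne
      exact hc (by simpa using hD (0, c))
    rw [h1, h2]; rfl
  · refine ContinuousLinearMap.ext fun v => ?_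
    exact (exteriorDerivative_tautologicalForm ξ s v).trans (h v)

/-- The function `ξ ↦ ξ (U)` on the cotangent bundle. -/
def momentum (U : ∀ x : M, TangentSpace 𝓘(ℝ, E) x) (ξ : CotangentSpace 𝓘(ℝ, E) M) : ℝ := ξ.2 (U ξ.1)

variable {U V : ∀ x : M, TangentSpace 𝓘(ℝ, E) x}

/-- Written as a pairing of coordinates, the momentum can be differentiated by the product rule. -/
theorem momentum_eventuallyEq (U : ∀ x : M, TangentSpace 𝓘(ℝ, E) x)
    (ξ : CotangentSpace 𝓘(ℝ, E) M) :
    momentum U =ᶠ[𝓝 ξ] fun η => cotangentCoord ξ η (vecCoord ξ.1 U η.1) := by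
  filter_upwards [eventually_mem_chart_cotangent ξ] with η h1
  rw [cotangentCoord_eq]
  exact congrArg η.2 (Trivialization.symmL_continuousLinearMapAt _ (by simpa using h1) _).symm

theorem contMDiffAt_momentum {ξ : CotangentSpace 𝓘(ℝ, E) M}
    (hU : ContMDiffAt 𝓘(ℝ, E) 𝓘(ℝ, E) ∞ (vecCoord ξ.1 U) ξ.1) :
    ContMDiffAt (𝓘(ℝ, E).prod 𝓘(ℝ, E →L[ℝ] ℝ)) 𝓘(ℝ, ℝ) ∞ (momentum U) ξ :=
  ((contMDiffAt_cotangentCoord ξ).clm_apply (hU.comp ξ (contMDiff_proj _ ξ))).congr_of_eventuallyEq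
    (momentum_eventuallyEq U ξ)

theorem differential_momentum {ξ : CotangentSpace 𝓘(ℝ, E) M}
    (hU : ContMDiffAt 𝓘(ℝ, E) 𝓘(ℝ, E) ∞ (vecCoord ξ.1 U) ξ.1)
    (v : TangentSpace (𝓘(ℝ, E).prod 𝓘(ℝ, E →L[ℝ] ℝ)) ξ) :
    differential (𝓘(ℝ, E).prod 𝓘(ℝ, E →L[ℝ] ℝ)) (momentum U) ξ v =
      ξ.2 (valueDeriv 𝓘(ℝ, E) (vecCoord ξ.1 U) ξ.1 (v : E × (E →L[ℝ] ℝ)).1) +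
        (v : E × (E →L[ℝ] ℝ)).2 (U ξ.1) := by
  rw [differential_congr (momentum_eventuallyEq U ξ)]
  have hp : MDifferentiableAt (𝓘(ℝ, E).prod 𝓘(ℝ, E →L[ℝ] ℝ)) 𝓘(ℝ, E)
      (TotalSpace.proj : CotangentSpace 𝓘(ℝ, E) M → M) ξ :=
    (contMDiff_proj _ (IB := 𝓘(ℝ, E)) (n := ∞)).mdifferentiable (by simp) ξ
  have hU' := hU.mdifferentiableAt (by simp : (∞ : WithTop ℕ∞) ≠ 0)
  have h0 := differential_clm_apply (s := fun η : CotangentSpace 𝓘(ℝ, E) M => vecCoord ξ.1 U η.1)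
    ((contMDiffAt_cotangentCoord ξ).mdifferentiableAt (by simp)) (hU'.comp ξ hp) v
  rw [cotangentCoord_self, valueDeriv_cotangentCoord] at h0
  refine h0.trans ?_
  have h1 := mfderiv_comp_apply ξ hU' hp v
  have h2 : vecCoord ξ.1 U ξ.1 = U ξ.1 := vecCoord_self _ _
  have h3 := congrArg (valueDeriv 𝓘(ℝ, E) (vecCoord ξ.1 U) ξ.1) (mfderiv_proj_apply ξ v)
  exact congrArg₂ (fun a b : E => ξ.2 a + (v : E × (E →L[ℝ] ℝ)).2 b) (h1.trans h3) h2

/-- For a covector from the base, the equation `i_s (dp ∧ dx) = c dx` is solved by the vertical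
vector `c`. -/
theorem canonicalSharp_comp_proj {ξ : CotangentSpace 𝓘(ℝ, E) M}
    (c : TangentSpace 𝓘(ℝ, E) ξ.1 →L[ℝ] ℝ) :
    (canonicalSharp 𝓘(ℝ, E) ξ (c.comp (mfderiv (𝓘(ℝ, E).prod 𝓘(ℝ, E →L[ℝ] ℝ)) 𝓘(ℝ, E)
      (TotalSpace.proj : CotangentSpace 𝓘(ℝ, E) M → M) ξ)) : E × (E →L[ℝ] ℝ)) = (0, c) := by
  refine canonicalSharp_eq _ fun v => ?_
  have h := congrArg c (mfderiv_proj_apply ξ v)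
  refine Eq.trans ?_ h.symm
  exact (congrArg (_ - ·) (map_zero v.2)).trans (sub_zero (G := ℝ) _)

theorem proj_canonicalSharp_comp_proj {ξ : CotangentSpace 𝓘(ℝ, E) M}
    (c : TangentSpace 𝓘(ℝ, E) ξ.1 →L[ℝ] ℝ) :
    mfderiv (𝓘(ℝ, E).prod 𝓘(ℝ, E →L[ℝ] ℝ)) 𝓘(ℝ, E)
      (TotalSpace.proj : CotangentSpace 𝓘(ℝ, E) M → M) ξ
      (canonicalSharp 𝓘(ℝ, E) ξ (c.comp (mfderiv (𝓘(ℝ, E).prod 𝓘(ℝ, E →L[ℝ] ℝ)) 𝓘(ℝ, E)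
        (TotalSpace.proj : CotangentSpace 𝓘(ℝ, E) M → M) ξ))) = 0 :=
  (mfderiv_proj_apply ξ _).trans (congrArg Prod.fst (canonicalSharp_comp_proj c))

theorem differential_momentum_canonicalSharp_comp_proj {ξ : CotangentSpace 𝓘(ℝ, E) M}
    (hU : ContMDiffAt 𝓘(ℝ, E) 𝓘(ℝ, E) ∞ (vecCoord ξ.1 U) ξ.1)
    (c : TangentSpace 𝓘(ℝ, E) ξ.1 →L[ℝ] ℝ) :
    differential (𝓘(ℝ, E).prod 𝓘(ℝ, E →L[ℝ] ℝ)) (momentum U) ξ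
      (canonicalSharp 𝓘(ℝ, E) ξ (c.comp (mfderiv (𝓘(ℝ, E).prod 𝓘(ℝ, E →L[ℝ] ℝ)) 𝓘(ℝ, E)
        (TotalSpace.proj : CotangentSpace 𝓘(ℝ, E) M → M) ξ))) = c (U ξ.1) := by
  rw [differential_momentum hU, canonicalSharp_comp_proj c]
  have h : ξ.2 (valueDeriv 𝓘(ℝ, E) (vecCoord ξ.1 U) ξ.1 (0 : E)) = 0 :=
    (congrArg ξ.2 (map_zero _)).trans (map_zero _)
  exact (congrArg (· + c (U ξ.1)) h).trans (zero_add (M := ℝ) _)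

/-- The minus sign on the base component comes from `X_f = w♯ df` with `{p, x} = 1`. The same sign
occurs in the anchor `-w♯` and in the definition of `hor_H`. -/
theorem canonicalSharp_momentum {ξ : CotangentSpace 𝓘(ℝ, E) M}
    (hV : ContMDiffAt 𝓘(ℝ, E) 𝓘(ℝ, E) ∞ (vecCoord ξ.1 V) ξ.1) :
    (canonicalSharp 𝓘(ℝ, E) ξ (differential (𝓘(ℝ, E).prod 𝓘(ℝ, E →L[ℝ] ℝ)) (momentum V) ξ) :
      E × (E →L[ℝ] ℝ)) = (-(V ξ.1 : E),
        (ξ.2 : E →L[ℝ] ℝ).comp (valueDeriv 𝓘(ℝ, E) (vecCoord ξ.1 V) ξ.1 : E →L[ℝ] E)) := by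
  refine canonicalSharp_eq _ fun v => ?_
  refine Eq.trans ?_ (differential_momentum hV v).symm
  have h : v.2 (-(V ξ.1 : E)) = - v.2 (V ξ.1 : E) := map_neg _ _
  exact (congrArg (_ - ·) h).trans (sub_neg_eq_add (α := ℝ) _ _)

/-- Inserting the Hamiltonian field of the second momentum gives `ξ(DV(U)) - ξ(DU(V))`, that is, `ξ`
applied to the coordinate Lie bracket. -/
theorem differential_momentum_canonicalSharp_momentum {ξ : CotangentSpace 𝓘(ℝ, E) M}
    (hU : ContMDiffAt 𝓘(ℝ, E) 𝓘(ℝ, E) ∞ (vecCoord ξ.1 U) ξ.1)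
    (hV : ContMDiffAt 𝓘(ℝ, E) 𝓘(ℝ, E) ∞ (vecCoord ξ.1 V) ξ.1) :
    differential (𝓘(ℝ, E).prod 𝓘(ℝ, E →L[ℝ] ℝ)) (momentum U) ξ
      (canonicalSharp 𝓘(ℝ, E) ξ
        (differential (𝓘(ℝ, E).prod 𝓘(ℝ, E →L[ℝ] ℝ)) (momentum V) ξ)) =
      ξ.2 (VectorField.mlieBracket 𝓘(ℝ, E) U V ξ.1) := by
  rw [differential_momentum hU, canonicalSharp_momentum hV]
  have h1 := congrArg (ξ.2 : E →L[ℝ] ℝ) (mlieBracket_eq_valueDeriv hU hV)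
  have h2 : (ξ.2 : E →L[ℝ] ℝ) (valueDeriv 𝓘(ℝ, E) (vecCoord ξ.1 U) ξ.1 (-(V ξ.1 : E))) =
      - (ξ.2 : E →L[ℝ] ℝ) (valueDeriv 𝓘(ℝ, E) (vecCoord ξ.1 U) ξ.1 (V ξ.1)) :=
    (congrArg (ξ.2 : E →L[ℝ] ℝ) (map_neg (valueDeriv 𝓘(ℝ, E) (vecCoord ξ.1 U) ξ.1) (V ξ.1))).trans
      (map_neg (ξ.2 : E →L[ℝ] ℝ) _)
  refine Eq.trans ?_ h1.symm
  refine Eq.trans ?_ (map_sub (ξ.2 : E →L[ℝ] ℝ) _ _).symm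
  refine (congrArg (· + _) h2).trans ?_
  exact neg_add_eq_sub (α := ℝ) _ _

theorem proj_canonicalSharp_momentum {ξ : CotangentSpace 𝓘(ℝ, E) M}
    (hV : ContMDiffAt 𝓘(ℝ, E) 𝓘(ℝ, E) ∞ (vecCoord ξ.1 V) ξ.1) :
    mfderiv (𝓘(ℝ, E).prod 𝓘(ℝ, E →L[ℝ] ℝ)) 𝓘(ℝ, E)
      (TotalSpace.proj : CotangentSpace 𝓘(ℝ, E) M → M) ξ
      (canonicalSharp 𝓘(ℝ, E) ξ
        (differential (𝓘(ℝ, E).prod 𝓘(ℝ, E →L[ℝ] ℝ)) (momentum V) ξ)) = - V ξ.1 :=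
  (mfderiv_proj_apply ξ _).trans (congrArg Prod.fst (canonicalSharp_momentum hV))

end Canonical

theorem tangent_ext {E H M : Type*} [NormedAddCommGroup E] [NormedSpace ℝ E] [TopologicalSpace H]
    {I : ModelWithCorners ℝ E H} [TopologicalSpace M] [ChartedSpace H M] {p : M}
    {u v : TangentSpace I p} (h : ∀ c : TangentSpace I p →L[ℝ] ℝ, c u = c v) : u = v :=
  (SeparatingDual.eq_iff_forall_dual_eq (R := ℝ) (V := E)).2 h

theorem BivectorField.bracket_skew {E H M : Type*} [NormedAddCommGroup E] [NormedSpace ℝ E]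
    [TopologicalSpace H] {I : ModelWithCorners ℝ E H} [TopologicalSpace M] [ChartedSpace H M]
    (w : BivectorField I M) (f g : M → ℝ) (p : M) : w.bracket f g p = - w.bracket g f p :=
  w.skew' p _ _

/-! ### The Poisson bracket as a bilinear map on smooth functions. -/

section BracketMap

variable {E M : Type*} [NormedAddCommGroup E] [NormedSpace ℝ E] [FiniteDimensional ℝ E]
  [TopologicalSpace M] [ChartedSpace E M] [IsManifold 𝓘(ℝ, E) ∞ M]
  (w : BivectorField 𝓘(ℝ, E) M)

/-- The bracket of smooth functions, as a bilinear map. -/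
def BivectorField.bracketₗ : C^∞⟮𝓘(ℝ, E), M; 𝓘(ℝ, ℝ), ℝ⟯ →ₗ[ℝ]
    C^∞⟮𝓘(ℝ, E), M; 𝓘(ℝ, ℝ), ℝ⟯ →ₗ[ℝ] C^∞⟮𝓘(ℝ, E), M; 𝓘(ℝ, ℝ), ℝ⟯ :=
  LinearMap.mk₂ ℝ w.bracketMap
    (fun f f' g => ContMDiffMap.ext fun p =>
      DFunLike.congr_fun (map_add (differentialAt 𝓘(ℝ, E) p) f f') _)
    (fun c f g => ContMDiffMap.ext fun p =>
      DFunLike.congr_fun (map_smul (differentialAt 𝓘(ℝ, E) p) c f) _)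
    (fun f g g' => ContMDiffMap.ext fun p =>
      (congrArg (fun l => differential 𝓘(ℝ, E) f p (w.sharp p l))
        (map_add (differentialAt 𝓘(ℝ, E) p) g g')).trans (by
          rw [map_add, map_add]; rfl))
    (fun c f g => ContMDiffMap.ext fun p =>
      (congrArg (fun l => differential 𝓘(ℝ, E) f p (w.sharp p l))
        (map_smul (differentialAt 𝓘(ℝ, E) p) c g)).trans (by
          rw [map_smul, map_smul]; rfl))

@[simp] theorem BivectorField.bracketₗ_apply (f g : C^∞⟮𝓘(ℝ, E), M; 𝓘(ℝ, ℝ), ℝ⟯) :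
    w.bracketₗ f g = w.bracketMap f g := rfl

theorem BivectorField.bracketMap_apply (f g : C^∞⟮𝓘(ℝ, E), M; 𝓘(ℝ, ℝ), ℝ⟯) (p : M) :
    w.bracketMap f g p = differential 𝓘(ℝ, E) f p (w.sharp p (differential 𝓘(ℝ, E) g p)) := rfl

theorem BivectorField.differential_bracketMap_skew (f g : C^∞⟮𝓘(ℝ, E), M; 𝓘(ℝ, ℝ), ℝ⟯) (p : M) :
    differential 𝓘(ℝ, E) (w.bracketMap f g) p = - differential 𝓘(ℝ, E) (w.bracketMap g f) p := by
  rw [← differential_neg]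
  exact congrArg (fun h => differential 𝓘(ℝ, E) h p) (funext fun q => w.bracket_skew f g q)

theorem BivectorField.differential_bracketMap_self (f : C^∞⟮𝓘(ℝ, E), M; 𝓘(ℝ, ℝ), ℝ⟯) (p : M) :
    differential 𝓘(ℝ, E) (w.bracketMap f f) p = 0 := by
  ext v
  exact self_eq_neg.1 (DFunLike.congr_fun (w.differential_bracketMap_skew f f p) v)

variable [T2Space M]

/-- The differential of a bracket at a critical point of the first function. -/
theorem BivectorField.differential_bracketMap_of_critical
    {f : C^∞⟮𝓘(ℝ, E), M; 𝓘(ℝ, ℝ), ℝ⟯} (g : C^∞⟮𝓘(ℝ, E), M; 𝓘(ℝ, ℝ), ℝ⟯) {p : M}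
    (hf : differential 𝓘(ℝ, E) f p = 0) (v : TangentSpace 𝓘(ℝ, E) p) :
    differential 𝓘(ℝ, E) (w.bracketMap f g) p v =
      hessian 𝓘(ℝ, E) f p (w.sharp p (differential 𝓘(ℝ, E) g p)) v := by
  have h1 := DFunLike.congr_fun (w.formBracket_exact f g p) v
  have h2 := w.formBracket_of_eq_zero (A := exactForm f) (B := exactForm g) hf v
  have h3 : formDeriv (fun q => exactForm f q) p = hessian 𝓘(ℝ, E) f p :=
    formDeriv_differential f.contMDiff
  rw [h3] at h2
  exact h1.symm.trans h2

end BracketMap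

/-! ### Linear algebra along the Lagrangian submanifold. -/

section Setting

universe uS
variable {EZ Z ES : Type*} {S : Type uS} {EX X : Type*}
  [NormedAddCommGroup EZ] [NormedSpace ℝ EZ] [TopologicalSpace Z] [ChartedSpace EZ Z]
  [NormedAddCommGroup ES] [NormedSpace ℝ ES] [TopologicalSpace S] [ChartedSpace ES S]
  [NormedAddCommGroup EX] [NormedSpace ℝ EX] [TopologicalSpace X] [ChartedSpace EX X]

namespace LagrangianInLeaf

variable (D : LagrangianInLeaf EZ Z ES S EX X)

theorem incl_isEmbedding : Topology.IsEmbedding D.incl.map :=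
  D.leaf_isEmbedding.comp D.lag_isEmbedding

theorem sharp_mem_range_leaf (x : X) (l : TangentSpace 𝓘(ℝ, EZ) (D.incl.map x) →L[ℝ] ℝ) :
    ∃ u, D.leaf.deriv (D.lag.map x) u = D.w.sharp (D.incl.map x) l :=
  ⟨_, D.isLeaf.toIsIntegralManifold.deriv_sharpToLeaf (D.lag.map x) l⟩

theorem exists_sharp_eq_leaf (s : S) (u : TangentSpace 𝓘(ℝ, ES) s) :
    ∃ l, D.w.sharp (D.leaf.map s) l = D.leaf.deriv s u := by
  obtain ⟨l, rfl⟩ := D.isLeaf.toIsIntegralManifold.sharpToLeaf_surjective s u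
  exact ⟨l, (D.isLeaf.toIsIntegralManifold.deriv_sharpToLeaf s l).symm⟩

/-- `TS` is the range of the skew map `w♯`, so its annihilator is the kernel. -/
theorem mem_conormal_leaf_iff (s : S) (l : TangentSpace 𝓘(ℝ, EZ) (D.leaf.map s) →L[ℝ] ℝ) :
    l ∈ D.leaf.Conormal s ↔ D.w.sharp (D.leaf.map s) l = 0 := by
  constructor
  · intro h
    refine tangent_ext fun m => ?_
    have h1 := D.w.skew' (D.leaf.map s) m l
    refine h1.trans (Eq.trans ?_ (map_zero m).symm)
    rw [← D.isLeaf.toIsIntegralManifold.deriv_sharpToLeaf s m, h _, neg_zero]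
  · intro h u
    obtain ⟨m, hm⟩ := D.exists_sharp_eq_leaf s u
    rw [← hm, D.w.skew', h, map_zero, neg_zero]

theorem incl_deriv_anchor (x : X) (l : D.EFiber x) :
    D.incl.deriv x (D.anchor x l) = - D.w.sharp (D.incl.map x) l := by
  have := LinearEquiv.apply_symm_apply
    (LinearEquiv.ofInjective (D.incl.deriv x).toLinearMap (D.incl.injective_mfderiv x))
    (LinearMap.codRestrict (D.incl.tangentImage x)
      (-(D.w.sharp (D.incl.map x)) ∘ₗ (D.EFiber x).subtype) (D.neg_sharp_mem x) l)
  exact congrArg Subtype.val this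

theorem sharp_eq_neg_anchor (x : X) (l : D.EFiber x) :
    D.w.sharp (D.incl.map x) l = - D.incl.deriv x (D.anchor x l) := by
  rw [incl_deriv_anchor, neg_neg]

/-- Since `TX` injects into `TZ`, the kernel of the anchor is the kernel of `w♯` on `E_X`, which is
`L_X`. -/
theorem anchor_eq_zero_iff (x : X) (l : D.EFiber x) : D.anchor x l = 0 ↔ l.1 ∈ D.LFiber x := by
  rw [show l.1 ∈ D.LFiber x ↔ _ from D.mem_conormal_leaf_iff (D.lag.map x) l.1]
  constructor
  · intro h
    have := D.sharp_eq_neg_anchor x l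
    rw [h, map_zero, neg_zero] at this
    exact this
  · intro h
    refine D.incl.injective_mfderiv x ?_
    refine (D.incl_deriv_anchor x l).trans ?_
    refine (congrArg Neg.neg h).trans (neg_zero.trans ?_)
    exact (map_zero (D.incl.deriv x)).symm

theorem lag_deriv_anchor (x : X) (l : D.EFiber x) :
    D.lag.deriv x (D.anchor x l) =
      - D.isLeaf.toIsIntegralManifold.sharpToLeaf (D.lag.map x) l.1 := by
  refine D.leaf.injective_mfderiv (D.lag.map x) ?_
  refine (D.leaf.comp_deriv D.lag x _).symm.trans ((D.incl_deriv_anchor x l).trans ?_)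
  refine Eq.trans ?_ (map_neg (D.leaf.deriv (D.lag.map x)) _).symm
  exact congrArg Neg.neg (D.isLeaf.toIsIntegralManifold.deriv_sharpToLeaf (D.lag.map x) l.1).symm

/-- If `ω♭ (w♯ l) = l|_TS` vanishes, then `l` lies in `(TS)⁰ = ker w♯`. -/
theorem flat_injective (s : S) : Function.Injective (D.isLeaf.flat s) := by
  rw [injective_iff_map_eq_zero]
  intro u hu
  obtain ⟨l, rfl⟩ := D.isLeaf.toIsIntegralManifold.sharpToLeaf_surjective s u
  rw [D.isLeaf.toIsIntegralManifold.flat_sharpToLeaf] at hu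
  have h := (D.mem_conormal_leaf_iff s l).1 fun u => DFunLike.congr_fun hu u
  rw [← D.isLeaf.toIsIntegralManifold.deriv_sharpToLeaf s l] at h
  exact D.leaf.injective_mfderiv s (h.trans (map_zero (D.leaf.deriv s)).symm)

variable [IsManifold 𝓘(ℝ, EZ) ∞ Z]

namespace AdmissibleHamiltonian

variable {D} (H : D.AdmissibleHamiltonian)

theorem restrictToLeaf_alpha (x : X) (u : TangentSpace 𝓘(ℝ, EX) x) :
    D.restrictToLeaf x (H.alpha x u) = D.flatX x (-u) :=
  (LinearEquiv.ofBijective (H.tV₀ x) (H.bijective_tV₀ x)).apply_symm_apply (D.flatX x (-u))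

/-- The restriction of `α_H u` to `TS` is `-ω♭ u`, because `t^V H_0` cancels its inverse; the
restriction of any `l` in `E_X` is `ω♭ (w♯ l)`, that is, `-ω♭` of its anchor. Injectivity of `ω♭`
makes `α_H` a splitting of the anchor. -/
theorem anchor_alpha (x : X) (u : TangentSpace 𝓘(ℝ, EX) x) : D.anchor x (H.alpha x u) = u := by
  refine D.lag.injective_mfderiv x ?_
  refine (D.lag_deriv_anchor x _).trans (D.flat_injective _ ?_)
  have h0 := D.isLeaf.toIsIntegralManifold.flat_sharpToLeaf (D.lag.map x) (H.alpha x u).1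
  have h := congrArg Subtype.val (H.restrictToLeaf_alpha x u)
  have h' : (D.flatX x (-u)).1 = - D.isLeaf.flat (D.lag.map x) (D.lag.deriv x u) :=
    (congrArg (D.isLeaf.flat (D.lag.map x)) (map_neg (D.lag.deriv x) u)).trans (map_neg _ _)
  exact (map_neg (D.isLeaf.flat (D.lag.map x)) _).trans
    ((congrArg Neg.neg (h0.trans (h.trans h'))).trans (neg_neg _))

theorem flatX_neg_anchor (x : X) (l : D.EFiber x) :
    D.flatX x (-(D.anchor x l)) = D.restrictToLeaf x l := by
  refine Subtype.ext ?_
  have h : D.lag.deriv x (-(D.anchor x l)) =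
      D.isLeaf.toIsIntegralManifold.sharpToLeaf (D.lag.map x) l.1 :=
    (map_neg (D.lag.deriv x) _).trans ((congrArg Neg.neg (D.lag_deriv_anchor x l)).trans (neg_neg _))
  exact (congrArg (D.isLeaf.flat (D.lag.map x)) h).trans
    (D.isLeaf.toIsIntegralManifold.flat_sharpToLeaf _ _)

/-- For `l = t^V H v`, `-ω♭` of the anchor is the restriction `t^V H_0 v`, so `(t^V H_0)⁻¹` gives
back `v`. Thus `α_H ∘ anchor` fixes the image of `t^V H`. -/
theorem alpha_anchor_tV (x : X) (v : D.lag.NormalSpace x) :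
    H.alpha x (D.anchor x (H.tV x v)) = H.tV x v := by
  change H.tV x ((LinearEquiv.ofBijective (H.tV₀ x) (H.bijective_tV₀ x)).symm
    (D.flatX x (-(D.anchor x (H.tV x v))))) = _
  rw [flatX_neg_anchor]
  congr 1
  exact LinearEquiv.symm_apply_apply (LinearEquiv.ofBijective (H.tV₀ x) (H.bijective_tV₀ x)) v

theorem alpha_anchor_tVTangent (x : X) (v : TangentSpace 𝓘(ℝ, ES) (D.lag.map x)) :
    H.alpha x (D.anchor x (H.tVTangent x v)) = H.tVTangent x v :=
  H.alpha_anchor_tV x (D.lag.proj x v)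

theorem exists_alpha_eq_tVTangent (x : X) (u : TangentSpace 𝓘(ℝ, EX) x) :
    ∃ v, H.alpha x u = H.tVTangent x v := by
  obtain ⟨v, hv⟩ := (D.lag.tangentImage x).mkQ_surjective
    ((LinearEquiv.ofBijective (H.tV₀ x) (H.bijective_tV₀ x)).symm (D.flatX x (-u)))
  exact ⟨v, (congrArg (H.tV x) hv).symm⟩

/-- The splitting gives `E_X = α_H(TX) ⊕ L_X`, with `L_X` the kernel of the anchor. -/
theorem sub_alpha_anchor_mem (x : X) (l : D.EFiber x) :
    (l - H.alpha x (D.anchor x l)).1 ∈ D.LFiber x := by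
  refine (D.anchor_eq_zero_iff x _).1 ?_
  refine (map_sub (D.anchor x) l (H.alpha x (D.anchor x l))).trans ?_
  rw [anchor_alpha]
  exact sub_self _

end AdmissibleHamiltonian

end LagrangianInLeaf

end Setting

theorem VField.contMDiffAt_vecCoord {E M : Type*} [NormedAddCommGroup E] [NormedSpace ℝ E]
    [TopologicalSpace M] [ChartedSpace E M] [IsManifold 𝓘(ℝ, E) ∞ M] (U : VField 𝓘(ℝ, E) M) (p : M) :
    ContMDiffAt 𝓘(ℝ, E) 𝓘(ℝ, E) ∞ (vecCoord p fun q => U q) p :=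
  _root_.contMDiffAt_vecCoord (U.contMDiff p)

/-! ### Functions vanishing on an immersed manifold. -/

namespace SmoothImmersion

variable {E M E' N : Type*} [NormedAddCommGroup E] [NormedSpace ℝ E]
    [TopologicalSpace M] [ChartedSpace E M] [NormedAddCommGroup E'] [NormedSpace ℝ E']
    [TopologicalSpace N] [ChartedSpace E' N] (k : SmoothImmersion E M E' N)

/-- The smooth functions that vanish on an immersed manifold. -/
def vanishing : Submodule ℝ C^∞⟮𝓘(ℝ, E'), N; 𝓘(ℝ, ℝ), ℝ⟯ where
  carrier := {f | ∀ x, f (k.map x) = 0}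
  add_mem' {f g} hf hg x := by
    have := congrArg₂ (· + ·) (hf x) (hg x)
    simpa using this
  zero_mem' _ := rfl
  smul_mem' c f hf x := by
    have := congrArg (c * ·) (hf x)
    simpa using this

theorem differential_comp_map (f : C^∞⟮𝓘(ℝ, E'), N; 𝓘(ℝ, ℝ), ℝ⟯) (x : M)
    (u : TangentSpace 𝓘(ℝ, E) x) :
    differential 𝓘(ℝ, E) (fun y => f (k.map y)) x u =
      differential 𝓘(ℝ, E') f (k.map x) (k.deriv x u) :=
  DFunLike.congr_fun (differential_comp (f.mdiffAt _) (k.map.mdiffAt x)) u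

theorem differential_mem_conormal {f : C^∞⟮𝓘(ℝ, E'), N; 𝓘(ℝ, ℝ), ℝ⟯} (hf : f ∈ k.vanishing)
    (x : M) : differential 𝓘(ℝ, E') f (k.map x) ∈ k.Conormal x := fun u => by
  rw [← k.differential_comp_map, show (fun y => f (k.map y)) = fun _ => (0 : ℝ) from funext hf,
    differential_const]
  rfl

/-- The differentials of vanishing functions are conormal covectors. -/
def dConormal (x : M) : k.vanishing →ₗ[ℝ] k.Conormal x :=
  LinearMap.codRestrict (k.Conormal x)
    (differentialAt 𝓘(ℝ, E') (k.map x) ∘ₗ k.vanishing.subtype)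
    (fun f => k.differential_mem_conormal f.2 x)

theorem dConormal_surjective [FiniteDimensional ℝ E] [FiniteDimensional ℝ E']
    [IsManifold 𝓘(ℝ, E) ∞ M] [IsManifold 𝓘(ℝ, E') ∞ N] [T2Space N]
    (hk : Topology.IsEmbedding k.map) (x : M) : Function.Surjective (k.dConormal x) := fun l => by
  obtain ⟨G, h0, hG⟩ := k.exists_vanishing_function hk x l
  exact ⟨⟨G, h0⟩, Subtype.ext hG⟩

/-- Local frames of differentials on an immersed manifold consist of restrictions. -/
theorem exists_differential_frame_comp [FiniteDimensional ℝ E] [FiniteDimensional ℝ E']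
    [IsManifold 𝓘(ℝ, E') ∞ N] [T2Space N] (x : M) :
    ∃ F : (E →L[ℝ] ℝ) →ₗ[ℝ] C^∞⟮𝓘(ℝ, E'), N; 𝓘(ℝ, ℝ), ℝ⟯,
      ∀ a, differential 𝓘(ℝ, E) (fun y => F a (k.map y)) x = a := by
  obtain ⟨R, hR⟩ := (k.deriv x).toLinearMap.exists_leftInverse_of_injective
    (LinearMap.ker_eq_bot.2 (k.injective_mfderiv x))
  obtain ⟨F, hF⟩ := exists_linear_differential_eq (E := E') (k.map x)
  let R' : TangentSpace 𝓘(ℝ, E') (k.map x) →L[ℝ] TangentSpace 𝓘(ℝ, E) x :=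
    LinearMap.toContinuousLinearMap R
  let P : (E →L[ℝ] ℝ) →ₗ[ℝ] (TangentSpace 𝓘(ℝ, E') (k.map x) →L[ℝ] ℝ) :=
    { toFun := fun a => ContinuousLinearMap.comp (M₂ := TangentSpace 𝓘(ℝ, E) x) a R'
      map_add' := fun _ _ => rfl
      map_smul' := fun _ _ => rfl }
  refine ⟨F ∘ₗ P, fun a => ?_⟩
  ext u
  refine (k.differential_comp_map (F (P a)) x u).trans ?_
  rw [hF]
  exact congrArg a (LinearMap.congr_fun hR u)

end SmoothImmersion

/-! ### Brackets of functions vanishing on `X`, horizontal functions, isotropy brackets. -/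

section Setting

universe uS
variable {EZ Z ES : Type*} {S : Type uS} {EX X : Type*}
  [NormedAddCommGroup EZ] [NormedSpace ℝ EZ] [FiniteDimensional ℝ EZ]
  [TopologicalSpace Z] [ChartedSpace EZ Z] [IsManifold 𝓘(ℝ, EZ) ∞ Z] [T2Space Z]
  [NormedAddCommGroup ES] [NormedSpace ℝ ES] [FiniteDimensional ℝ ES]
  [TopologicalSpace S] [ChartedSpace ES S] [IsManifold 𝓘(ℝ, ES) ∞ S]
  [NormedAddCommGroup EX] [NormedSpace ℝ EX] [FiniteDimensional ℝ EX]
  [TopologicalSpace X] [ChartedSpace EX X] [IsManifold 𝓘(ℝ, EX) ∞ X]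

namespace LagrangianInLeaf

variable (D : LagrangianInLeaf EZ Z ES S EX X)

/-- The differential along `X` of a function that vanishes on `X`. -/
abbrev dE (x : X) : D.incl.vanishing →ₗ[ℝ] D.EFiber x := D.incl.dConormal x

theorem leaf_vanishing_le : D.leaf.vanishing ≤ D.incl.vanishing := fun _ hf x => hf (D.lag.map x)

theorem dL_surjective (x : X) : Function.Surjective (D.leaf.dConormal (D.lag.map x)) :=
  D.leaf.dConormal_surjective D.leaf_isEmbedding _

/-- Inclusion of the functions that vanish on the leaf. -/
def leafToIncl : D.leaf.vanishing →ₗ[ℝ] D.incl.vanishing := Submodule.inclusion D.leaf_vanishing_le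

theorem dE_leafToIncl_mem (x : X) (G : D.leaf.vanishing) :
    (D.dE x (D.leafToIncl G)).1 ∈ D.LFiber x :=
  D.leaf.differential_mem_conormal G.2 (D.lag.map x)

theorem anchor_leafToIncl (x : X) (G : D.leaf.vanishing) :
    D.anchor x (D.dE x (D.leafToIncl G)) = 0 :=
  (D.anchor_eq_zero_iff x _).2 (D.dE_leafToIncl_mem x G)

/-- `w♯ dG` is tangent to `X` because `X` is Lagrangian in the leaf, and `dF` vanishes on `TX`. -/
theorem bracketMap_mem_vanishing {F G : C^∞⟮𝓘(ℝ, EZ), Z; 𝓘(ℝ, ℝ), ℝ⟯}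
    (hF : F ∈ D.incl.vanishing) (hG : G ∈ D.incl.vanishing) :
    D.w.bracketMap F G ∈ D.incl.vanishing := fun x => by
  have h := D.sharp_eq_neg_anchor x (D.dE x ⟨G, hG⟩)
  refine (congrArg (differential 𝓘(ℝ, EZ) F (D.incl.map x)) h).trans ?_
  rw [map_neg, D.incl.differential_mem_conormal hF, neg_zero]

/-- All Hamiltonian fields are tangent to the leaf, so the second function is arbitrary. -/
theorem bracketMap_mem_vanishing_leaf {F : C^∞⟮𝓘(ℝ, EZ), Z; 𝓘(ℝ, ℝ), ℝ⟯}
    (hF : F ∈ D.leaf.vanishing) (G : C^∞⟮𝓘(ℝ, EZ), Z; 𝓘(ℝ, ℝ), ℝ⟯) :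
    D.w.bracketMap F G ∈ D.leaf.vanishing := fun s => by
  have h := D.isLeaf.toIsIntegralManifold.deriv_sharpToLeaf s
    (differential 𝓘(ℝ, EZ) G (D.leaf.map s))
  refine (congrArg (differential 𝓘(ℝ, EZ) F (D.leaf.map s)) h).symm.trans ?_
  exact D.leaf.differential_mem_conormal hF s _

/-- The bracket of functions that vanish on `X`. -/
def bracketE : D.incl.vanishing →ₗ[ℝ] D.incl.vanishing →ₗ[ℝ] D.incl.vanishing :=
  LinearMap.mk₂ ℝ (fun F G => ⟨D.w.bracketMap F.1 G.1, D.bracketMap_mem_vanishing F.2 G.2⟩)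
    (fun F F' G => Subtype.ext (LinearMap.map_add₂ D.w.bracketₗ F.1 F'.1 G.1))
    (fun c F G => Subtype.ext (LinearMap.map_smul₂ D.w.bracketₗ c F.1 G.1))
    (fun F G G' => Subtype.ext (map_add (D.w.bracketₗ F.1) G.1 G'.1))
    (fun c F G => Subtype.ext (map_smul (D.w.bracketₗ F.1) c G.1))

theorem dE_bracketE_self (x : X) (F : D.incl.vanishing) : D.dE x (D.bracketE F F) = 0 :=
  Subtype.ext (D.w.differential_bracketMap_self F.1 _)

theorem differential_incl_anchor (f : C^∞⟮𝓘(ℝ, EZ), Z; 𝓘(ℝ, ℝ), ℝ⟯) (x : X) (G : D.incl.vanishing) :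
    differential 𝓘(ℝ, EX) (fun y => f (D.incl.map y)) x (D.anchor x (D.dE x G)) =
      - D.w.bracketMap f G.1 (D.incl.map x) := by
  rw [D.incl.differential_comp_map, D.incl_deriv_anchor, map_neg]
  rfl

/-- The vector field on `X` of a function that vanishes on `X`. -/
def field (G : D.incl.vanishing) : VField 𝓘(ℝ, EX) X where
  toFun x := D.anchor x (D.dE x G)
  contMDiff_toFun x := by
    obtain ⟨F, hF⟩ := D.incl.exists_differential_frame_comp x
    let F' : (EX →L[ℝ] ℝ) →ₗ[ℝ] C^∞⟮𝓘(ℝ, EX), X; 𝓘(ℝ, ℝ), ℝ⟯ :=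
      { toFun := fun a => (F a).comp D.incl.map
        map_add' := fun a b => by rw [map_add]; rfl
        map_smul' := fun a b => by rw [map_smul]; rfl }
    refine contMDiffAt_section_of_differential (F := F') ?_ fun a => ?_
    · have : (fun a => differential 𝓘(ℝ, EX) (F' a) x) = id := funext hF
      rw [this]; exact Function.bijective_id
    -- The restrictions of functions of `Z` form a frame on `X`, and the field differentiates them
    -- to restrictions of brackets, which are smooth.
    · have : (fun y => differential 𝓘(ℝ, EX) (F' a) y (D.anchor y (D.dE y G))) =
          fun y => - D.w.bracketMap (F a) G.1 (D.incl.map y) :=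
        funext fun y => D.differential_incl_anchor (F a) y G
      rw [this]
      exact ((((D.w.bracketMap (F a) G.1).comp D.incl.map).contMDiff).neg).contMDiffAt

/-- The field of `G` sends `f|_X` to `-{f,G}|_X`, so on restrictions the claim is the Jacobi
identity for `f`, `F`, `G`. The sign in the anchor makes the map a homomorphism and not an
antihomomorphism. -/
theorem mlieBracket_field (F G : D.incl.vanishing) (x : X) :
    VectorField.mlieBracket 𝓘(ℝ, EX) (fun y => D.field F y) (fun y => D.field G y) x =
      D.anchor x (D.dE x (D.bracketE F G)) := by
  obtain ⟨Φ, hΦ⟩ := D.incl.exists_differential_frame_comp x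
  refine tangent_ext fun c => ?_
  rw [← hΦ c]
  set f := Φ c
  have h1 := differential_mlieBracket (f := fun y => f (D.incl.map y)) (p := x)
    ((f.comp D.incl.map).contMDiff)
    ((D.field F).contMDiff x) ((D.field G).contMDiff x)
  have e : ∀ G : D.incl.vanishing,
      (fun y => differential 𝓘(ℝ, EX) (fun y => f (D.incl.map y)) y (D.field G y)) =
      fun y => - D.w.bracketMap f G.1 (D.incl.map y) := fun G => funext fun y =>
    D.differential_incl_anchor f y G
  have e' : ∀ F G : D.incl.vanishing,
      differential 𝓘(ℝ, EX) (fun y => - D.w.bracketMap f G.1 (D.incl.map y)) x (D.field F x) =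
        D.w.bracketMap (D.w.bracketMap f G.1) F.1 (D.incl.map x) := fun F G => by
    rw [differential_neg]
    refine (congrArg Neg.neg (D.differential_incl_anchor (D.w.bracketMap f G.1) x F)).trans ?_
    exact neg_neg _
  rw [e, e, e', e'] at h1
  refine h1.trans (Eq.trans ?_ (D.differential_incl_anchor f x (D.bracketE F G)).symm)
  have hJ := D.poisson.jacobi f F.1 G.1 (D.incl.map x)
  have s1 := D.w.bracket_skew (D.w.bracketMap f G.1) F.1 (D.incl.map x)
  have s2 := D.w.bracket_skew (D.w.bracketMap f F.1) G.1 (D.incl.map x)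
  have s3 : D.w.bracket F.1 (D.w.bracket G.1 f) (D.incl.map x) =
      - D.w.bracket F.1 (D.w.bracket f G.1) (D.incl.map x) := by
    have h := D.w.differential_bracketMap_skew G.1 f (D.incl.map x)
    exact (congrArg (fun l => differential 𝓘(ℝ, EZ) F.1 (D.incl.map x)
      (D.w.sharp (D.incl.map x) l)) h).trans (by rw [map_neg, map_neg]; rfl)
  have t1 : D.w.bracketMap (D.w.bracketMap f G.1) F.1 (D.incl.map x) =
    D.w.bracket (D.w.bracket f G.1) F.1 (D.incl.map x) := rfl
  have t2 : D.w.bracketMap (D.w.bracketMap f F.1) G.1 (D.incl.map x) =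
    D.w.bracket (D.w.bracket f F.1) G.1 (D.incl.map x) := rfl
  have t3 : D.w.bracketMap f (D.bracketE F G).1 (D.incl.map x) =
    D.w.bracket f (D.w.bracket F.1 G.1) (D.incl.map x) := rfl
  have s1' : D.w.bracket (D.w.bracket f G.1) F.1 (D.incl.map x) =
    - D.w.bracket F.1 (D.w.bracket f G.1) (D.incl.map x) := s1
  have s2' : D.w.bracket (D.w.bracket f F.1) G.1 (D.incl.map x) =
    - D.w.bracket G.1 (D.w.bracket f F.1) (D.incl.map x) := s2
  rw [t1, t2, t3, s1', s2']
  linarith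

namespace AdmissibleHamiltonian

variable {D} (H : D.AdmissibleHamiltonian)

/-- The functions vanishing on `X` whose differentials along `X` lie in the image of `α_H`. -/
def horizontal : Submodule ℝ D.incl.vanishing where
  carrier := {G | ∀ x, H.alpha x (D.anchor x (D.dE x G)) = D.dE x G}
  add_mem' {F G} hF hG x := by
    rw [map_add (D.dE x), map_add (D.anchor x), map_add (H.alpha x), hF, hG]
  zero_mem' x := by
    rw [map_zero (D.dE x), map_zero (D.anchor x), map_zero (H.alpha x)]
  smul_mem' c F hF x := by
    rw [map_smul (D.dE x), map_smul (D.anchor x), map_smul (H.alpha x), hF]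

theorem alpha_field (K : H.horizontal) (x : X) :
    H.alpha x (D.field K.1 x) = D.dE x K.1 := K.2 x

theorem bracketMap_hamiltonian_mem (F : C^∞⟮𝓘(ℝ, EZ), Z; 𝓘(ℝ, ℝ), ℝ⟯) :
    D.w.bracketMap H.toFun F ∈ D.incl.vanishing := fun x => by
  rw [BivectorField.bracketMap_apply, H.critical]
  rfl

/-- At a critical point of `H` only second derivatives of `H` contribute to `d{H,F}`, contracted
with `X_F`, which is tangent to the leaf. This links `t^V H` with Poisson brackets. -/
theorem dE_bracketMap_hamiltonian (F : C^∞⟮𝓘(ℝ, EZ), Z; 𝓘(ℝ, ℝ), ℝ⟯) (x : X) :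
    D.dE x ⟨_, H.bracketMap_hamiltonian_mem F⟩ =
      H.tVTangent x (D.isLeaf.toIsIntegralManifold.sharpToLeaf (D.lag.map x)
        (differential 𝓘(ℝ, EZ) F (D.incl.map x))) := by
  refine Subtype.ext (ContinuousLinearMap.ext fun v => ?_)
  refine (D.w.differential_bracketMap_of_critical F (H.critical x) v).trans ?_
  have h := D.isLeaf.toIsIntegralManifold.deriv_sharpToLeaf (D.lag.map x)
    (differential 𝓘(ℝ, EZ) F (D.incl.map x))
  exact congrArg (fun u => hessian 𝓘(ℝ, EZ) H.toFun (D.incl.map x) u v) h.symm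

/-- Take `{H,F}` with `X_F` at `x` chosen so that `t^V H` maps it to `α_H u`. At every other point
of `X` the differential is again in the image of `t^V H`, so the function is horizontal everywhere
although `F` was adjusted at `x` only. -/
theorem exists_horizontal (x : X) (u : TangentSpace 𝓘(ℝ, EX) x) :
    ∃ K : H.horizontal, D.field K.1 x = u := by
  obtain ⟨v, hv⟩ := H.exists_alpha_eq_tVTangent x u
  obtain ⟨l, rfl⟩ := D.isLeaf.toIsIntegralManifold.sharpToLeaf_surjective (D.lag.map x) v
  obtain ⟨F, rfl⟩ := exists_differential_eq (E := EZ) (D.incl.map x) l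
  refine ⟨⟨⟨_, H.bracketMap_hamiltonian_mem F⟩, fun y => ?_⟩, ?_⟩
  · rw [dE_bracketMap_hamiltonian]
    exact H.alpha_anchor_tVTangent y _
  · refine (congrArg (D.anchor x) (H.dE_bracketMap_hamiltonian F x)).trans ?_
    rw [← hv, anchor_alpha]

/-- A linear choice of horizontal functions with given vector at `x`. -/
theorem exists_linear_horizontal (x : X) :
    ∃ K : TangentSpace 𝓘(ℝ, EX) x →ₗ[ℝ] H.horizontal, ∀ u, D.field (K u).1 x = u := by
  have hs : Function.Surjective (D.anchor x ∘ₗ D.dE x ∘ₗ H.horizontal.subtype) :=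
    H.exists_horizontal x
  obtain ⟨K, hK⟩ := LinearMap.exists_rightInverse_of_surjective _ (LinearMap.range_eq_top.2 hs)
  exact ⟨K, fun u => LinearMap.congr_fun hK u⟩

end AdmissibleHamiltonian

/-- The differential of a bracket does not depend on the first function, if the second one has
isotropic differential. -/
theorem differential_bracketMap_eq_zero {f g : C^∞⟮𝓘(ℝ, EZ), Z; 𝓘(ℝ, ℝ), ℝ⟯} {x : X}
    (hf : differential 𝓘(ℝ, EZ) f (D.incl.map x) = 0)
    (hg : differential 𝓘(ℝ, EZ) g (D.incl.map x) ∈ D.LFiber x) :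
    differential 𝓘(ℝ, EZ) (D.w.bracketMap f g) (D.incl.map x) = 0 := by
  ext v
  refine (D.w.differential_bracketMap_of_critical g hf v).trans ?_
  have := (D.mem_conormal_leaf_iff (D.lag.map x) _).1 hg
  have h : D.w.sharp (D.incl.map x) (differential 𝓘(ℝ, EZ) g (D.incl.map x)) = 0 := this
  rw [h, map_zero]

/-- This makes the isotropy bracket depend only on the covectors. -/
theorem differential_bracketMap_congr {f f' g g' : C^∞⟮𝓘(ℝ, EZ), Z; 𝓘(ℝ, ℝ), ℝ⟯} {x : X}
    (hf : differential 𝓘(ℝ, EZ) f (D.incl.map x) ∈ D.LFiber x)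
    (hg : differential 𝓘(ℝ, EZ) g (D.incl.map x) ∈ D.LFiber x)
    (hff : differential 𝓘(ℝ, EZ) f (D.incl.map x) = differential 𝓘(ℝ, EZ) f' (D.incl.map x))
    (hgg : differential 𝓘(ℝ, EZ) g (D.incl.map x) = differential 𝓘(ℝ, EZ) g' (D.incl.map x)) :
    differential 𝓘(ℝ, EZ) (D.w.bracketMap f g) (D.incl.map x) =
      differential 𝓘(ℝ, EZ) (D.w.bracketMap f' g') (D.incl.map x) := by
  have hsub : ∀ f f' : C^∞⟮𝓘(ℝ, EZ), Z; 𝓘(ℝ, ℝ), ℝ⟯,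
      differential 𝓘(ℝ, EZ) f (D.incl.map x) = differential 𝓘(ℝ, EZ) f' (D.incl.map x) →
      differential 𝓘(ℝ, EZ) (f - f' : C^∞⟮𝓘(ℝ, EZ), Z; 𝓘(ℝ, ℝ), ℝ⟯) (D.incl.map x) = 0 :=
    fun f f' h => (map_sub (differentialAt 𝓘(ℝ, EZ) (D.incl.map x)) f f').trans (sub_eq_zero.2 h)
  have h1 := D.differential_bracketMap_eq_zero (hsub f f' hff) hg
  have h2 := D.differential_bracketMap_eq_zero (hsub g g' hgg) (hff ▸ hf)
  -- Change one function at a time: `{f,g} = {f-f',g} + {f',g-g'} + {f',g'}`. The first term has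
  -- zero differential because `dg` is isotropic, the second, after a swap, because `df'` is.
  have h3 : D.w.bracketMap f g =
      D.w.bracketMap (f - f') g + (D.w.bracketₗ f' (g - g') + D.w.bracketMap f' g') := by
    have e1 := LinearMap.map_sub₂ D.w.bracketₗ f f' g
    have e2 := map_sub (D.w.bracketₗ f') g g'
    simp only [BivectorField.bracketₗ_apply] at e1 e2 ⊢
    rw [e1, e2]
    abel
  have h4 := D.w.differential_bracketMap_skew f' (g - g') (D.incl.map x)
  rw [h2, neg_zero] at h4
  have h5 := map_add (differentialAt 𝓘(ℝ, EZ) (D.incl.map x)) (D.w.bracketMap (f - f') g)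
    (D.w.bracketₗ f' (g - g') + D.w.bracketMap f' g')
  have h6 := map_add (differentialAt 𝓘(ℝ, EZ) (D.incl.map x)) (D.w.bracketₗ f' (g - g'))
    (D.w.bracketMap f' g')
  simp only [differentialAt_apply, BivectorField.bracketₗ_apply] at h5 h6
  rw [h3]
  simp only [BivectorField.bracketₗ_apply]
  rw [h5, h6, h1, h4, zero_add, zero_add]

/-- Tested against `dh`, the vector `w♯ d{f,g}` gives `{h,{f,g}}`. By the Jacobi identity this is a
sum of brackets with `f` and with `g`, whose Hamiltonian vectors vanish at the point. -/
theorem differential_bracketMap_mem {f g : C^∞⟮𝓘(ℝ, EZ), Z; 𝓘(ℝ, ℝ), ℝ⟯} {x : X}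
    (hf : differential 𝓘(ℝ, EZ) f (D.incl.map x) ∈ D.LFiber x)
    (hg : differential 𝓘(ℝ, EZ) g (D.incl.map x) ∈ D.LFiber x) :
    differential 𝓘(ℝ, EZ) (D.w.bracketMap f g) (D.incl.map x) ∈ D.LFiber x := by
  refine (D.mem_conormal_leaf_iff (D.lag.map x) _).2 (tangent_ext fun c => ?_)
  obtain ⟨h, rfl⟩ := exists_differential_eq (E := EZ) (D.incl.map x) c
  have hf' : D.w.sharp (D.incl.map x) (differential 𝓘(ℝ, EZ) f (D.incl.map x)) = 0 :=
    (D.mem_conormal_leaf_iff (D.lag.map x) _).1 hf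
  have hg' : D.w.sharp (D.incl.map x) (differential 𝓘(ℝ, EZ) g (D.incl.map x)) = 0 :=
    (D.mem_conormal_leaf_iff (D.lag.map x) _).1 hg
  have key : ∀ f : C^∞⟮𝓘(ℝ, EZ), Z; 𝓘(ℝ, ℝ), ℝ⟯,
      D.w.sharp (D.incl.map x) (differential 𝓘(ℝ, EZ) f (D.incl.map x)) = 0 →
      ∀ k : Z → ℝ, D.w.bracket f k (D.incl.map x) = 0 := fun f hf k => by
    rw [D.w.bracket_skew]
    refine (congrArg (fun v => -differential 𝓘(ℝ, EZ) k (D.incl.map x) v) hf).trans ?_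
    rw [map_zero, neg_zero]
  have hJ := D.poisson.jacobi f g h (D.incl.map x)
  rw [key f hf', key g hg', zero_add, zero_add] at hJ
  exact hJ.trans (map_zero (differential 𝓘(ℝ, EZ) h (D.incl.map x))).symm

/-- The isotropy bracket, defined through a linear choice of functions with given differential. -/
def isotropyBracket (x : X) (F : (TangentSpace 𝓘(ℝ, EZ) (D.incl.map x) →L[ℝ] ℝ) →ₗ[ℝ]
    C^∞⟮𝓘(ℝ, EZ), Z; 𝓘(ℝ, ℝ), ℝ⟯) (hF : ∀ c, differential 𝓘(ℝ, EZ) (F c) (D.incl.map x) = c) :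
    D.LFiber x →ₗ[ℝ] D.LFiber x →ₗ[ℝ] D.LFiber x :=
  LinearMap.mk₂ ℝ (fun l m => ⟨differential 𝓘(ℝ, EZ) (D.w.bracketₗ (F l.1) (F m.1)) (D.incl.map x),
    D.differential_bracketMap_mem ((hF l.1).symm ▸ l.2) ((hF m.1).symm ▸ m.2)⟩)
    (by
      intro l l' m
      refine Subtype.ext ?_
      have := map_add (differentialAt 𝓘(ℝ, EZ) (D.incl.map x)) (D.w.bracketₗ (F l.1) (F m.1))
        (D.w.bracketₗ (F l'.1) (F m.1))
      refine Eq.trans ?_ this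
      rw [← LinearMap.map_add₂, ← map_add]
      rfl)
    (by
      intro c l m
      refine Subtype.ext ?_
      have := map_smul (differentialAt 𝓘(ℝ, EZ) (D.incl.map x)) c (D.w.bracketₗ (F l.1) (F m.1))
      refine Eq.trans ?_ this
      rw [← LinearMap.map_smul₂, ← map_smul]
      rfl)
    (by
      intro l m m'
      refine Subtype.ext ?_
      have := map_add (differentialAt 𝓘(ℝ, EZ) (D.incl.map x)) (D.w.bracketₗ (F l.1) (F m.1))
        (D.w.bracketₗ (F l.1) (F m'.1))
      refine Eq.trans ?_ this
      rw [← map_add (D.w.bracketₗ _), ← map_add]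
      rfl)
    (by
      intro c l m
      refine Subtype.ext ?_
      have := map_smul (differentialAt 𝓘(ℝ, EZ) (D.incl.map x)) c (D.w.bracketₗ (F l.1) (F m.1))
      refine Eq.trans ?_ this
      rw [← map_smul (D.w.bracketₗ _), ← map_smul]
      rfl)

theorem isotropyBracket_val (x : X) (F : (TangentSpace 𝓘(ℝ, EZ) (D.incl.map x) →L[ℝ] ℝ) →ₗ[ℝ]
    C^∞⟮𝓘(ℝ, EZ), Z; 𝓘(ℝ, ℝ), ℝ⟯) (hF : ∀ c, differential 𝓘(ℝ, EZ) (F c) (D.incl.map x) = c)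
    {f g : C^∞⟮𝓘(ℝ, EZ), Z; 𝓘(ℝ, ℝ), ℝ⟯}
    (hf : differential 𝓘(ℝ, EZ) f (D.incl.map x) ∈ D.LFiber x)
    (hg : differential 𝓘(ℝ, EZ) g (D.incl.map x) ∈ D.LFiber x) :
    (D.isotropyBracket x F hF ⟨_, hf⟩ ⟨_, hg⟩).1 =
      differential 𝓘(ℝ, EZ) (D.w.bracketMap f g) (D.incl.map x) :=
  (D.differential_bracketMap_congr hf hg (hF (differential 𝓘(ℝ, EZ) f (D.incl.map x))).symm
    (hF (differential 𝓘(ℝ, EZ) g (D.incl.map x))).symm).symm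

theorem existsUnique_isIsotropyBracket :
    ∃! br : ∀ x, D.LFiber x →ₗ[ℝ] D.LFiber x →ₗ[ℝ] D.LFiber x, D.IsIsotropyBracket br := by
  choose F hF using fun x : X => exists_linear_differential_eq (E := EZ) (D.incl.map x)
  refine ⟨fun x => D.isotropyBracket x (F x) (hF x), fun x f g hf hg =>
    D.isotropyBracket_val x (F x) (hF x) hf hg, ?_⟩
  intro br hbr
  funext x
  refine LinearMap.ext fun l => LinearMap.ext fun m => Subtype.ext ?_
  obtain ⟨f, hf⟩ := exists_differential_eq (E := EZ) (D.incl.map x) l.1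
  obtain ⟨g, hg⟩ := exists_differential_eq (E := EZ) (D.incl.map x) m.1
  have hl : l = ⟨_, hf ▸ l.2⟩ := Subtype.ext hf.symm
  have hm : m = ⟨_, hg ▸ m.2⟩ := Subtype.ext hg.symm
  rw [hl, hm]
  exact (hbr x f g _ _).trans (D.isotropyBracket_val x (F x) (hF x) _ _).symm

end LagrangianInLeaf

end Setting

/-! ### Covectors of a total space modulo covectors of the base. -/

section Spanning

variable {EB B : Type*} [NormedAddCommGroup EB] [NormedSpace ℝ EB] [FiniteDimensional ℝ EB]
  [TopologicalSpace B] [ChartedSpace EB B] [IsManifold 𝓘(ℝ, EB) ∞ B] [T2Space B]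
  {F : Type*} [NormedAddCommGroup F] [NormedSpace ℝ F] {V : B → Type*}
  [TopologicalSpace (TotalSpace F V)] [∀ x, AddCommMonoid (V x)] [∀ x, Module ℝ (V x)]
  [∀ x, TopologicalSpace (V x)] [FiberBundle F V] [VectorBundle ℝ F V]
  [ContMDiffVectorBundle ∞ F V 𝓘(ℝ, EB)]

/-- The composition of a smooth function on the base with the bundle projection. -/
def basePullback : C^∞⟮𝓘(ℝ, EB), B; 𝓘(ℝ, ℝ), ℝ⟯ →ₗ[ℝ]
    C^∞⟮𝓘(ℝ, EB).prod 𝓘(ℝ, F), TotalSpace F V; 𝓘(ℝ, ℝ), ℝ⟯ where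
  toFun f := f.comp ⟨TotalSpace.proj, contMDiff_proj V⟩
  map_add' _ _ := rfl
  map_smul' _ _ := rfl

theorem differential_basePullback (f : C^∞⟮𝓘(ℝ, EB), B; 𝓘(ℝ, ℝ), ℝ⟯) (t : TotalSpace F V) :
    differential (𝓘(ℝ, EB).prod 𝓘(ℝ, F)) (basePullback (F := F) (V := V) f) t =
      (differential 𝓘(ℝ, EB) f t.1).comp (mfderiv (𝓘(ℝ, EB).prod 𝓘(ℝ, F)) 𝓘(ℝ, EB)
        (TotalSpace.proj : TotalSpace F V → B) t) :=
  differential_comp (f.mdiffAt _) ((contMDiff_proj V (IB := 𝓘(ℝ, EB)) (n := ∞)).mdifferentiable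
    (by simp) t)

/-- The difference kills vertical vectors, hence comes from the base, where every covector is a
differential. -/
theorem exists_eq_differential_add {t : TotalSpace F V}
    (b c : TangentSpace (𝓘(ℝ, EB).prod 𝓘(ℝ, F)) t →L[ℝ] ℝ)
    (h : verticalPart t c = verticalPart t b) :
    ∃ f : C^∞⟮𝓘(ℝ, EB), B; 𝓘(ℝ, ℝ), ℝ⟯,
      b = differential (𝓘(ℝ, EB).prod 𝓘(ℝ, F)) (basePullback (F := F) (V := V) f) t + c := by
  have h0 : verticalPart t (b - c) = 0 := by
    ext v
    exact sub_eq_zero.2 (DFunLike.congr_fun h v).symm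
  obtain ⟨e, he⟩ := exists_eq_comp_mfderiv_proj h0
  obtain ⟨f, rfl⟩ := exists_differential_eq (E := EB) t.1 e
  refine ⟨f, ?_⟩
  rw [differential_basePullback, ← he, sub_add_cancel]

theorem mfderiv_proj_eq_of_basePullback {t : TotalSpace F V}
    {u : TangentSpace (𝓘(ℝ, EB).prod 𝓘(ℝ, F)) t} {v : TangentSpace 𝓘(ℝ, EB) t.1}
    (h : ∀ f : C^∞⟮𝓘(ℝ, EB), B; 𝓘(ℝ, ℝ), ℝ⟯,
      differential (𝓘(ℝ, EB).prod 𝓘(ℝ, F)) (basePullback (F := F) (V := V) f) t u =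
        differential 𝓘(ℝ, EB) f t.1 v) :
    mfderiv (𝓘(ℝ, EB).prod 𝓘(ℝ, F)) 𝓘(ℝ, EB) (TotalSpace.proj : TotalSpace F V → B) t u = v := by
  refine tangent_ext fun c => ?_
  obtain ⟨f, rfl⟩ := exists_differential_eq (E := EB) t.1 c
  rw [← h, differential_basePullback]
  rfl

end Spanning

/-! ### Fibrewise linear functions on the normal bundle. -/

namespace SmoothImmersion

variable {E M E' N : Type*} [NormedAddCommGroup E] [NormedSpace ℝ E] [FiniteDimensional ℝ E]
    [TopologicalSpace M] [ChartedSpace E M] [IsManifold 𝓘(ℝ, E) ∞ M]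
    [NormedAddCommGroup E'] [NormedSpace ℝ E'] [FiniteDimensional ℝ E']
    [TopologicalSpace N] [ChartedSpace E' N] [IsManifold 𝓘(ℝ, E') ∞ N]
    (k : SmoothImmersion E M E' N)

theorem proj_surjective (x : M) : Function.Surjective (k.proj x) :=
  (k.tangentImage x).mkQ_surjective

/-- The pairing with a conormal covector. -/
def pairingL (x : M) (l : k.Conormal x) : k.NormalSpace x →L[ℝ] ℝ :=
  ⟨k.pairing x l, (isQuotientMap_quotient_mk'.continuous_iff).2 l.1.continuous⟩

theorem pairingL_toConormal (x : M) (a : k.NormalSpace x →L[ℝ] ℝ) :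
    k.pairingL x (k.toConormal x a) = a := by
  ext n
  obtain ⟨v, rfl⟩ := k.proj_surjective x n
  rfl

/-- The fiberwise linear function on the normal bundle of a 1-form that is conormal along `k`. -/
def barForm (A : OneForm 𝓘(ℝ, E') N) (hA : ∀ x, A (k.map x) ∈ k.Conormal x)
    (t : TotalSpace k.NormalFiber k.NormalSpace) : ℝ :=
  k.pairing t.1 ⟨A (k.map t.1), hA t.1⟩ t.2

/-- The fiber coordinate of a normal vector in the trivialization around `x₀`. -/
def normalCoord (x₀ : M) (t : TotalSpace k.NormalFiber k.NormalSpace) : k.NormalFiber :=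
  (trivializationAt k.NormalFiber k.NormalSpace x₀ t).2

theorem contMDiffAt_normalCoord (t : TotalSpace k.NormalFiber k.NormalSpace) :
    ContMDiffAt (𝓘(ℝ, E).prod 𝓘(ℝ, k.NormalFiber)) 𝓘(ℝ, k.NormalFiber) ∞ (k.normalCoord t.1) t :=
  (contMDiffAt_totalSpace.1 (contMDiffAt_id (x := t))).2

theorem proj_symmL_splitS {x₀ : M} {t : TotalSpace k.NormalFiber k.NormalSpace}
    (h : t.1 ∈ k.normalBase x₀) :
    k.proj t.1 ((k.trN x₀).symmL ℝ (k.map t.1) (k.splitS x₀ (k.normalCoord x₀ t))) = t.2 :=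
  k.normalInv_normalMap h t.2

theorem proj_splitS (t : TotalSpace k.NormalFiber k.NormalSpace) :
    k.proj t.1 (k.splitS t.1 (k.normalCoord t.1 t) : E') = t.2 := by
  refine Eq.trans ?_ (k.proj_symmL_splitS (k.mem_normalBase t.1))
  exact congrArg (k.proj t.1) (tangent_symmL_self (I := 𝓘(ℝ, E')) (k.map t.1) _).symm

theorem eventually_mem_normalBase (t : TotalSpace k.NormalFiber k.NormalSpace) :
    ∀ᶠ s : TotalSpace k.NormalFiber k.NormalSpace in 𝓝 t, s.1 ∈ k.normalBase t.1 :=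
  (FiberBundle.continuous_proj _ _).continuousAt.preimage_mem_nhds
    ((k.isOpen_normalBase t.1).mem_nhds (k.mem_normalBase t.1))

variable {A : OneForm 𝓘(ℝ, E') N} (hA : ∀ x, A (k.map x) ∈ k.Conormal x)

/-- The map `splitS` lifts the fibre coordinate to a vector of `TN`, and the pairing does not depend
on the lift. This writes `bar A` as a pairing of smooth coordinates, ready for the product rule. -/
theorem barForm_eventuallyEq (t : TotalSpace k.NormalFiber k.NormalSpace) :
    k.barForm A hA =ᶠ[𝓝 t] fun s =>
      formCoord (k.map t.1) (fun q => A q) (k.map s.1) (k.splitS t.1 (k.normalCoord t.1 s)) := by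
  filter_upwards [k.eventually_mem_normalBase t] with s hs
  exact congrArg (k.pairing s.1 ⟨A (k.map s.1), hA s.1⟩) (k.proj_symmL_splitS hs).symm

theorem contMDiffAt_map_proj (t : TotalSpace k.NormalFiber k.NormalSpace) :
    ContMDiffAt (𝓘(ℝ, E).prod 𝓘(ℝ, k.NormalFiber)) 𝓘(ℝ, E') ∞
      (fun s : TotalSpace k.NormalFiber k.NormalSpace => k.map s.1) t :=
  (k.map.contMDiff.comp (contMDiff_proj k.NormalSpace)).contMDiffAt

theorem contMDiff_barForm :
    ContMDiff (𝓘(ℝ, E).prod 𝓘(ℝ, k.NormalFiber)) 𝓘(ℝ, ℝ) ∞ (k.barForm A hA) := fun t =>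
  have h1 : ContMDiffAt (𝓘(ℝ, E).prod 𝓘(ℝ, k.NormalFiber)) 𝓘(ℝ, E' →L[ℝ] ℝ) ∞
      (fun s : TotalSpace k.NormalFiber k.NormalSpace =>
        formCoord (k.map t.1) (fun q => A q) (k.map s.1)) t :=
    (A.contMDiffAt_formCoord (k.map t.1)).comp t (k.contMDiffAt_map_proj t)
  have h2 : ContMDiffAt (𝓘(ℝ, E).prod 𝓘(ℝ, k.NormalFiber)) 𝓘(ℝ, E') ∞
      (fun s => k.splitS t.1 (k.normalCoord t.1 s)) t :=
    (k.splitS t.1).contMDiffAt.comp t (k.contMDiffAt_normalCoord t)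
  (h1.clm_apply h2).congr_of_eventuallyEq (k.barForm_eventuallyEq hA t)

theorem verticalPart_barForm (t : TotalSpace k.NormalFiber k.NormalSpace) :
    verticalPart t (differential (𝓘(ℝ, E).prod 𝓘(ℝ, k.NormalFiber)) (k.barForm A hA) t) =
      k.pairingL t.1 ⟨A (k.map t.1), hA t.1⟩ :=
  verticalPart_differential ((k.contMDiff_barForm hA).mdifferentiable (by simp) t) _ 0
    fun _ => (add_zero _).symm

/-- Differentiate `A(dk v) = 0` along the submanifold; the derivative of `dk v` is multiplied by
`A`, which is zero at the point. -/
theorem formDeriv_apply_deriv (hA : ∀ x, A (k.map x) ∈ k.Conormal x) {x : M} (h0 : A (k.map x) = 0) (u v : TangentSpace 𝓘(ℝ, E) x) :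
    formDeriv (fun q => A q) (k.map x) (k.deriv x u) (k.deriv x v) = 0 := by
  have hA' := (A.contMDiffAt_formCoord (k.map x))
  have hc : ContMDiffAt 𝓘(ℝ, E) 𝓘(ℝ, E →L[ℝ] E') ∞ (k.coord x) x :=
    (k.contMDiffOn_coord x).contMDiffAt ((k.isOpen_coordBase x).mem_nhds (k.mem_coordBase x))
  have hv : ContMDiffAt 𝓘(ℝ, E) 𝓘(ℝ, E') ∞ (fun y => k.coord x y v) x :=
    hc.clm_apply contMDiffAt_const
  have h1 : (fun y => formCoord (k.map x) (fun q => A q) (k.map y) (k.coord x y v)) =ᶠ[𝓝 x]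
      fun _ => (0 : ℝ) := by
    filter_upwards [(k.isOpen_coordBase x).mem_nhds (k.mem_coordBase x)] with y hy
    have e := Trivialization.symmL_continuousLinearMapAt (R := ℝ) (k.trN x) hy.2
      (k.deriv y ((trM (E := E) x).symmL ℝ y v))
    exact (congrArg (A (k.map y)) e).trans (hA y _)
  have h2 := differential_clm_apply (I := 𝓘(ℝ, E)) (s := fun y => k.coord x y v)
    (c := fun y => formCoord (k.map x) (fun q => A q) (k.map y))
    ((hA'.comp x k.map.contMDiff.contMDiffAt).mdifferentiableAt (by simp))
    (hv.mdifferentiableAt (by simp)) u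
  rw [differential_congr h1, differential_const] at h2
  have h3 : formCoord (k.map x) (fun q => A q) (k.map x) = 0 := (formCoord_self _ _).trans h0
  rw [h3] at h2
  have h4 := mfderiv_comp_apply x (g := formCoord (k.map x) (fun q => A q))
    (I'' := 𝓘(ℝ, E' →L[ℝ] ℝ))
    (hA'.mdifferentiableAt (by simp)) (k.map.mdiffAt x) u
  have h5 : k.coord x x v = k.deriv x v :=
    (tangent_continuousLinearMapAt_self (I := 𝓘(ℝ, E')) (k.map x) _).trans
      (congrArg (k.deriv x) (tangent_symmL_self (I := 𝓘(ℝ, E)) x v))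
  have h6 : valueDeriv 𝓘(ℝ, E) (fun y => formCoord (k.map x) (fun q => A q) (k.map y)) x u =
    formDeriv (fun q => A q) (k.map x) (k.deriv x u) := h4
  rw [h6, h5] at h2
  exact (h2.trans (zero_add (M := ℝ) _)).symm

/-- The differential of the function of a 1-form that vanishes at a point. -/
theorem differential_barForm_of_eq_zero {t : TotalSpace k.NormalFiber k.NormalSpace}
    (h0 : A (k.map t.1) = 0) {v : TangentSpace 𝓘(ℝ, E') (k.map t.1)} (hv : k.proj t.1 v = t.2)
    (Y : TangentSpace (𝓘(ℝ, E).prod 𝓘(ℝ, k.NormalFiber)) t) :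
    differential (𝓘(ℝ, E).prod 𝓘(ℝ, k.NormalFiber)) (k.barForm A hA) t Y =
      formDeriv (fun q => A q) (k.map t.1) (k.deriv t.1
        (mfderiv (𝓘(ℝ, E).prod 𝓘(ℝ, k.NormalFiber)) 𝓘(ℝ, E)
          (TotalSpace.proj : TotalSpace k.NormalFiber k.NormalSpace → M) t Y)) v := by
  have hA' := (A.contMDiffAt_formCoord (k.map t.1))
  have hS : ContMDiffAt (𝓘(ℝ, E).prod 𝓘(ℝ, k.NormalFiber)) 𝓘(ℝ, E') ∞
    (fun s => k.splitS t.1 (k.normalCoord t.1 s)) t :=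
    (k.splitS t.1).contMDiffAt.comp t (k.contMDiffAt_normalCoord t)
  have h2 := differential_clm_apply (I := 𝓘(ℝ, E).prod 𝓘(ℝ, k.NormalFiber))
    (s := fun s => k.splitS t.1 (k.normalCoord t.1 s))
    (c := fun s : TotalSpace k.NormalFiber k.NormalSpace =>
      formCoord (k.map t.1) (fun q => A q) (k.map s.1))
    ((hA'.comp t (k.contMDiffAt_map_proj t)).mdifferentiableAt (by simp))
    (hS.mdifferentiableAt (by simp)) Y
  have h3 : formCoord (k.map t.1) (fun q => A q) (k.map t.1) = 0 := (formCoord_self _ _).trans h0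
  rw [h3] at h2
  have hp : MDifferentiableAt (𝓘(ℝ, E).prod 𝓘(ℝ, k.NormalFiber)) 𝓘(ℝ, E)
      (TotalSpace.proj : TotalSpace k.NormalFiber k.NormalSpace → M) t :=
    (contMDiff_proj _ (IB := 𝓘(ℝ, E)) (n := ∞)).mdifferentiable (by simp) t
  have h4 := mfderiv_comp_apply t (g := formCoord (k.map t.1) (fun q => A q))
    (f := fun s : TotalSpace k.NormalFiber k.NormalSpace => k.map s.1)
    (I'' := 𝓘(ℝ, E' →L[ℝ] ℝ)) (hA'.mdifferentiableAt (by simp))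
    ((k.contMDiffAt_map_proj t).mdifferentiableAt (by simp)) Y
  have h5 := mfderiv_comp_apply t (g := k.map)
    (f := (TotalSpace.proj : TotalSpace k.NormalFiber k.NormalSpace → M)) (k.map.mdiffAt t.1) hp Y
  have h6 : valueDeriv (𝓘(ℝ, E).prod 𝓘(ℝ, k.NormalFiber))
      (fun s : TotalSpace k.NormalFiber k.NormalSpace =>
        formCoord (k.map t.1) (fun q => A q) (k.map s.1)) t Y =
      formDeriv (fun q => A q) (k.map t.1) (k.deriv t.1
        (mfderiv (𝓘(ℝ, E).prod 𝓘(ℝ, k.NormalFiber)) 𝓘(ℝ, E)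
          (TotalSpace.proj : TotalSpace k.NormalFiber k.NormalSpace → M) t Y)) :=
    h4.trans (congrArg (formDeriv (fun q => A q) (k.map t.1)) h5)
  rw [h6] at h2
  have h7 : differential (𝓘(ℝ, E).prod 𝓘(ℝ, k.NormalFiber)) (k.barForm A hA) t Y = _ :=
    (DFunLike.congr_fun (differential_congr (k.barForm_eventuallyEq hA t)) Y).trans h2
  refine h7.trans ((zero_add _).trans ?_)
  -- The product rule gave the formula for the particular lift `v'` of `t`. Another lift `v` differs
  -- from it by a vector tangent to the submanifold, to which the derivative of `A` does not react.
  let v' : TangentSpace 𝓘(ℝ, E') (k.map t.1) := (k.splitS t.1 (k.normalCoord t.1 t) : E')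
  obtain ⟨e, he⟩ : ∃ e, k.deriv t.1 e = v' - v := by
    have h : k.proj t.1 (v' - v) = 0 :=
      (map_sub (k.proj t.1) _ _).trans (sub_eq_zero.2 ((k.proj_splitS t).trans hv.symm))
    exact (Submodule.Quotient.mk_eq_zero (k.tangentImage t.1)).1 h
  have h8 := k.formDeriv_apply_deriv hA h0 (mfderiv (𝓘(ℝ, E).prod 𝓘(ℝ, k.NormalFiber)) 𝓘(ℝ, E)
    (TotalSpace.proj : TotalSpace k.NormalFiber k.NormalSpace → M) t Y) e
  rw [he, map_sub] at h8
  exact sub_eq_zero.1 h8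

/-- The fiberwise linear function on the normal bundle of a function vanishing on `k`. -/
def barMap : k.vanishing →ₗ[ℝ]
    C^∞⟮𝓘(ℝ, E).prod 𝓘(ℝ, k.NormalFiber), TotalSpace k.NormalFiber k.NormalSpace; 𝓘(ℝ, ℝ), ℝ⟯ where
  toFun G := ⟨k.barForm (exactForm G.1) (fun x => k.differential_mem_conormal G.2 x),
    k.contMDiff_barForm _⟩
  map_add' G G' := ContMDiffMap.ext fun t =>
    (congrArg (fun l => k.pairing t.1 l t.2) (map_add (k.dConormal t.1) G G')).trans
      (LinearMap.map_add₂ (k.pairing t.1) _ _ _)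
  map_smul' c G := ContMDiffMap.ext fun t =>
    (congrArg (fun l => k.pairing t.1 l t.2) (map_smul (k.dConormal t.1) c G)).trans
      (LinearMap.map_smul₂ (k.pairing t.1) _ _ _)

theorem verticalPart_barMap (G : k.vanishing) (t : TotalSpace k.NormalFiber k.NormalSpace) :
    verticalPart t (differential (𝓘(ℝ, E).prod 𝓘(ℝ, k.NormalFiber)) (k.barMap G) t) =
      k.pairingL t.1 (k.dConormal t.1 G) :=
  k.verticalPart_barForm (A := exactForm G.1) (fun x => k.differential_mem_conormal G.2 x) t

variable [T2Space M] [T2Space N]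

/-- Covectors of the normal bundle are spanned by differentials of functions on the base and
of fiberwise linear functions. -/
theorem exists_differential_eq_add_barMap (hk : Topology.IsEmbedding k.map)
    (t : TotalSpace k.NormalFiber k.NormalSpace)
    (b : TangentSpace (𝓘(ℝ, E).prod 𝓘(ℝ, k.NormalFiber)) t →L[ℝ] ℝ) :
    ∃ (f : C^∞⟮𝓘(ℝ, E), M; 𝓘(ℝ, ℝ), ℝ⟯) (G : k.vanishing),
      b = differential (𝓘(ℝ, E).prod 𝓘(ℝ, k.NormalFiber)) (basePullback (F := k.NormalFiber)
        (V := k.NormalSpace) f) t +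
        differential (𝓘(ℝ, E).prod 𝓘(ℝ, k.NormalFiber)) (k.barMap G) t := by
  obtain ⟨G, hG⟩ := k.dConormal_surjective hk t.1 (k.toConormal t.1 (verticalPart t b))
  obtain ⟨f, hf⟩ := exists_eq_differential_add b
    (differential (𝓘(ℝ, E).prod 𝓘(ℝ, k.NormalFiber)) (k.barMap G) t)
    (by rw [verticalPart_barMap, hG, pairingL_toConormal])
  exact ⟨f, G, hf⟩

end SmoothImmersion

/-! ### Tangent vectors as functionals on covectors. -/

section DualVector

variable {E H M : Type*} [NormedAddCommGroup E] [NormedSpace ℝ E] [FiniteDimensional ℝ E]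
  [TopologicalSpace H] {I : ModelWithCorners ℝ E H} [TopologicalSpace M] [ChartedSpace H M]

/-- The tangent vector given by a linear functional on covectors. -/
def tangentOfDual (p : M) : ((TangentSpace I p →L[ℝ] ℝ) →ₗ[ℝ] ℝ) →ₗ[ℝ] TangentSpace I p :=
  (Module.evalEquiv ℝ (TangentSpace I p)).symm.toLinearMap ∘ₗ
    (LinearMap.lcomp ℝ ℝ (LinearMap.toContinuousLinearMap (𝕜 := ℝ) (E := TangentSpace I p)
      (F' := ℝ)).toLinearMap)

theorem apply_tangentOfDual (p : M) (φ : (TangentSpace I p →L[ℝ] ℝ) →ₗ[ℝ] ℝ)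
    (c : TangentSpace I p →L[ℝ] ℝ) : c (tangentOfDual p φ) = φ c := by
  have h := Module.apply_evalEquiv_symm_apply (R := ℝ) (M := TangentSpace I p) c.toLinearMap
    (φ ∘ₗ (LinearMap.toContinuousLinearMap (𝕜 := ℝ) (E := TangentSpace I p)
      (F' := ℝ)).toLinearMap)
  refine h.trans (congrArg φ ?_)
  ext v
  rfl

theorem BivectorField.ext_of_apply {w₁ w₂ : BivectorField I M}
    (h : ∀ (p : M) (α β : TangentSpace I p →L[ℝ] ℝ), α (w₁.sharp p β) = α (w₂.sharp p β)) :
    w₁ = w₂ := by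
  obtain ⟨s₁, _, _⟩ := w₁
  obtain ⟨s₂, _, _⟩ := w₂
  have : s₁ = s₂ := funext fun p => LinearMap.ext fun β => tangent_ext fun α => h p α β
  subst this
  rfl

end DualVector

/-! ### Conormal forms and the covectors they induce on the normal bundle. -/

namespace SmoothImmersion

variable {E M E' N : Type*} [NormedAddCommGroup E] [NormedSpace ℝ E] [FiniteDimensional ℝ E]
    [TopologicalSpace M] [ChartedSpace E M] [IsManifold 𝓘(ℝ, E) ∞ M]
    [NormedAddCommGroup E'] [NormedSpace ℝ E'] [FiniteDimensional ℝ E']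
    [TopologicalSpace N] [ChartedSpace E' N] [IsManifold 𝓘(ℝ, E') ∞ N]
    (k : SmoothImmersion E M E' N)

/-- The 1-forms that are conormal along `k`. -/
def conormalForms : Submodule ℝ (OneForm 𝓘(ℝ, E') N) where
  carrier := {A | ∀ x, A (k.map x) ∈ k.Conormal x}
  add_mem' hA hB x := (k.Conormal x).add_mem (hA x) (hB x)
  zero_mem' x := (k.Conormal x).zero_mem
  smul_mem' c _ hA x := (k.Conormal x).smul_mem c (hA x)

/-- The value of a conormal form. -/
def conormalAt (x : M) : k.conormalForms →ₗ[ℝ] k.Conormal x where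
  toFun A := ⟨A.1 (k.map x), A.2 x⟩
  map_add' _ _ := rfl
  map_smul' _ _ := rfl

/-- The fiberwise linear function of a conormal form. -/
def barFormₗ : k.conormalForms →ₗ[ℝ]
    C^∞⟮𝓘(ℝ, E).prod 𝓘(ℝ, k.NormalFiber), TotalSpace k.NormalFiber k.NormalSpace; 𝓘(ℝ, ℝ), ℝ⟯ where
  toFun A := ⟨k.barForm A.1 A.2, k.contMDiff_barForm _⟩
  map_add' A B := ContMDiffMap.ext fun t =>
    (congrArg (fun l => k.pairing t.1 l t.2) (map_add (k.conormalAt t.1) A B)).trans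
      (LinearMap.map_add₂ (k.pairing t.1) _ _ _)
  map_smul' c A := ContMDiffMap.ext fun t =>
    (congrArg (fun l => k.pairing t.1 l t.2) (map_smul (k.conormalAt t.1) c A)).trans
      (LinearMap.map_smul₂ (k.pairing t.1) _ _ _)

/-- The differential of a function vanishing along `k`, as a conormal form. -/
def exactConormal (G : k.vanishing) : k.conormalForms :=
  ⟨exactForm G.1, fun x => k.differential_mem_conormal G.2 x⟩

variable [T2Space M]

/-- The differential of `f ∘ π + bar A`. -/
def covector (t : TotalSpace k.NormalFiber k.NormalSpace) :
    (C^∞⟮𝓘(ℝ, E), M; 𝓘(ℝ, ℝ), ℝ⟯ × k.conormalForms) →ₗ[ℝ]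
      TangentSpace (𝓘(ℝ, E).prod 𝓘(ℝ, k.NormalFiber)) t →L[ℝ] ℝ :=
  differentialAt (𝓘(ℝ, E).prod 𝓘(ℝ, k.NormalFiber)) t ∘ₗ
    (basePullback (F := k.NormalFiber) (V := k.NormalSpace)).coprod k.barFormₗ

theorem covector_apply (t : TotalSpace k.NormalFiber k.NormalSpace)
    (f : C^∞⟮𝓘(ℝ, E), M; 𝓘(ℝ, ℝ), ℝ⟯) (A : k.conormalForms) :
    k.covector t (f, A) = differential (𝓘(ℝ, E).prod 𝓘(ℝ, k.NormalFiber))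
      (basePullback (F := k.NormalFiber) (V := k.NormalSpace) f) t +
      differential (𝓘(ℝ, E).prod 𝓘(ℝ, k.NormalFiber)) (k.barFormₗ A) t := by
  change differentialAt _ t (_ + _) = _
  rw [map_add]
  rfl

/-- The vertical part of the differential is the value of `A`, so it vanishes; then `d(bar A)` is
the derivative of `A` paired with a lift of `t`, and the horizontal part gives the second relation.
These are the relations that a bracket defined on symbols must respect. -/
theorem covector_eq_zero {t : TotalSpace k.NormalFiber k.NormalSpace}
    {f : C^∞⟮𝓘(ℝ, E), M; 𝓘(ℝ, ℝ), ℝ⟯} {A : k.conormalForms} (h : k.covector t (f, A) = 0) :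
    A.1 (k.map t.1) = 0 ∧ ∀ (v : TangentSpace 𝓘(ℝ, E') (k.map t.1)), k.proj t.1 v = t.2 →
      ∀ u, differential 𝓘(ℝ, E) f t.1 u +
        formDeriv (fun q => A.1 q) (k.map t.1) (k.deriv t.1 u) v = 0 := by
  rw [covector_apply] at h
  have h0 : A.1 (k.map t.1) = 0 := by
    have h1 : verticalPart t (differential (𝓘(ℝ, E).prod 𝓘(ℝ, k.NormalFiber))
        (basePullback (F := k.NormalFiber) (V := k.NormalSpace) f) t) +
        verticalPart t (differential (𝓘(ℝ, E).prod 𝓘(ℝ, k.NormalFiber)) (k.barFormₗ A) t) = 0 :=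
      congrArg (verticalPart t) h
    rw [differential_basePullback, verticalPart_comp_proj, zero_add] at h1
    have h2 := (k.verticalPart_barForm A.2 t).symm.trans h1
    exact congrArg (fun a => (k.toConormal t.1 a).1) h2
  refine ⟨h0, fun v hv u => ?_⟩
  obtain ⟨Y, rfl⟩ := mfderiv_proj_surjective (IB := 𝓘(ℝ, E)) t u
  have h3 := k.differential_barForm_of_eq_zero A.2 h0 hv Y
  have h4 := DFunLike.congr_fun h Y
  rw [differential_basePullback] at h4
  exact (congrArg (_ + ·) h3).symm.trans h4

end SmoothImmersion

/-! ### The Sternberg–Weinstein bracket on symbols. -/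

section Setting

universe uS
variable {EZ Z ES : Type*} {S : Type uS} {EX X : Type*}
  [NormedAddCommGroup EZ] [NormedSpace ℝ EZ] [FiniteDimensional ℝ EZ]
  [TopologicalSpace Z] [ChartedSpace EZ Z] [IsManifold 𝓘(ℝ, EZ) ∞ Z] [T2Space Z]
  [NormedAddCommGroup ES] [NormedSpace ℝ ES] [FiniteDimensional ℝ ES]
  [TopologicalSpace S] [ChartedSpace ES S] [IsManifold 𝓘(ℝ, ES) ∞ S]
  [NormedAddCommGroup EX] [NormedSpace ℝ EX] [FiniteDimensional ℝ EX]
  [TopologicalSpace X] [ChartedSpace EX X] [IsManifold 𝓘(ℝ, EX) ∞ X] [T2Space X]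

namespace LagrangianInLeaf

variable (D : LagrangianInLeaf EZ Z ES S EX X)

/-- The bracket of the functions `f ∘ τ + bar A` and `g ∘ τ + bar B` at the class of `v`. -/
def symbolBracket (x : X) (v : TangentSpace 𝓘(ℝ, EZ) (D.incl.map x))
    (f : C^∞⟮𝓘(ℝ, EX), X; 𝓘(ℝ, ℝ), ℝ⟯) (A : D.incl.conormalForms)
    (g : C^∞⟮𝓘(ℝ, EX), X; 𝓘(ℝ, ℝ), ℝ⟯) (B : D.incl.conormalForms) : ℝ :=
  differential 𝓘(ℝ, EX) g x (D.anchor x (D.incl.conormalAt x A)) -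
    differential 𝓘(ℝ, EX) f x (D.anchor x (D.incl.conormalAt x B)) +
    D.w.formBracket A.1 B.1 (D.incl.map x) v

theorem symbolBracket_skew (x : X) (v : TangentSpace 𝓘(ℝ, EZ) (D.incl.map x))
    (f : C^∞⟮𝓘(ℝ, EX), X; 𝓘(ℝ, ℝ), ℝ⟯) (A : D.incl.conormalForms)
    (g : C^∞⟮𝓘(ℝ, EX), X; 𝓘(ℝ, ℝ), ℝ⟯) (B : D.incl.conormalForms) :
    D.symbolBracket x v f A g B = - D.symbolBracket x v g B f A := by
  have h := DFunLike.congr_fun (D.w.formBracket_skew A.1 B.1 (D.incl.map x)) v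
  unfold symbolBracket
  rw [h]
  change _ - _ + - D.w.formBracket B.1 A.1 (D.incl.map x) v = _
  ring

theorem symbolBracket_add_left (x : X) (v : TangentSpace 𝓘(ℝ, EZ) (D.incl.map x))
    (f f' : C^∞⟮𝓘(ℝ, EX), X; 𝓘(ℝ, ℝ), ℝ⟯) (A A' : D.incl.conormalForms)
    (g : C^∞⟮𝓘(ℝ, EX), X; 𝓘(ℝ, ℝ), ℝ⟯) (B : D.incl.conormalForms) :
    D.symbolBracket x v (f + f') (A + A') g B =
      D.symbolBracket x v f A g B + D.symbolBracket x v f' A' g B := by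
  have h := DFunLike.congr_fun (D.w.formBracket_add_left A.1 A'.1 B.1 (D.incl.map x)) v
  have h' : D.w.formBracket (A + A').1 B.1 (D.incl.map x) v =
    D.w.formBracket A.1 B.1 (D.incl.map x) v + D.w.formBracket A'.1 B.1 (D.incl.map x) v := h
  have h2 := DFunLike.congr_fun (map_add (differentialAt 𝓘(ℝ, EX) x) f f')
    (D.anchor x (D.incl.conormalAt x B))
  have h2' : differential 𝓘(ℝ, EX) (f + f' : C^∞⟮𝓘(ℝ, EX), X; 𝓘(ℝ, ℝ), ℝ⟯) x
      (D.anchor x (D.incl.conormalAt x B)) =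
    differential 𝓘(ℝ, EX) f x (D.anchor x (D.incl.conormalAt x B)) +
    differential 𝓘(ℝ, EX) f' x (D.anchor x (D.incl.conormalAt x B)) := h2
  unfold symbolBracket
  rw [h', h2', map_add, map_add, map_add]
  ring

/-- As `A` vanishes at the point, its anchor term drops out and `{A,B}` is `DA(w♯ B)(v)`, where `w♯
B` is minus the anchor of `B`. The two remaining terms cancel by the second relation of
`covector_eq_zero`. -/
theorem symbolBracket_of_covector_eq_zero {t : D.EStar}
    {v : TangentSpace 𝓘(ℝ, EZ) (D.incl.map t.1)} (hv : D.incl.proj t.1 v = t.2)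
    {f : C^∞⟮𝓘(ℝ, EX), X; 𝓘(ℝ, ℝ), ℝ⟯} {A : D.incl.conormalForms}
    (h : D.incl.covector t (f, A) = 0)
    (g : C^∞⟮𝓘(ℝ, EX), X; 𝓘(ℝ, ℝ), ℝ⟯) (B : D.incl.conormalForms) :
    D.symbolBracket t.1 v f A g B = 0 := by
  obtain ⟨h0, h1⟩ := D.incl.covector_eq_zero h
  have h2 := h1 v hv (D.anchor t.1 (D.incl.conormalAt t.1 B))
  have h3 : D.incl.conormalAt t.1 A = 0 := Subtype.ext h0
  have h4 := D.w.formBracket_of_eq_zero (B := B.1) h0 v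
  have h5 := D.sharp_eq_neg_anchor t.1 (D.incl.conormalAt t.1 B)
  have h5' : D.w.sharp (D.incl.map t.1) (B.1 (D.incl.map t.1)) =
    - D.incl.deriv t.1 (D.anchor t.1 (D.incl.conormalAt t.1 B)) := h5
  rw [h5', map_neg] at h4
  unfold symbolBracket
  rw [h4, h3, map_zero, map_zero]
  change 0 - _ + - (formDeriv _ _ _ v) = 0
  linarith

/-- Additivity handles one slot and skewness moves the argument to the other: the bracket at a point
sees only differentials. -/
theorem symbolBracket_congr {t : D.EStar} {v : TangentSpace 𝓘(ℝ, EZ) (D.incl.map t.1)}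
    (hv : D.incl.proj t.1 v = t.2)
    {f f' g g' : C^∞⟮𝓘(ℝ, EX), X; 𝓘(ℝ, ℝ), ℝ⟯} {A A' B B' : D.incl.conormalForms}
    (h : D.incl.covector t (f, A) = D.incl.covector t (f', A'))
    (h' : D.incl.covector t (g, B) = D.incl.covector t (g', B')) :
    D.symbolBracket t.1 v f A g B = D.symbolBracket t.1 v f' A' g' B' := by
  have key : ∀ {f f' : C^∞⟮𝓘(ℝ, EX), X; 𝓘(ℝ, ℝ), ℝ⟯} {A A' : D.incl.conormalForms},
      D.incl.covector t (f, A) = D.incl.covector t (f', A') →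
      ∀ (g : C^∞⟮𝓘(ℝ, EX), X; 𝓘(ℝ, ℝ), ℝ⟯) (B : D.incl.conormalForms),
      D.symbolBracket t.1 v f A g B = D.symbolBracket t.1 v f' A' g B := by
    intro f f' A A' h g B
    have h0 : D.incl.covector t (f - f', A - A') = 0 := by
      have := map_sub (D.incl.covector t) (f, A) (f', A')
      rw [h, sub_self] at this
      exact this
    have h1 := D.symbolBracket_add_left t.1 v f' (f - f') A' (A - A') g B
    rw [D.symbolBracket_of_covector_eq_zero hv h0, add_zero] at h1
    rw [← h1, add_sub_cancel, add_sub_cancel]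
  rw [key h, symbolBracket_skew, key h', ← symbolBracket_skew]

/-- The bracket of the functions `f ∘ τ + bar dF` and `g ∘ τ + bar dG`, for functions `F`, `G`
vanishing on `X`. -/
def exactBracket (t : D.EStar) :
    (C^∞⟮𝓘(ℝ, EX), X; 𝓘(ℝ, ℝ), ℝ⟯ × D.incl.vanishing) →ₗ[ℝ]
      (C^∞⟮𝓘(ℝ, EX), X; 𝓘(ℝ, ℝ), ℝ⟯ × D.incl.vanishing) →ₗ[ℝ] ℝ :=
  LinearMap.mk₂ ℝ (fun a b => differentialAt 𝓘(ℝ, EX) t.1 b.1 (D.anchor t.1 (D.dE t.1 a.2)) -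
      differentialAt 𝓘(ℝ, EX) t.1 a.1 (D.anchor t.1 (D.dE t.1 b.2)) +
      D.incl.pairing t.1 (D.dE t.1 (D.bracketE a.2 b.2)) t.2)
    (fun a a' b => by
      simp only [Prod.fst_add, Prod.snd_add, map_add, add_apply, LinearMap.add_apply]
      ring)
    (fun c a b => by
      simp only [Prod.smul_fst, Prod.smul_snd, map_smul, smul_apply, LinearMap.smul_apply,
        smul_eq_mul]
      ring)
    (fun a b b' => by
      simp only [Prod.fst_add, Prod.snd_add, map_add, add_apply, LinearMap.add_apply]
      ring)
    (fun c a b => by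
      simp only [Prod.smul_fst, Prod.smul_snd, map_smul, smul_apply, LinearMap.smul_apply,
        smul_eq_mul]
      ring)

theorem exactBracket_apply (t : D.EStar) (a b : C^∞⟮𝓘(ℝ, EX), X; 𝓘(ℝ, ℝ), ℝ⟯ × D.incl.vanishing) :
    D.exactBracket t a b = differential 𝓘(ℝ, EX) b.1 t.1 (D.anchor t.1 (D.dE t.1 a.2)) -
      differential 𝓘(ℝ, EX) a.1 t.1 (D.anchor t.1 (D.dE t.1 b.2)) +
      D.incl.pairing t.1 (D.dE t.1 (D.bracketE a.2 b.2)) t.2 := rfl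

theorem exactBracket_eq_symbolBracket {t : D.EStar} {v : TangentSpace 𝓘(ℝ, EZ) (D.incl.map t.1)}
    (hv : D.incl.proj t.1 v = t.2) (f : C^∞⟮𝓘(ℝ, EX), X; 𝓘(ℝ, ℝ), ℝ⟯) (F : D.incl.vanishing)
    (g : C^∞⟮𝓘(ℝ, EX), X; 𝓘(ℝ, ℝ), ℝ⟯) (G : D.incl.vanishing) :
    D.exactBracket t (f, F) (g, G) =
      D.symbolBracket t.1 v f (D.incl.exactConormal F) g (D.incl.exactConormal G) := by
  have h := DFunLike.congr_fun (D.w.formBracket_exact F.1 G.1 (D.incl.map t.1)) v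
  rw [exactBracket_apply, ← hv]
  exact congrArg (_ + ·) h.symm

theorem exactBracket_self (t : D.EStar) (a : C^∞⟮𝓘(ℝ, EX), X; 𝓘(ℝ, ℝ), ℝ⟯ × D.incl.vanishing) :
    D.exactBracket t a a = 0 := by
  rw [exactBracket_apply, sub_self, zero_add, dE_bracketE_self, map_zero]
  rfl

/-- Each term is a smooth field applied to a smooth function on `X`, or `bar d{F,G}`. These are the
entries of the Sternberg–Weinstein tensor in a frame. -/
theorem contMDiff_exactBracket (a b : C^∞⟮𝓘(ℝ, EX), X; 𝓘(ℝ, ℝ), ℝ⟯ × D.incl.vanishing) :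
    ContMDiff D.IEStar 𝓘(ℝ, ℝ) ∞ fun t => D.exactBracket t a b := by
  have key : ∀ (f : C^∞⟮𝓘(ℝ, EX), X; 𝓘(ℝ, ℝ), ℝ⟯) (G : D.incl.vanishing),
      ContMDiff D.IEStar 𝓘(ℝ, ℝ) ∞ fun t : D.EStar =>
        differential 𝓘(ℝ, EX) f t.1 (D.anchor t.1 (D.dE t.1 G)) := by
    intro f G t
    refine ContMDiffAt.comp (g := fun x => differential 𝓘(ℝ, EX) f x (D.anchor x (D.dE x G))) t ?_
      (contMDiff_proj D.EDual t)
    refine ContMDiffAt.congr_of_eventuallyEq ((contMDiffAt_formCoord_differential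
      (f.contMDiff t.1)).clm_apply (VField.contMDiffAt_vecCoord (D.field G) t.1)) ?_
    filter_upwards [chart_source_mem_nhds EX t.1] with x hx
    exact (formCoord_apply _ hx _).symm
  exact ((key b.1 a.2).sub (key a.1 b.2)).add (D.incl.barMap (D.bracketE a.2 b.2)).contMDiff

end LagrangianInLeaf

end Setting

/-! ### Existence and uniqueness of the Sternberg–Weinstein structure. -/

section Setting

universe uS
variable {EZ Z ES : Type*} {S : Type uS} {EX X : Type*}
  [NormedAddCommGroup EZ] [NormedSpace ℝ EZ] [FiniteDimensional ℝ EZ]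
  [TopologicalSpace Z] [ChartedSpace EZ Z] [IsManifold 𝓘(ℝ, EZ) ∞ Z] [T2Space Z]
  [NormedAddCommGroup ES] [NormedSpace ℝ ES] [FiniteDimensional ℝ ES]
  [TopologicalSpace S] [ChartedSpace ES S] [IsManifold 𝓘(ℝ, ES) ∞ S]
  [NormedAddCommGroup EX] [NormedSpace ℝ EX] [FiniteDimensional ℝ EX]
  [TopologicalSpace X] [ChartedSpace EX X] [IsManifold 𝓘(ℝ, EX) ∞ X] [T2Space X]

namespace LagrangianInLeaf

variable (D : LagrangianInLeaf EZ Z ES S EX X)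

/-- The function `f ∘ τ + bar dG` on `Z'`. -/
def exactSymbol : (C^∞⟮𝓘(ℝ, EX), X; 𝓘(ℝ, ℝ), ℝ⟯ × D.incl.vanishing) →ₗ[ℝ]
    C^∞⟮D.IEStar, D.EStar; 𝓘(ℝ, ℝ), ℝ⟯ :=
  (basePullback (F := D.incl.NormalFiber) (V := D.EDual)).coprod D.incl.barMap

theorem exists_linear_covector (t : D.EStar) :
    ∃ σ : (TangentSpace D.IEStar t →L[ℝ] ℝ) →ₗ[ℝ]
        C^∞⟮𝓘(ℝ, EX), X; 𝓘(ℝ, ℝ), ℝ⟯ × D.incl.vanishing,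
      ∀ β, differential D.IEStar (D.exactSymbol (σ β)) t = β := by
  have hs : Function.Surjective (differentialAt D.IEStar t ∘ₗ D.exactSymbol) := fun b => by
    obtain ⟨f, G, h⟩ := D.incl.exists_differential_eq_add_barMap D.incl_isEmbedding t b
    refine ⟨(f, G), ?_⟩
    rw [h]
    exact D.incl.covector_apply t f (D.incl.exactConormal G)
  obtain ⟨K, hK⟩ := LinearMap.exists_rightInverse_of_surjective _ (LinearMap.range_eq_top.2 hs)
  exact ⟨K, fun u => LinearMap.congr_fun hK u⟩

/-- A linear choice of functions with given differential at `t`. -/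
def symbolLift (t : D.EStar) : (TangentSpace D.IEStar t →L[ℝ] ℝ) →ₗ[ℝ]
    C^∞⟮𝓘(ℝ, EX), X; 𝓘(ℝ, ℝ), ℝ⟯ × D.incl.vanishing := (D.exists_linear_covector t).choose

theorem differential_symbolLift (t : D.EStar) (β : TangentSpace D.IEStar t →L[ℝ] ℝ) :
    differential D.IEStar (D.exactSymbol (D.symbolLift t β)) t = β :=
  (D.exists_linear_covector t).choose_spec β

/-- The Sternberg-Weinstein tensor. -/
def swSharp (t : D.EStar) : (TangentSpace D.IEStar t →L[ℝ] ℝ) →ₗ[ℝ] TangentSpace D.IEStar t :=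
  tangentOfDual t ∘ₗ ((D.exactBracket t).compl₁₂ (D.symbolLift t) (D.symbolLift t)).flip

theorem apply_swSharp (t : D.EStar) (α β : TangentSpace D.IEStar t →L[ℝ] ℝ) :
    α (D.swSharp t β) = D.exactBracket t (D.symbolLift t α) (D.symbolLift t β) :=
  apply_tangentOfDual t _ _

/-- The tensor was defined through a choice of symbols with given differentials;
`symbolBracket_congr` removes the choice and also passes from exact forms to arbitrary conormal
ones. -/
theorem covector_swSharp {t : D.EStar} {v : TangentSpace 𝓘(ℝ, EZ) (D.incl.map t.1)}
    (hv : D.incl.proj t.1 v = t.2) (f g : C^∞⟮𝓘(ℝ, EX), X; 𝓘(ℝ, ℝ), ℝ⟯)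
    (A B : D.incl.conormalForms) :
    D.incl.covector t (f, A) (D.swSharp t (D.incl.covector t (g, B))) =
      D.symbolBracket t.1 v f A g B := by
  rw [apply_swSharp]
  refine (D.exactBracket_eq_symbolBracket hv _ _ _ _).trans (D.symbolBracket_congr hv ?_ ?_)
  · exact D.differential_symbolLift t _
  · exact D.differential_symbolLift t _

theorem differential_exactSymbol_swSharp (t : D.EStar)
    (a b : C^∞⟮𝓘(ℝ, EX), X; 𝓘(ℝ, ℝ), ℝ⟯ × D.incl.vanishing) :
    differential D.IEStar (D.exactSymbol a) t (D.swSharp t (differential D.IEStar (D.exactSymbol b) t)) =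
      D.exactBracket t a b := by
  obtain ⟨v, hv⟩ := D.incl.proj_surjective t.1 t.2
  refine (D.covector_swSharp hv a.1 b.1 (D.incl.exactConormal a.2) (D.incl.exactConormal b.2)).trans ?_
  exact (D.exactBracket_eq_symbolBracket hv a.1 a.2 b.1 b.2).symm

/-- The Sternberg-Weinstein structure. -/
def swField : BivectorField D.IEStar D.EStar where
  sharp := D.swSharp
  skew t α := (D.apply_swSharp t α α).trans (D.exactBracket_self t _)
  smooth f g t := by
    -- The lift chosen at the single point `t` gives global functions whose differentials form a
    -- frame at `t`; no smooth dependence of the lift on the point is needed.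
    let σ : (EX × D.incl.NormalFiber →L[ℝ] ℝ) →ₗ[ℝ]
      C^∞⟮𝓘(ℝ, EX), X; 𝓘(ℝ, ℝ), ℝ⟯ × D.incl.vanishing := D.symbolLift t
    refine contMDiffAt_sharp_of_frame (F := D.exactSymbol ∘ₗ σ) (w := D.swSharp) ?_ ?_
      (contMDiffAt_formCoord_differential (f.contMDiff t))
      (contMDiffAt_formCoord_differential (g.contMDiff t))
    · have : (fun a => differential D.IEStar ((D.exactSymbol ∘ₗ σ) a) t) = id :=
        funext fun β => D.differential_symbolLift t β
      rw [this]
      exact Function.bijective_id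
    · intro a b
      refine ((D.contMDiff_exactBracket (σ a) (σ b)).contMDiffAt (x := t)).congr_of_eventuallyEq
        (.of_forall fun s => ?_)
      exact D.differential_exactSymbol_swSharp s (σ a) (σ b)

theorem covector_inl (t : D.EStar) (f : C^∞⟮𝓘(ℝ, EX), X; 𝓘(ℝ, ℝ), ℝ⟯) :
    D.incl.covector t (f, 0) = differential D.IEStar (fun s : D.EStar => f s.1) t := by
  rw [D.incl.covector_apply, map_zero]
  have h0 : differential D.IEStar (0 : C^∞⟮D.IEStar, D.EStar; 𝓘(ℝ, ℝ), ℝ⟯) t = 0 :=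
    map_zero (differentialAt D.IEStar t)
  exact (congrArg₂ (· + ·) rfl h0).trans (add_zero _)

theorem covector_inr (t : D.EStar) (A : D.incl.conormalForms) :
    D.incl.covector t (0, A) =
      differential D.IEStar (D.bar fun x => ⟨A.1 (D.incl.map x), A.2 x⟩) t := by
  rw [D.incl.covector_apply, map_zero]
  have h0 : differential D.IEStar (0 : C^∞⟮D.IEStar, D.EStar; 𝓘(ℝ, ℝ), ℝ⟯) t = 0 :=
    map_zero (differentialAt D.IEStar t)
  exact (congrArg₂ (· + ·) h0 rfl).trans (zero_add _)

theorem differential_zero_apply (x : X) (u : TangentSpace 𝓘(ℝ, EX) x) :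
    differential 𝓘(ℝ, EX) (0 : C^∞⟮𝓘(ℝ, EX), X; 𝓘(ℝ, ℝ), ℝ⟯) x u = 0 :=
  DFunLike.congr_fun (map_zero (differentialAt 𝓘(ℝ, EX) x)) u

theorem formBracket_zero_left (B : OneForm 𝓘(ℝ, EZ) Z) (z : Z) : D.w.formBracket 0 B z = 0 := by
  have h := D.w.formBracket_add_left 0 0 B z
  rw [add_zero] at h
  exact left_eq_add.1 h

theorem formBracket_zero_right (A : OneForm 𝓘(ℝ, EZ) Z) (z : Z) : D.w.formBracket A 0 z = 0 := by
  rw [D.w.formBracket_skew, formBracket_zero_left, neg_zero]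

/-- The three defining conditions are the components of one bilinear identity. In one direction they
are added up using skewness, in the other `f` or `A` is set to zero. -/
theorem isSternbergWeinstein_iff (w' : BivectorField D.IEStar D.EStar) :
    D.IsSternbergWeinstein w' ↔ ∀ (t : D.EStar) (v : TangentSpace 𝓘(ℝ, EZ) (D.incl.map t.1)),
      D.incl.proj t.1 v = t.2 → ∀ (f g : C^∞⟮𝓘(ℝ, EX), X; 𝓘(ℝ, ℝ), ℝ⟯)
        (A B : D.incl.conormalForms),
      D.incl.covector t (f, A) (w'.sharp t (D.incl.covector t (g, B))) =
        D.symbolBracket t.1 v f A g B := by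
  constructor
  · intro h t v hv f g A B
    have e : ∀ (f : C^∞⟮𝓘(ℝ, EX), X; 𝓘(ℝ, ℝ), ℝ⟯) (A : D.incl.conormalForms),
        D.incl.covector t (f, A) = differential D.IEStar (fun s : D.EStar => f s.1) t +
          differential D.IEStar (D.bar fun x => ⟨A.1 (D.incl.map x), A.2 x⟩) t :=
      fun f A => D.incl.covector_apply t f A
    have h1 := h.bracket_base_base f g t
    have h2 := h.bracket_bar_base A.1 A.2 g t
    have h3 := (w'.bracket_skew (fun s : D.EStar => f s.1)
      (D.bar fun x => ⟨B.1 (D.incl.map x), B.2 x⟩) t).trans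
      (congrArg Neg.neg (h.bracket_bar_base B.1 B.2 f t))
    have h4 := h.bracket_bar_bar A.1 B.1 A.2 B.2 t.1 v
    rw [hv] at h4
    have expand : ∀ α α' β β' : TangentSpace D.IEStar t →L[ℝ] ℝ,
        (α + α') (w'.sharp t (β + β')) = α (w'.sharp t β) + α (w'.sharp t β') +
          (α' (w'.sharp t β) + α' (w'.sharp t β')) := fun α α' β β' => by
      rw [map_add, add_apply, map_add, map_add]
    rw [e, e]
    refine (expand _ _ _ _).trans ?_
    refine (congrArg₂ (· + ·) (congrArg₂ (· + ·) h1 h3) (congrArg₂ (· + ·) h2 h4)).trans ?_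
    unfold symbolBracket
    change 0 + -differential 𝓘(ℝ, EX) f t.1 (D.anchor t.1 (D.incl.conormalAt t.1 B)) +
      (differential 𝓘(ℝ, EX) g t.1 (D.anchor t.1 (D.incl.conormalAt t.1 A)) + _) = _
    ring
  · intro h
    refine ⟨fun f g t => ?_, fun A hA f t => ?_, fun A B hA hB x v => ?_⟩
    · obtain ⟨v, hv⟩ := D.incl.proj_surjective t.1 t.2
      have h1 := h t v hv f g 0 0
      rw [covector_inl, covector_inl] at h1
      refine h1.trans ?_
      unfold symbolBracket
      rw [map_zero, map_zero, map_zero, map_zero]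
      have : D.w.formBracket (0 : D.incl.conormalForms).1 (0 : D.incl.conormalForms).1
        (D.incl.map t.1) v = 0 := DFunLike.congr_fun (D.formBracket_zero_left 0 _) v
      rw [this]
      simp
    · obtain ⟨v, hv⟩ := D.incl.proj_surjective t.1 t.2
      have h1 := h t v hv 0 f ⟨A, hA⟩ 0
      rw [covector_inl, covector_inr] at h1
      refine h1.trans ?_
      unfold symbolBracket
      have : D.w.formBracket A (0 : D.incl.conormalForms).1
        (D.incl.map t.1) v = 0 := DFunLike.congr_fun (D.formBracket_zero_right A _) v
      rw [this, differential_zero_apply, sub_zero, add_zero]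
      rfl
    · have h1 := h ⟨x, D.incl.proj x v⟩ v rfl 0 0 ⟨A, hA⟩ ⟨B, hB⟩
      rw [covector_inr, covector_inr] at h1
      refine h1.trans ?_
      unfold symbolBracket
      rw [differential_zero_apply, differential_zero_apply, sub_zero, zero_add]

variable {D}

/-- The Sternberg-Weinstein bracket of functions on the base and of fiberwise linear functions. -/
theorem IsSternbergWeinstein.apply_sharp {w' : BivectorField D.IEStar D.EStar}
    (h : D.IsSternbergWeinstein w') (t : D.EStar)
    (a b : C^∞⟮𝓘(ℝ, EX), X; 𝓘(ℝ, ℝ), ℝ⟯ × D.incl.vanishing) :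
    differential D.IEStar (D.exactSymbol a) t
      (w'.sharp t (differential D.IEStar (D.exactSymbol b) t)) = D.exactBracket t a b := by
  obtain ⟨v, hv⟩ := D.incl.proj_surjective t.1 t.2
  refine ((D.isSternbergWeinstein_iff w').1 h t v hv a.1 b.1 (D.incl.exactConormal a.2)
    (D.incl.exactConormal b.2)).trans ?_
  exact (D.exactBracket_eq_symbolBracket hv a.1 a.2 b.1 b.2).symm

variable (D)

theorem existsUnique_isSternbergWeinstein :
    ∃! w' : BivectorField D.IEStar D.EStar, D.IsSternbergWeinstein w' := by
  have hsw : D.IsSternbergWeinstein D.swField :=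
    (D.isSternbergWeinstein_iff _).2 fun t v hv f g A B => D.covector_swSharp hv f g A B
  refine ⟨D.swField, hsw, fun w' h => BivectorField.ext_of_apply fun t α β => ?_⟩
  have hα := D.differential_symbolLift t α
  have hβ := D.differential_symbolLift t β
  have h1 := (h.apply_sharp t (D.symbolLift t α) (D.symbolLift t β)).trans
    (hsw.apply_sharp t (D.symbolLift t α) (D.symbolLift t β)).symm
  rw [hα, hβ] at h1
  exact h1

end LagrangianInLeaf

end Setting

/-! ### Fibrewise bijective maps of vector bundles. -/

section Fiberwise

variable {EB HB B : Type*} [NormedAddCommGroup EB] [NormedSpace ℝ EB] [TopologicalSpace HB]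
  {IB : ModelWithCorners ℝ EB HB} [TopologicalSpace B] [ChartedSpace HB B] [IsManifold IB ∞ B]
  {F₁ : Type*} [NormedAddCommGroup F₁] [NormedSpace ℝ F₁] [FiniteDimensional ℝ F₁] {V₁ : B → Type*}
  [TopologicalSpace (TotalSpace F₁ V₁)] [∀ x, AddCommMonoid (V₁ x)] [∀ x, Module ℝ (V₁ x)]
  [∀ x, TopologicalSpace (V₁ x)] [FiberBundle F₁ V₁] [VectorBundle ℝ F₁ V₁]
  [ContMDiffVectorBundle ∞ F₁ V₁ IB]
  {F₂ : Type*} [NormedAddCommGroup F₂] [NormedSpace ℝ F₂] [CompleteSpace F₂] {V₂ : B → Type*}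
  [TopologicalSpace (TotalSpace F₂ V₂)] [∀ x, AddCommMonoid (V₂ x)] [∀ x, Module ℝ (V₂ x)]
  [∀ x, TopologicalSpace (V₂ x)] [FiberBundle F₂ V₂] [VectorBundle ℝ F₂ V₂]
  [ContMDiffVectorBundle ∞ F₂ V₂ IB]

theorem contMDiffAt_constSection (x₀ : B) (m : F₁) :
    ContMDiffAt IB (IB.prod 𝓘(ℝ, F₁)) ∞
      (fun x => (⟨x, (trivializationAt F₁ V₁ x₀).symm x m⟩ : TotalSpace F₁ V₁)) x₀ := by
  refine contMDiffAt_totalSpace.2 ⟨contMDiffAt_id, ?_⟩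
  refine (contMDiffAt_const (c := m)).congr_of_eventuallyEq ?_
  filter_upwards [(trivializationAt F₁ V₁ x₀).open_baseSet.mem_nhds
    (mem_baseSet_trivializationAt F₁ V₁ x₀)] with x hx
  exact congrArg Prod.snd ((trivializationAt F₁ V₁ x₀).apply_mk_symm hx m)

/-- A smooth map of vector bundles that is bijective on the fibers is a diffeomorphism. -/
theorem exists_diffeomorph_of_fiberwise_bijective {ψ : TotalSpace F₁ V₁ → TotalSpace F₂ V₂}
    (φ : ∀ x, V₁ x →ₗ[ℝ] V₂ x) (hφ : ∀ x, Function.Bijective (φ x))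
    (hψ : ∀ t, ψ t = ⟨t.1, φ t.1 t.2⟩)
    (hs : ContMDiff (IB.prod 𝓘(ℝ, F₁)) (IB.prod 𝓘(ℝ, F₂)) ∞ ψ) :
    ∃ Ψ : Diffeomorph (IB.prod 𝓘(ℝ, F₁)) (IB.prod 𝓘(ℝ, F₂)) (TotalSpace F₁ V₁)
      (TotalSpace F₂ V₂) ∞, ⇑Ψ = ψ := by
  let e : ∀ x, V₁ x ≃ₗ[ℝ] V₂ x := fun x => LinearEquiv.ofBijective (φ x) (hφ x)
  let χ : TotalSpace F₂ V₂ → TotalSpace F₁ V₁ := fun s => ⟨s.1, (e s.1).symm s.2⟩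
  have hχψ : ∀ t, χ (ψ t) = t := fun t => by
    rw [hψ]
    exact congrArg (TotalSpace.mk t.1) ((e t.1).symm_apply_apply t.2)
  have hψχ : ∀ s, ψ (χ s) = s := fun s => by
    rw [hψ]
    exact congrArg (TotalSpace.mk s.1) ((e s.1).apply_symm_apply s.2)
  refine ⟨⟨⟨ψ, χ, hχψ, hψχ⟩, hs, fun s₀ => ?_⟩, rfl⟩
  refine contMDiffAt_totalSpace.2 ⟨contMDiff_proj V₂ s₀, ?_⟩
  let e₁ := trivializationAt F₁ V₁ s₀.1
  let e₂ := trivializationAt F₂ V₂ s₀.1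
  have h₁ := mem_baseSet_trivializationAt F₁ V₁ s₀.1
  have h₂ := mem_baseSet_trivializationAt F₂ V₂ s₀.1
  -- The matrix of `φ` in the trivializations. It is smooth because `ψ` maps the constant local
  -- sections to smooth sections.
  let T : B → F₁ →L[ℝ] F₂ := fun x => LinearMap.toContinuousLinearMap
    ((e₂.continuousLinearMapAt ℝ x).toLinearMap ∘ₗ φ x ∘ₗ (e₁.symmL ℝ x).toLinearMap)
  have hT : ContMDiffAt IB 𝓘(ℝ, F₁ →L[ℝ] F₂) ∞ T s₀.1 := by
    refine ContMDiffAt.clm_of_forall_apply fun m => ?_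
    have h3 := contMDiffAt_totalSpace.1
      ((hs _).comp s₀.1 (contMDiffAt_constSection (IB := IB) (V₁ := V₁) s₀.1 m))
    have h4 := h3.2
    simp only [Function.comp_apply, hψ] at h4
    refine h4.congr_of_eventuallyEq ?_
    filter_upwards [e₁.open_baseSet.mem_nhds h₁, e₂.open_baseSet.mem_nhds h₂] with x hx hx'
    refine (Trivialization.continuousLinearMapAt_apply_of_mem ℝ e₂ hx' _).trans ?_
    exact congrArg (fun v => (e₂ ⟨x, φ x v⟩).2) (Trivialization.symmL_apply (R := ℝ) e₁ hx m)
  have hT' : ContMDiffAt (IB.prod 𝓘(ℝ, F₂)) 𝓘(ℝ, F₁ →L[ℝ] F₂) ∞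
      (fun s : TotalSpace F₂ V₂ => T s.1) s₀ := hT.comp s₀ (contMDiff_proj V₂ s₀)
  have : CompleteSpace F₁ := FiniteDimensional.complete ℝ F₁
  -- The fibre coordinate of the inverse map solves a smooth linear system with matrix `T`, and so
  -- is smooth.
  refine ContMDiffAt.of_clm_apply hT' ?_ ?_
  · have h5 : Function.Bijective (e₂.continuousLinearMapAt ℝ s₀.1) :=
      ⟨(Function.LeftInverse.injective fun y => e₂.symmL_continuousLinearMapAt h₂ y),
        (Function.RightInverse.surjective fun y => e₂.continuousLinearMapAt_symmL h₂ y)⟩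
    have h6 : Function.Bijective (e₁.symmL ℝ s₀.1) :=
      ⟨(Function.LeftInverse.injective fun y => e₁.continuousLinearMapAt_symmL h₁ y),
        (Function.RightInverse.surjective fun y => e₁.symmL_continuousLinearMapAt h₁ y)⟩
    exact h5.comp ((hφ s₀.1).comp h6)
  · refine (contMDiffAt_totalSpace.1 (contMDiffAt_id (x := s₀))).2.congr_of_eventuallyEq ?_
    have hp : Continuous (TotalSpace.proj : TotalSpace F₂ V₂ → B) := FiberBundle.continuous_proj _ _
    filter_upwards [hp.continuousAt.preimage_mem_nhds (e₁.open_baseSet.mem_nhds h₁),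
      hp.continuousAt.preimage_mem_nhds (e₂.open_baseSet.mem_nhds h₂)] with s hs1 hs2
    have h7 : e₁.symmL ℝ s.1 (e₁ (χ s)).2 = (e s.1).symm s.2 := by
      rw [← Trivialization.continuousLinearMapAt_apply_of_mem ℝ e₁ hs1 ((e s.1).symm s.2)]
      exact e₁.symmL_continuousLinearMapAt hs1 _
    have h8 : T s.1 (e₁ (χ s)).2 = e₂.continuousLinearMapAt ℝ s.1 s.2 := by
      refine (congrArg (fun v => e₂.continuousLinearMapAt ℝ s.1 (φ s.1 v)) h7).trans ?_
      exact congrArg _ ((e s.1).apply_symm_apply s.2)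
    exact h8.trans (Trivialization.continuousLinearMapAt_apply_of_mem ℝ e₂ hs2 _)

end Fiberwise

/-! ### The bundles `L_X*` and `L_X^π` and their functions. -/

section Setting

universe uS
variable {EZ Z ES : Type*} {S : Type uS} {EX X : Type*}
  [NormedAddCommGroup EZ] [NormedSpace ℝ EZ] [FiniteDimensional ℝ EZ]
  [TopologicalSpace Z] [ChartedSpace EZ Z] [IsManifold 𝓘(ℝ, EZ) ∞ Z] [T2Space Z]
  [NormedAddCommGroup ES] [NormedSpace ℝ ES] [FiniteDimensional ℝ ES]
  [TopologicalSpace S] [ChartedSpace ES S] [IsManifold 𝓘(ℝ, ES) ∞ S]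
  [NormedAddCommGroup EX] [NormedSpace ℝ EX] [FiniteDimensional ℝ EX]
  [TopologicalSpace X] [ChartedSpace EX X] [IsManifold 𝓘(ℝ, EX) ∞ X] [T2Space X]

namespace LagrangianInLeaf

variable (D : LagrangianInLeaf EZ Z ES S EX X)
  {E' H' M : Type*} [NormedAddCommGroup E'] [NormedSpace ℝ E'] [TopologicalSpace H']
  {J : ModelWithCorners ℝ E' H'} [TopologicalSpace M] [ChartedSpace H' M]

/-- The natural map of `L_X*` to the normal bundle of the leaf. -/
def lstarToLeaf (n : D.LStar) : TotalSpace D.leaf.NormalFiber D.leaf.NormalSpace :=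
  ⟨D.lag.map n.1, n.2⟩

/-- The trivializations of the pulled-back bundle are those of the normal bundle of the leaf, so its
fibre coordinate can be used. -/
theorem contMDiffAt_LStar_iff {f : M → D.LStar} {p : M} :
    ContMDiffAt J D.ILStar ∞ f p ↔ ContMDiffAt J 𝓘(ℝ, EX) ∞ (fun q => (f q).1) p ∧
      ContMDiffAt J 𝓘(ℝ, D.leaf.NormalFiber) ∞
        (fun q => D.leaf.normalCoord (D.lag.map (f p).1) (D.lstarToLeaf (f q))) p :=
  contMDiffAt_totalSpace

theorem contMDiff_lstarToLeaf :
    ContMDiff D.ILStar (𝓘(ℝ, ES).prod 𝓘(ℝ, D.leaf.NormalFiber)) ∞ D.lstarToLeaf := fun n =>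
  contMDiffAt_totalSpace.2 ⟨(D.lag.map.contMDiff.comp (contMDiff_proj D.LDual)) n,
    (D.contMDiffAt_LStar_iff.1 (contMDiffAt_id (x := n))).2⟩

/-- In coordinates the projection lifts a normal vector of `X` to `TZ` by `splitS` and then projects
along `TS` by `projAt`; both are smooth. -/
theorem contMDiff_toLStar : ContMDiff D.IEStar D.ILStar ∞ D.toLStar := fun t => by
  refine D.contMDiffAt_LStar_iff.2 ⟨contMDiff_proj D.EDual t, ?_⟩
  have h1 : ContMDiffAt D.IEStar 𝓘(ℝ, EZ →L[ℝ] D.leaf.NormalFiber) ∞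
      (fun s : D.EStar => D.leaf.projAt (D.lag.map t.1) (D.lag.map s.1)) t :=
    ContMDiffAt.comp (I' := 𝓘(ℝ, ES)) (g := D.leaf.projAt (D.lag.map t.1))
      (f := fun s : D.EStar => D.lag.map s.1) t
      ((D.leaf.contMDiffOn_projAt (D.lag.map t.1)).contMDiffAt
        ((D.leaf.isOpen_normalBase _).mem_nhds (D.leaf.mem_normalBase _)))
      ((D.lag.map.contMDiff.comp (contMDiff_proj D.EDual)) t)
  have h2 : ContMDiffAt D.IEStar 𝓘(ℝ, EZ) ∞
      (fun s : D.EStar => D.incl.splitS t.1 (D.incl.normalCoord t.1 s)) t :=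
    (D.incl.splitS t.1).contMDiffAt.comp t (D.incl.contMDiffAt_normalCoord t)
  refine (h1.clm_apply h2).congr_of_eventuallyEq ?_
  have hp : Continuous fun s : D.EStar => D.lag.map s.1 :=
    (D.lag.map.contMDiff.comp (contMDiff_proj D.EDual (IB := 𝓘(ℝ, EX)))).continuous
  filter_upwards [D.incl.eventually_mem_normalBase t, hp.continuousAt.preimage_mem_nhds
    ((D.leaf.isOpen_normalBase _).mem_nhds (D.leaf.mem_normalBase (D.lag.map t.1)))] with s hs hs'
  have h3 := congrArg (D.leaf.normalProj D.lag s.1) (D.incl.proj_symmL_splitS hs)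
  refine (congrArg (D.leaf.normalMap (D.lag.map t.1) (D.lag.map s.1)) h3).symm.trans ?_
  refine (D.leaf.normalMap_proj hs' _).trans ?_
  exact congrArg _ (Trivialization.continuousLinearMapAt_symmL (R := ℝ) (D.incl.trN t.1) hs.1.2 _)

theorem toLStar_surjective : Function.Surjective D.toLStar := by
  rintro ⟨x, n⟩
  obtain ⟨v, rfl⟩ := D.leaf.proj_surjective (D.lag.map x) n
  exact ⟨⟨x, D.incl.proj x v⟩, rfl⟩

/-- The fiberwise linear function on `L_X*` of a function vanishing on the leaf. -/
def barL (G : D.leaf.vanishing) : C^∞⟮D.ILStar, D.LStar; 𝓘(ℝ, ℝ), ℝ⟯ :=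
  (D.leaf.barMap G).comp ⟨D.lstarToLeaf, D.contMDiff_lstarToLeaf⟩

theorem barL_apply (G : D.leaf.vanishing) (n : D.LStar) :
    D.barL G n = D.leaf.pairing (D.lag.map n.1) (D.leaf.dConormal (D.lag.map n.1) G) n.2 := rfl

theorem pairing_normalProj (x : X) {l : D.EFiber x} (hl : l.1 ∈ D.LFiber x) (n : D.EDual x) :
    D.leaf.pairing (D.lag.map x) ⟨l.1, hl⟩ (D.leaf.normalProj D.lag x n) =
      D.incl.pairing x l n := by
  obtain ⟨v, rfl⟩ := D.incl.proj_surjective x n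
  rfl

/-- Functions that vanish on the leaf also vanish on `X`, and the two fibrewise linear functions
correspond under `l`. So brackets on `L_X*` can be computed on `Z'`. -/
theorem barL_toLStar (G : D.leaf.vanishing) (t : D.EStar) :
    D.barL G (D.toLStar t) = D.incl.barMap (D.leafToIncl G) t :=
  D.pairing_normalProj t.1 (D.dE_leafToIncl_mem t.1 G) t.2

theorem verticalPart_barL (G : D.leaf.vanishing) (n : D.LStar) :
    verticalPart n (differential D.ILStar (D.barL G) n) =
      D.leaf.pairingL (D.lag.map n.1) (D.leaf.dConormal (D.lag.map n.1) G) :=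
  verticalPart_differential (V := D.LDual) ((D.barL G).mdiffAt n)
    (D.leaf.pairingL (D.lag.map n.1) (D.leaf.dConormal (D.lag.map n.1) G)) 0
    fun _ => (add_zero _).symm

theorem exists_differential_eq_add_barL (n : D.LStar) (b : TangentSpace D.ILStar n →L[ℝ] ℝ) :
    ∃ (f : C^∞⟮𝓘(ℝ, EX), X; 𝓘(ℝ, ℝ), ℝ⟯) (G : D.leaf.vanishing),
      b = differential D.ILStar (basePullback (F := D.leaf.NormalFiber) (V := D.LDual) f) n +
        differential D.ILStar (D.barL G) n := by
  obtain ⟨G, hG⟩ := D.dL_surjective n.1 (D.leaf.toConormal (D.lag.map n.1) (verticalPart n b))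
  obtain ⟨f, hf⟩ := exists_eq_differential_add b (differential D.ILStar (D.barL G) n)
    (by rw [verticalPart_barL, hG]; exact D.leaf.pairingL_toConormal (D.lag.map n.1) _)
  exact ⟨f, G, hf⟩

theorem contMDiffAt_LPi_iff {f : M → D.LPi} {p : M} :
    ContMDiffAt J D.ILPi ∞ f p ↔ ContMDiffAt J D.ICot ∞ (fun q => D.pr₁ (f q)) p ∧
      ContMDiffAt J D.ILStar ∞ (fun q => D.pr₂ (f q)) p := by
  have h1 : ContMDiffAt J D.ILPi ∞ f p ↔ ContMDiffAt J 𝓘(ℝ, EX) ∞ (fun q => (f q).1) p ∧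
      ContMDiffAt J 𝓘(ℝ, (EX →L[ℝ] ℝ) × D.leaf.NormalFiber) ∞
        (fun q => (cotangentCoord (D.pr₁ (f p)) (D.pr₁ (f q)),
          D.leaf.normalCoord (D.lag.map (f p).1) (D.lstarToLeaf (D.pr₂ (f q))))) p :=
    contMDiffAt_totalSpace
  have h2 : ContMDiffAt J D.ICot ∞ (fun q => D.pr₁ (f q)) p ↔
      ContMDiffAt J 𝓘(ℝ, EX) ∞ (fun q => (f q).1) p ∧ ContMDiffAt J 𝓘(ℝ, EX →L[ℝ] ℝ) ∞
        (fun q => cotangentCoord (D.pr₁ (f p)) (D.pr₁ (f q))) p := contMDiffAt_totalSpace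
  have h3 : ContMDiffAt J D.ILStar ∞ (fun q => D.pr₂ (f q)) p ↔
      ContMDiffAt J 𝓘(ℝ, EX) ∞ (fun q => (f q).1) p ∧
      ContMDiffAt J 𝓘(ℝ, D.leaf.NormalFiber) ∞
        (fun q => D.leaf.normalCoord (D.lag.map (f p).1) (D.lstarToLeaf (D.pr₂ (f q)))) p :=
    D.contMDiffAt_LStar_iff
  rw [h1, h2, h3]
  constructor
  · rintro ⟨h, h'⟩
    rw [contMDiffAt_prod_module_iff] at h'
    exact ⟨⟨h, h'.1⟩, ⟨h, h'.2⟩⟩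
  · rintro ⟨⟨h, h'⟩, -, h''⟩
    exact ⟨h, h'.prodMk_space h''⟩

theorem contMDiff_pr₁ : ContMDiff D.ILPi D.ICot ∞ D.pr₁ := fun q =>
  (D.contMDiffAt_LPi_iff.1 (contMDiffAt_id (x := q))).1

theorem contMDiff_pr₂ : ContMDiff D.ILPi D.ILStar ∞ D.pr₂ := fun q =>
  (D.contMDiffAt_LPi_iff.1 (contMDiffAt_id (x := q))).2

end LagrangianInLeaf

end Setting

/-- A family of linear maps is smooth if it is smooth on a smooth moving frame `T q u`: express a
constant vector in the frame by solving a linear system. -/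
theorem ContMDiffAt.of_clm_comp {E H M V W : Type*} [NormedAddCommGroup E] [NormedSpace ℝ E]
    [TopologicalSpace H] {I : ModelWithCorners ℝ E H} [TopologicalSpace M] [ChartedSpace H M]
    [NormedAddCommGroup V] [NormedSpace ℝ V] [FiniteDimensional ℝ V] [NormedAddCommGroup W]
    [NormedSpace ℝ W] {n : WithTop ℕ∞} {T : M → V →L[ℝ] V} {C : M → V →L[ℝ] W} {p : M}
    (hT : ContMDiffAt I 𝓘(ℝ, V →L[ℝ] V) n T p) (hb : Function.Bijective (T p))
    (h : ∀ u, ContMDiffAt I 𝓘(ℝ, W) n (fun q => C q (T q u)) p) :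
    ContMDiffAt I 𝓘(ℝ, V →L[ℝ] W) n C p := by
  have : CompleteSpace V := FiniteDimensional.complete ℝ V
  have hS : ContMDiffAt I 𝓘(ℝ, V →L[ℝ] W) n (fun q => (C q).comp (T q)) p :=
    ContMDiffAt.clm_of_forall_apply h
  refine ContMDiffAt.clm_of_forall_apply fun u => ?_
  obtain ⟨y, hy, hyu⟩ := hT.exists_clm_apply_eq hb (contMDiffAt_const (c := u))
  refine (hS.clm_apply hy).congr_of_eventuallyEq ?_
  filter_upwards [hyu] with q hq
  exact (congrArg (C q) hq).symm

/-! ### The diffeomorphism `ψ_H`. -/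

section Setting

universe uS
variable {EZ Z ES : Type*} {S : Type uS} {EX X : Type*}
  [NormedAddCommGroup EZ] [NormedSpace ℝ EZ] [FiniteDimensional ℝ EZ]
  [TopologicalSpace Z] [ChartedSpace EZ Z] [IsManifold 𝓘(ℝ, EZ) ∞ Z] [T2Space Z]
  [NormedAddCommGroup ES] [NormedSpace ℝ ES] [FiniteDimensional ℝ ES]
  [TopologicalSpace S] [ChartedSpace ES S] [IsManifold 𝓘(ℝ, ES) ∞ S]
  [NormedAddCommGroup EX] [NormedSpace ℝ EX] [FiniteDimensional ℝ EX]
  [TopologicalSpace X] [ChartedSpace EX X] [IsManifold 𝓘(ℝ, EX) ∞ X] [T2Space X]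

namespace LagrangianInLeaf

variable {D : LagrangianInLeaf EZ Z ES S EX X}

namespace AdmissibleHamiltonian

variable (H : D.AdmissibleHamiltonian)

/-- The map `ψ_H` on the fibers. -/
def psiFiber (x : X) : D.EDual x →ₗ[ℝ] (TangentSpace 𝓘(ℝ, EX) x →L[ℝ] Trivial X ℝ x) × D.LDual x where
  toFun n := (LinearMap.toContinuousLinearMap ((D.incl.pairing x).flip n ∘ₗ H.alpha x),
    D.leaf.normalProj D.lag x n)
  map_add' n n' := Prod.ext (ContinuousLinearMap.ext fun u =>
    map_add (D.incl.pairing x (H.alpha x u)) n n') (map_add (D.leaf.normalProj D.lag x) n n')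
  map_smul' c n := Prod.ext (ContinuousLinearMap.ext fun u =>
    map_smul (D.incl.pairing x (H.alpha x u)) c n) (map_smul (D.leaf.normalProj D.lag x) c n)

theorem psi_eq (t : D.EStar) : H.psi t = ⟨t.1, H.psiFiber t.1 t.2⟩ := rfl

/-- For horizontal `K` the map `α_H` sends the field of `K` to `dK`, so momenta on `T*X` pull back
to functions whose brackets on `Z'` are known. -/
theorem momentum_field_pr₁_psi (K : H.horizontal) (t : D.EStar) :
    momentum (fun x => D.field K.1 x) (D.pr₁ (H.psi t)) = D.incl.barMap K.1 t :=
  congrArg (fun l => D.incl.pairing t.1 l t.2) (H.alpha_field K t.1)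

theorem alpha_apply_sharp (x : X) (u : TangentSpace 𝓘(ℝ, EX) x)
    (l : TangentSpace 𝓘(ℝ, EZ) (D.incl.map x) →L[ℝ] ℝ) :
    (H.alpha x u).1 (D.w.sharp (D.incl.map x) l) = l (D.incl.deriv x u) := by
  rw [D.w.skew', D.sharp_eq_neg_anchor, anchor_alpha, map_neg, neg_neg]

/-- A vector `v` with zero image lies in `TS`, so `v = w♯ l`. From `α_H u (w♯ l) = l u` the covector
`l` annihilates `TX`; then `w♯ l` is minus its anchor, which is tangent to `X`. -/
theorem psiFiber_injective (x : X) : Function.Injective (H.psiFiber x) := by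
  have key : ∀ n, H.psiFiber x n = 0 → n = 0 := by
    intro n hn
    obtain ⟨v, rfl⟩ := D.incl.proj_surjective x n
    have h1 : D.leaf.proj (D.lag.map x) v = 0 := congrArg Prod.snd hn
    have h2 : ∀ u, (H.alpha x u).1 v = 0 := fun u => DFunLike.congr_fun (congrArg Prod.fst hn) u
    obtain ⟨u, rfl⟩ := (Submodule.Quotient.mk_eq_zero (D.leaf.tangentImage (D.lag.map x))).1 h1
    obtain ⟨l, hl'⟩ : ∃ l : TangentSpace 𝓘(ℝ, EZ) (D.incl.map x) →L[ℝ] ℝ,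
        D.w.sharp (D.incl.map x) l = D.leaf.deriv (D.lag.map x) u :=
      D.exists_sharp_eq_leaf (D.lag.map x) u
    have h3 : l ∈ D.EFiber x := fun u' =>
      (H.alpha_apply_sharp x u' l).symm.trans ((congrArg (H.alpha x u').1 hl').trans (h2 u'))
    refine (Submodule.Quotient.mk_eq_zero (D.incl.tangentImage x)).2 ⟨-D.anchor x ⟨l, h3⟩, ?_⟩
    refine (map_neg (D.incl.deriv x) _).trans ((D.sharp_eq_neg_anchor x ⟨l, h3⟩).symm.trans hl')
  intro n n' h
  refine sub_eq_zero.1 (key _ ?_)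
  have h1 : H.psiFiber x (n - n') + H.psiFiber x n' = H.psiFiber x n := by
    rw [← map_add, sub_add_cancel]
  refine Prod.ext ?_ ?_
  · have := congrArg Prod.fst (h1.trans h)
    exact add_eq_right.1 this
  · have := congrArg Prod.snd (h1.trans h)
    exact (add_eq_right (M := D.leaf.NormalSpace (D.lag.map x))).1 this

/-- Correct a lift `v` of the `L_X*` component by `w♯ l`. This stays in the same class modulo `TS`
and changes the `T*X` component by `l|_TX`, which is chosen to be the defect `a`. -/
theorem psiFiber_surjective (x : X) : Function.Surjective (H.psiFiber x) := by
  rintro ⟨c, m⟩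
  obtain ⟨v, rfl⟩ : ∃ v : TangentSpace 𝓘(ℝ, EZ) (D.incl.map x), D.leaf.proj (D.lag.map x) v = m :=
    D.leaf.proj_surjective (D.lag.map x) m
  obtain ⟨R, hR⟩ := (D.incl.deriv x).toLinearMap.exists_leftInverse_of_injective
    (LinearMap.ker_eq_bot.2 (D.incl.injective_mfderiv x))
  let a : TangentSpace 𝓘(ℝ, EX) x →ₗ[ℝ] ℝ :=
    c.toLinearMap - (D.incl.pairing x).flip (D.incl.proj x v) ∘ₗ H.alpha x
  let l : TangentSpace 𝓘(ℝ, EZ) (D.incl.map x) →L[ℝ] ℝ := LinearMap.toContinuousLinearMap (a ∘ₗ R)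
  have hl : ∀ u, l (D.incl.deriv x u) = c u - (H.alpha x u).1 v := fun u =>
    congrArg a (LinearMap.congr_fun hR u)
  refine ⟨D.incl.proj x (v + D.w.sharp (D.incl.map x) l), Prod.ext ?_ ?_⟩
  · refine ContinuousLinearMap.ext fun u => ?_
    change (H.alpha x u).1 (v + D.w.sharp (D.incl.map x) l) = c u
    rw [map_add, alpha_apply_sharp, hl]
    exact add_sub_cancel (G := ℝ) _ _
  · change D.leaf.proj (D.lag.map x) (v + D.w.sharp (D.incl.map x) l) = D.leaf.proj (D.lag.map x) v
    obtain ⟨u, hu⟩ := D.sharp_mem_range_leaf x l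
    have h0 : D.leaf.proj (D.lag.map x) (D.w.sharp (D.incl.map x) l) = 0 :=
      (Submodule.Quotient.mk_eq_zero _).2 ⟨u, hu⟩
    exact (map_add (D.leaf.proj (D.lag.map x)) _ _).trans ((congrArg (_ + ·) h0).trans (add_zero _))

/-- Smoothness is tested on a frame of fields of horizontal functions, where the pairing is the
smooth function `bar dK`. Smoothness of `α_H` itself never has to be stated. -/
theorem contMDiff_pr₁_psi : ContMDiff D.IEStar D.ICot ∞ fun t => D.pr₁ (H.psi t) := by
  intro t
  refine contMDiffAt_totalSpace.2 ⟨contMDiff_proj D.EDual t, ?_⟩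
  obtain ⟨K, hK⟩ := H.exists_linear_horizontal t.1
  let T : X → EX →L[ℝ] EX := fun x => LinearMap.toContinuousLinearMap
    (((trivializationAt EX (TangentSpace 𝓘(ℝ, EX)) t.1).continuousLinearMapAt ℝ x).toLinearMap ∘ₗ
      D.anchor x ∘ₗ D.dE x ∘ₗ H.horizontal.subtype ∘ₗ
      (show EX →ₗ[ℝ] H.horizontal from K))
  have hTu : ∀ (u : EX) (x : X), T x u = vecCoord t.1 (fun y => D.field (K u).1 y) x := fun _ _ => rfl
  have hT : ContMDiffAt 𝓘(ℝ, EX) 𝓘(ℝ, EX →L[ℝ] EX) ∞ T t.1 :=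
    ContMDiffAt.clm_of_forall_apply fun u =>
      (VField.contMDiffAt_vecCoord (D.field (K u).1) t.1).congr_of_eventuallyEq (.of_forall (hTu u))
  have hT1 : T t.1 = ContinuousLinearMap.id ℝ EX := ContinuousLinearMap.ext fun u =>
    (hTu u t.1).trans ((vecCoord_self _ _).trans (hK u))
  have hT' : ContMDiffAt D.IEStar 𝓘(ℝ, EX →L[ℝ] EX) ∞ (fun s : D.EStar => T s.1) t :=
    hT.comp t (contMDiff_proj D.EDual t)
  refine ContMDiffAt.of_clm_comp hT' (hT1 ▸ Function.bijective_id) fun u => ?_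
  refine ((D.incl.barMap (K u).1).contMDiff t).congr_of_eventuallyEq ?_
  have hp : Continuous (TotalSpace.proj : D.EStar → X) := FiberBundle.continuous_proj _ _
  filter_upwards [hp.continuousAt.preimage_mem_nhds (chart_source_mem_nhds EX t.1)] with s hs
  rw [← H.momentum_field_pr₁_psi (K u) s]
  have h1 := cotangentCoord_eq (D.pr₁ (H.psi t)) (D.pr₁ (H.psi s)) (T s.1 u)
  refine h1.trans (congrArg (D.pr₁ (H.psi s)).2 ?_)
  exact Trivialization.symmL_continuousLinearMapAt (R := ℝ)
    (trivializationAt EX (TangentSpace 𝓘(ℝ, EX)) t.1) (by simpa using hs) (D.field (K u).1 s.1)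

theorem contMDiff_psi : ContMDiff D.IEStar D.ILPi ∞ H.psi := fun t =>
  D.contMDiffAt_LPi_iff.2 ⟨H.contMDiff_pr₁_psi t, D.contMDiff_toLStar t⟩

theorem exists_diffeomorph_psi : ∃ Ψ : Diffeomorph D.IEStar D.ILPi D.EStar D.LPi ∞, ⇑Ψ = H.psi := by
  have : CompleteSpace ((EX →L[ℝ] ℝ) × D.leaf.NormalFiber) := FiniteDimensional.complete ℝ _
  exact exists_diffeomorph_of_fiberwise_bijective H.psiFiber
    (fun x => ⟨H.psiFiber_injective x, H.psiFiber_surjective x⟩) H.psi_eq H.contMDiff_psi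

end AdmissibleHamiltonian

end LagrangianInLeaf

end Setting

/-! ### The curvature of `α_H`. -/

section Setting

universe uS
variable {EZ Z ES : Type*} {S : Type uS} {EX X : Type*}
  [NormedAddCommGroup EZ] [NormedSpace ℝ EZ] [FiniteDimensional ℝ EZ]
  [TopologicalSpace Z] [ChartedSpace EZ Z] [IsManifold 𝓘(ℝ, EZ) ∞ Z] [T2Space Z]
  [NormedAddCommGroup ES] [NormedSpace ℝ ES] [FiniteDimensional ℝ ES]
  [TopologicalSpace S] [ChartedSpace ES S] [IsManifold 𝓘(ℝ, ES) ∞ S]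
  [NormedAddCommGroup EX] [NormedSpace ℝ EX] [FiniteDimensional ℝ EX]
  [TopologicalSpace X] [ChartedSpace EX X] [IsManifold 𝓘(ℝ, EX) ∞ X] [T2Space X]

namespace LagrangianInLeaf

variable {D : LagrangianInLeaf EZ Z ES S EX X}

namespace AdmissibleHamiltonian

variable (H : D.AdmissibleHamiltonian)

theorem mfderiv_pr₁_psi_fst (t : D.EStar) (Y : TangentSpace D.IEStar t) :
    (mfderiv D.IEStar D.ICot (fun s => D.pr₁ (H.psi s)) t Y : EX × (EX →L[ℝ] ℝ)).1 =
      (mfderiv D.IEStar 𝓘(ℝ, EX) (TotalSpace.proj : D.EStar → X) t Y : EX) := by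
  have h1 := mfderiv_comp_apply t (I'' := 𝓘(ℝ, EX))
    (g := (TotalSpace.proj : CotangentSpace 𝓘(ℝ, EX) X → X)) (f := fun s => D.pr₁ (H.psi s))
    ((contMDiff_proj _ (IB := 𝓘(ℝ, EX)) (n := ∞)).mdifferentiable (by simp) _)
    (H.contMDiff_pr₁_psi.mdifferentiable (by simp) t) Y
  exact (mfderiv_proj_apply _ _).symm.trans h1.symm

/-- `bar (α_H U)` is the momentum of `U` pulled back along the `T*X` component of `ψ_H`. -/
theorem differential_bar_alpha (U : VField 𝓘(ℝ, EX) X) (t : D.EStar) :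
    differential D.IEStar (D.bar fun x => H.alpha x (U x)) t =
      (differential D.ICot (momentum fun x => U x) (D.pr₁ (H.psi t))).comp
        (mfderiv D.IEStar D.ICot (fun s => D.pr₁ (H.psi s)) t) :=
  differential_comp (f := momentum fun x => U x) (g := fun s => D.pr₁ (H.psi s))
    ((contMDiffAt_momentum (VField.contMDiffAt_vecCoord U _)).mdifferentiableAt (by simp))
    (H.contMDiff_pr₁_psi.mdifferentiable (by simp) t)

theorem mdifferentiableAt_bar_alpha (U : VField 𝓘(ℝ, EX) X) (t : D.EStar) :
    MDifferentiableAt D.IEStar 𝓘(ℝ, ℝ) (D.bar fun x => H.alpha x (U x)) t :=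
  MDifferentiableAt.comp (g := momentum fun x => U x) (f := fun s => D.pr₁ (H.psi s)) t
    ((contMDiffAt_momentum (VField.contMDiffAt_vecCoord U _)).mdifferentiableAt (by simp))
    (H.contMDiff_pr₁_psi.mdifferentiable (by simp) t)

theorem differential_bar_alpha_of_eq_zero {U : VField 𝓘(ℝ, EX) X} {t : D.EStar} (h : U t.1 = 0)
    (Y : TangentSpace D.IEStar t) :
    differential D.IEStar (D.bar fun x => H.alpha x (U x)) t Y =
      D.incl.pairing t.1 (H.alpha t.1 (valueDeriv 𝓘(ℝ, EX) (vecCoord t.1 fun x => U x) t.1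
        (mfderiv D.IEStar 𝓘(ℝ, EX) (TotalSpace.proj : D.EStar → X) t Y))) t.2 := by
  rw [differential_bar_alpha]
  have h1 := differential_momentum (ξ := D.pr₁ (H.psi t)) (U := fun x => U x)
    (VField.contMDiffAt_vecCoord U _) (mfderiv D.IEStar D.ICot (fun s => D.pr₁ (H.psi s)) t Y)
  have h2 : (mfderiv D.IEStar D.ICot (fun s => D.pr₁ (H.psi s)) t Y : EX × (EX →L[ℝ] ℝ)).2
      (U t.1) = 0 := (congrArg _ h).trans (map_zero _)
  refine h1.trans ((congrArg (_ + ·) h2).trans ((add_zero (M := ℝ) _).trans ?_))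
  exact congrArg (fun u => (D.pr₁ (H.psi t)).2 (valueDeriv 𝓘(ℝ, EX) (vecCoord t.1 fun x => U x) t.1 u))
    (H.mfderiv_pr₁_psi_fst t Y)

/-- This is the tensoriality of the curvature. As `A` vanishes at `x`, `{A,B}` is minus the
derivative of `bar A` along a lift of `V`. Since `bar A` is the pull-back of the momentum of `U`,
that derivative is `α_H (DU(V))`, and `[U,V] = -DU(V)` where `U = 0`. -/
theorem formBracket_of_field_eq_zero {U V : VField 𝓘(ℝ, EX) X} {A B : OneForm 𝓘(ℝ, EZ) Z}
    (hA : ∀ x, A (D.incl.map x) = H.alpha x (U x)) (hB : ∀ x, B (D.incl.map x) = H.alpha x (V x))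
    {x : X} (h : U x = 0) :
    D.w.formBracket A B (D.incl.map x) =
      H.alpha x (VectorField.mlieBracket 𝓘(ℝ, EX) (fun y => U y) (fun y => V y) x) := by
  refine ContinuousLinearMap.ext fun v => ?_
  have hA' : ∀ x, A (D.incl.map x) ∈ D.incl.Conormal x := fun x => by
    rw [hA]; exact (H.alpha x (U x)).2
  have hA0 : A (D.incl.map x) = 0 := by rw [hA, h, map_zero]; rfl
  have h1 := D.w.formBracket_of_eq_zero (B := B) hA0 v
  have h2 : D.w.sharp (D.incl.map x) (B (D.incl.map x)) = - D.incl.deriv x (V x) := by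
    rw [hB, D.sharp_eq_neg_anchor, anchor_alpha]
  rw [h2, map_neg] at h1
  let t : D.EStar := ⟨x, D.incl.proj x v⟩
  obtain ⟨Y, hY⟩ := mfderiv_proj_surjective (IB := 𝓘(ℝ, EX)) t (V x)
  have h3 := D.incl.differential_barForm_of_eq_zero hA' (t := t) hA0 (v := v) rfl Y
  have h4 : D.incl.barForm A hA' = D.bar fun x => H.alpha x (U x) :=
    funext fun t => congrArg (fun l => D.incl.pairing t.1 l t.2) (Subtype.ext (hA t.1))
  rw [h4, H.differential_bar_alpha_of_eq_zero (t := t) h, hY] at h3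
  have h5 : (VectorField.mlieBracket 𝓘(ℝ, EX) (fun y => U y) (fun y => V y) x : EX) =
      - valueDeriv 𝓘(ℝ, EX) (vecCoord x fun y => U y) x (V x) := by
    refine (mlieBracket_eq_valueDeriv (VField.contMDiffAt_vecCoord U x)
      (VField.contMDiffAt_vecCoord V x)).trans ?_
    rw [h, map_zero, zero_sub]
  have h6 : (H.alpha x (VectorField.mlieBracket 𝓘(ℝ, EX) (fun y => U y) (fun y => V y) x)).1 v =
      - (H.alpha x (valueDeriv 𝓘(ℝ, EX) (vecCoord x fun y => U y) x (V x))).1 v :=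
    (congrArg (fun u => (H.alpha x u).1 v) h5).trans
      (congrArg (fun l : D.EFiber x => l.1 v) (map_neg (H.alpha x) _))
  refine h1.trans (Eq.trans ?_ h6.symm)
  exact congrArg Neg.neg h3.symm

/-- Apply the vanishing case to `U - U'` and `A - A'`: the curvature expression depends on `U` only
through its value at the point. -/
theorem formBracket_sub_alpha_congr_left {U U' V : VField 𝓘(ℝ, EX) X} {A A' B : OneForm 𝓘(ℝ, EZ) Z}
    (hA : ∀ x, A (D.incl.map x) = H.alpha x (U x)) (hA' : ∀ x, A' (D.incl.map x) = H.alpha x (U' x))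
    (hB : ∀ x, B (D.incl.map x) = H.alpha x (V x)) {x : X} (h : U x = U' x) :
    D.w.formBracket A B (D.incl.map x) -
        H.alpha x (VectorField.mlieBracket 𝓘(ℝ, EX) (fun y => U y) (fun y => V y) x) =
      D.w.formBracket A' B (D.incl.map x) -
        H.alpha x (VectorField.mlieBracket 𝓘(ℝ, EX) (fun y => U' y) (fun y => V y) x) := by
  have h1 := H.formBracket_of_field_eq_zero (U := U - U') (V := V) (A := A - A') (B := B) (x := x)
    (fun x => by
      rw [ContMDiffSection.coe_sub, ContMDiffSection.coe_sub, Pi.sub_apply, Pi.sub_apply, hA, hA',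
        map_sub]
      rfl) hB (by
      rw [ContMDiffSection.coe_sub, Pi.sub_apply, h, sub_self])
  have h2 := D.w.formBracket_add_left (A - A') A' B (D.incl.map x)
  rw [sub_add_cancel] at h2
  have h3 := VectorField.mlieBracket_add_left (I := 𝓘(ℝ, EX)) (V := fun y => (U - U') y)
    (V₁ := fun y => U' y) (W := fun y => V y) (x := x)
    ((U - U').contMDiff.mdifferentiable (by simp) x) (U'.contMDiff.mdifferentiable (by simp) x)
  have h4 : ((fun y => (U - U') y) + fun y => U' y) = fun y => U y := by
    funext y
    rw [ContMDiffSection.coe_sub, Pi.add_apply, Pi.sub_apply, sub_add_cancel]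
  rw [h4] at h3
  have h5 := congrArg Subtype.val ((congrArg (H.alpha x) h3).trans (map_add (H.alpha x) _ _))
  rw [h2, h1, h5]
  simp only [Submodule.coe_add]
  abel

theorem formBracket_sub_alpha_skew (U V : VField 𝓘(ℝ, EX) X) (A B : OneForm 𝓘(ℝ, EZ) Z) (x : X) :
    D.w.formBracket A B (D.incl.map x) -
        H.alpha x (VectorField.mlieBracket 𝓘(ℝ, EX) (fun y => U y) (fun y => V y) x) =
      - (D.w.formBracket B A (D.incl.map x) -
        H.alpha x (VectorField.mlieBracket 𝓘(ℝ, EX) (fun y => V y) (fun y => U y) x)) := by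
  have h := congrArg Subtype.val ((congrArg (H.alpha x) (VectorField.mlieBracket_swap_apply
    (I := 𝓘(ℝ, EX)) (V := fun y => U y) (W := fun y => V y) (x := x))).trans (map_neg (H.alpha x) _))
  rw [D.w.formBracket_skew, h]
  simp only [Submodule.coe_neg]
  abel

/-- The projection of `E_X` to `L_X` along the image of `α_H`. -/
def isotropyProjection (x : X) : D.EFiber x →ₗ[ℝ] D.LFiber x where
  toFun l := ⟨(l - H.alpha x (D.anchor x l)).1, H.sub_alpha_anchor_mem x l⟩
  map_add' l l' := by
    have h : l + l' - H.alpha x (D.anchor x (l + l')) =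
        (l - H.alpha x (D.anchor x l)) + (l' - H.alpha x (D.anchor x l')) := by
      rw [map_add, map_add]
      abel
    exact Subtype.ext (congrArg (fun m : D.EFiber x => m.1) h)
  map_smul' c l := by
    have h : c • l - H.alpha x (D.anchor x (c • l)) = c • (l - H.alpha x (D.anchor x l)) := by
      rw [map_smul, map_smul]
      exact (smul_sub c l _).symm
    exact Subtype.ext (congrArg (fun m : D.EFiber x => m.1) h)

/-- A linear choice of horizontal functions with given vector at `x`. -/
def horizontalLift (x : X) : TangentSpace 𝓘(ℝ, EX) x →ₗ[ℝ] H.horizontal :=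
  (H.exists_linear_horizontal x).choose

theorem field_horizontalLift (x : X) (u : TangentSpace 𝓘(ℝ, EX) x) :
    D.field (H.horizontalLift x u).1 x = u := (H.exists_linear_horizontal x).choose_spec u

/-- The curvature of `α_H`. -/
def curvature (x : X) :
    TangentSpace 𝓘(ℝ, EX) x →ₗ[ℝ] TangentSpace 𝓘(ℝ, EX) x →ₗ[ℝ] D.LFiber x :=
  (D.bracketE.compl₁₂ (H.horizontal.subtype ∘ₗ H.horizontalLift x)
    (H.horizontal.subtype ∘ₗ H.horizontalLift x)).compr₂ (H.isotropyProjection x ∘ₗ D.dE x)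

theorem curvature_apply (x : X) (u v : TangentSpace 𝓘(ℝ, EX) x) :
    H.curvature x u v = H.isotropyProjection x
      (D.dE x (D.bracketE (H.horizontalLift x u).1 (H.horizontalLift x v).1)) := rfl

/-- For horizontal functions the 1-form bracket is `d{K,K'}` and the Lie bracket of the fields is
its anchor, so the curvature is the projection of `d{K,K'}` along `α_H(TX)`. -/
theorem isotropyProjection_bracketE (K K' : H.horizontal) (x : X) :
    (H.isotropyProjection x (D.dE x (D.bracketE K.1 K'.1)) :
      TangentSpace 𝓘(ℝ, EZ) (D.incl.map x) →L[ℝ] ℝ) =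
      D.w.formBracket (exactForm K.1.1) (exactForm K'.1.1) (D.incl.map x) -
        H.alpha x (VectorField.mlieBracket 𝓘(ℝ, EX) (fun y => D.field K.1 y)
          (fun y => D.field K'.1 y) x) := by
  rw [D.mlieBracket_field, D.w.formBracket_exact]
  rfl

theorem isCurvature_curvature : H.IsCurvature H.curvature := by
  intro U V A B hA hB x
  rw [curvature_apply, isotropyProjection_bracketE]
  set K := H.horizontalLift x (U x)
  set K' := H.horizontalLift x (V x)
  have hK : ∀ y, exactForm K.1.1 (D.incl.map y) = H.alpha y (D.field K.1 y) := fun y =>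
    (congrArg Subtype.val (H.alpha_field K y)).symm
  have hK' : ∀ y, exactForm K'.1.1 (D.incl.map y) = H.alpha y (D.field K'.1 y) := fun y =>
    (congrArg Subtype.val (H.alpha_field K' y)).symm
  -- Replace `U`, and then, after a swap, `V` by the fields of horizontal functions with the same
  -- value at `x`.
  have h1 := H.formBracket_sub_alpha_congr_left hA hK hB (x := x)
    (H.field_horizontalLift x (U x)).symm
  have h2 := H.formBracket_sub_alpha_congr_left hB hK' hK (x := x)
    (H.field_horizontalLift x (V x)).symm
  rw [h1, H.formBracket_sub_alpha_skew (D.field K.1) V, h2, ← H.formBracket_sub_alpha_skew]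

theorem IsCurvature.apply_field {H : D.AdmissibleHamiltonian}
    {Φ : ∀ x, TangentSpace 𝓘(ℝ, EX) x →ₗ[ℝ] TangentSpace 𝓘(ℝ, EX) x →ₗ[ℝ] D.LFiber x}
    (h : H.IsCurvature Φ) (K K' : H.horizontal) (x : X) :
    Φ x (D.field K.1 x) (D.field K'.1 x) =
      H.isotropyProjection x (D.dE x (D.bracketE K.1 K'.1)) :=
  Subtype.ext ((h (D.field K.1) (D.field K'.1) (exactForm K.1.1) (exactForm K'.1.1)
    (fun y => (congrArg Subtype.val (H.alpha_field K y)).symm)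
    (fun y => (congrArg Subtype.val (H.alpha_field K' y)).symm) x).trans
      (H.isotropyProjection_bracketE K K' x).symm)

theorem existsUnique_isCurvature :
    ∃! Φ : ∀ x, TangentSpace 𝓘(ℝ, EX) x →ₗ[ℝ] TangentSpace 𝓘(ℝ, EX) x →ₗ[ℝ] D.LFiber x,
      H.IsCurvature Φ := by
  refine ⟨H.curvature, H.isCurvature_curvature, fun Φ h => ?_⟩
  funext x
  refine LinearMap.ext fun u => LinearMap.ext fun v => ?_
  have h1 := h.apply_field (H.horizontalLift x u) (H.horizontalLift x v) x
  rw [H.field_horizontalLift, H.field_horizontalLift] at h1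
  exact h1

end AdmissibleHamiltonian

end LagrangianInLeaf

end Setting

/-! ### Push-forward of bivector fields along diffeomorphisms. -/

section Pushforward

variable {E H M E' H' M' : Type*} [NormedAddCommGroup E] [NormedSpace ℝ E]
  [TopologicalSpace H] {I : ModelWithCorners ℝ E H} [TopologicalSpace M] [ChartedSpace H M]
  [NormedAddCommGroup E'] [NormedSpace ℝ E'] [TopologicalSpace H'] {J : ModelWithCorners ℝ E' H'}
  [TopologicalSpace M'] [ChartedSpace H' M']

/-- The push-forward of `w♯` along a diffeomorphism. -/
def pushforwardSharp (Ψ : Diffeomorph I J M M' ∞) (w : BivectorField I M) (q : M') :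
    (TangentSpace J q →L[ℝ] ℝ) →ₗ[ℝ] TangentSpace J q :=
  let A : TangentSpace I (Ψ.symm q) →L[ℝ] TangentSpace J q := mfderiv I J Ψ (Ψ.symm q)
  { toFun := fun b => A (w.sharp (Ψ.symm q) (b.comp A))
    map_add' := fun b b' => by rw [ContinuousLinearMap.add_comp, map_add, map_add]
    map_smul' := fun c b => by
      rw [ContinuousLinearMap.smul_comp, map_smul, map_smul, RingHom.id_apply] }

theorem pushforwardSharp_apply (Ψ : Diffeomorph I J M M' ∞) (w : BivectorField I M) (t : M)
    (b : TangentSpace J (Ψ t) →L[ℝ] ℝ) :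
    pushforwardSharp Ψ w (Ψ t) b =
      mfderiv I J Ψ t (w.sharp t (b.comp (mfderiv I J Ψ t))) := by
  have key : ∀ t' : M, t' = t →
      (mfderiv I J Ψ t' (w.sharp t' (ContinuousLinearMap.comp (M₂ := E') b (mfderiv I J Ψ t'))) : E') =
        mfderiv I J Ψ t (w.sharp t (b.comp (mfderiv I J Ψ t))) := by
    rintro _ rfl
    rfl
  exact key _ (Ψ.symm_apply_apply t)

/-- The push-forward of a bivector field along a diffeomorphism. -/
def BivectorField.pushforward (Ψ : Diffeomorph I J M M' ∞) (w : BivectorField I M) :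
    BivectorField J M' where
  sharp := pushforwardSharp Ψ w
  skew q b := by
    obtain ⟨t, rfl⟩ : ∃ t, Ψ t = q := ⟨_, Ψ.apply_symm_apply q⟩
    rw [pushforwardSharp_apply]
    exact w.skew t (b.comp (mfderiv I J Ψ t))
  smooth f g := by
    let c : C^∞⟮I, M; J, M'⟯ := ⟨Ψ, Ψ.contMDiff⟩
    refine ((w.smooth (f.comp c) (g.comp c)).comp Ψ.symm.contMDiff).congr fun q => ?_
    obtain ⟨t, rfl⟩ : ∃ t, Ψ t = q := ⟨_, Ψ.apply_symm_apply q⟩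
    have hd : ∀ f : C^∞⟮J, M'; 𝓘(ℝ, ℝ), ℝ⟯, differential I (f.comp c) t =
        (differential J f (Ψ t)).comp (mfderiv I J Ψ t) := fun f =>
      differential_comp (f.mdiffAt _) (Ψ.contMDiff.mdifferentiable (by simp) t)
    rw [Function.comp_apply, Ψ.symm_apply_apply, hd, hd, pushforwardSharp_apply]
    rfl

theorem BivectorField.isPushforward_pushforward (Ψ : Diffeomorph I J M M' ∞)
    (w : BivectorField I M) : IsPushforward Ψ w (w.pushforward Ψ) :=
  pushforwardSharp_apply Ψ w

theorem existsUnique_isPushforward (Ψ : Diffeomorph I J M M' ∞) (w : BivectorField I M) :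
    ∃! w' : BivectorField J M', IsPushforward Ψ w w' := by
  refine ⟨_, w.isPushforward_pushforward Ψ, fun w' h => ?_⟩
  have hs : w'.sharp = (w.pushforward Ψ).sharp := by
    funext q
    obtain ⟨t, rfl⟩ : ∃ t, Ψ t = q := ⟨_, Ψ.apply_symm_apply q⟩
    exact LinearMap.ext fun b => (h t b).trans (w.isPushforward_pushforward Ψ t b).symm
  obtain ⟨s, _, _⟩ := w'
  subst hs
  rfl

end Pushforward

/-! ### The horizontal lift to `L_X*`. -/

section Setting

universe uS
variable {EZ Z ES : Type*} {S : Type uS} {EX X : Type*}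
  [NormedAddCommGroup EZ] [NormedSpace ℝ EZ] [FiniteDimensional ℝ EZ]
  [TopologicalSpace Z] [ChartedSpace EZ Z] [IsManifold 𝓘(ℝ, EZ) ∞ Z] [T2Space Z]
  [NormedAddCommGroup ES] [NormedSpace ℝ ES] [FiniteDimensional ℝ ES]
  [TopologicalSpace S] [ChartedSpace ES S] [IsManifold 𝓘(ℝ, ES) ∞ S]
  [NormedAddCommGroup EX] [NormedSpace ℝ EX] [FiniteDimensional ℝ EX]
  [TopologicalSpace X] [ChartedSpace EX X] [IsManifold 𝓘(ℝ, EX) ∞ X] [T2Space X]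

namespace LagrangianInLeaf

variable {D : LagrangianInLeaf EZ Z ES S EX X}

variable (D) in
/-- The function `f ∘ π + bar G` on `L_X*`. -/
def leafSymbol (f : C^∞⟮𝓘(ℝ, EX), X; 𝓘(ℝ, ℝ), ℝ⟯) (G : D.leaf.vanishing) :
    C^∞⟮D.ILStar, D.LStar; 𝓘(ℝ, ℝ), ℝ⟯ :=
  basePullback (F := D.leaf.NormalFiber) (V := D.LDual) f + D.barL G

theorem differential_leafSymbol (f : C^∞⟮𝓘(ℝ, EX), X; 𝓘(ℝ, ℝ), ℝ⟯) (G : D.leaf.vanishing)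
    (n : D.LStar) : differential D.ILStar (D.leafSymbol f G) n =
      differential D.ILStar (basePullback (F := D.leaf.NormalFiber) (V := D.LDual) f) n +
        differential D.ILStar (D.barL G) n :=
  map_add (differentialAt D.ILStar n) (basePullback (F := D.leaf.NormalFiber) (V := D.LDual) f)
    (D.barL G)

theorem exists_differential_leafSymbol_eq (n : D.LStar) (b : TangentSpace D.ILStar n →L[ℝ] ℝ) :
    ∃ f G, differential D.ILStar (D.leafSymbol f G) n = b := by
  obtain ⟨f, G, h⟩ := D.exists_differential_eq_add_barL n b
  exact ⟨f, G, (differential_leafSymbol f G n).trans h.symm⟩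

theorem differential_leafSymbol_comp (f : C^∞⟮𝓘(ℝ, EX), X; 𝓘(ℝ, ℝ), ℝ⟯) (G : D.leaf.vanishing)
    (t : D.EStar) :
    (differential D.ILStar (D.leafSymbol f G) (D.toLStar t)).comp
        (mfderiv D.IEStar D.ILStar D.toLStar t) =
      differential D.IEStar (D.exactSymbol (f, D.leafToIncl G)) t := by
  refine (differential_comp ((D.leafSymbol f G).mdiffAt _)
    (D.contMDiff_toLStar.mdifferentiable (by simp) t)).symm.trans ?_
  exact congrArg (fun g : D.EStar → ℝ => differential D.IEStar g t)
    (funext fun s => congrArg (f s.1 + ·) (D.barL_toLStar G s))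

variable (D) in
/-- The bracket with a function, on the functions that vanish on the leaf. -/
def leafBracket (G : D.leaf.vanishing) (F : C^∞⟮𝓘(ℝ, EZ), Z; 𝓘(ℝ, ℝ), ℝ⟯) : D.leaf.vanishing :=
  ⟨D.w.bracketMap G.1 F, D.bracketMap_mem_vanishing_leaf G.2 F⟩

theorem leafToIncl_leafBracket (G : D.leaf.vanishing) (F : D.incl.vanishing) :
    D.leafToIncl (D.leafBracket G F.1) = D.bracketE (D.leafToIncl G) F := rfl

/-- Only the vertical part of `β` enters: a summand from the base is paired with the anchor of `dG`,
which is zero for `G` vanishing on the leaf. The right side depends on `t` only through its image in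
`L_X*`. Hence the lift is tensorial in `U` and descends to `L_X*`. -/
theorem IsSternbergWeinstein.leafSymbol_sharp {w' : BivectorField D.IEStar D.EStar}
    (h : D.IsSternbergWeinstein w') {t : D.EStar} {β : TangentSpace D.IEStar t →L[ℝ] ℝ}
    {K : D.incl.vanishing} (hβ : verticalPart t β = D.incl.pairingL t.1 (D.dE t.1 K))
    (f : C^∞⟮𝓘(ℝ, EX), X; 𝓘(ℝ, ℝ), ℝ⟯) (G : D.leaf.vanishing) :
    differential D.ILStar (D.leafSymbol f G) (D.toLStar t)
        (-mfderiv D.IEStar D.ILStar D.toLStar t (w'.sharp t β)) =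
      differential 𝓘(ℝ, EX) f t.1 (D.field K t.1) -
        D.barL (D.leafBracket G K.1) (D.toLStar t) := by
  obtain ⟨g, hg⟩ := exists_eq_differential_add β (differential D.IEStar (D.incl.barMap K) t)
    ((D.incl.verticalPart_barMap K t).trans hβ.symm)
  have hg' : β = differential D.IEStar (D.exactSymbol (g, K)) t :=
    hg.trans (D.incl.covector_apply t g (D.incl.exactConormal K)).symm
  have h1 := h.apply_sharp t (f, D.leafToIncl G) (g, K)
  rw [← hg', ← differential_leafSymbol_comp, exactBracket_apply] at h1
  have h2 : differential 𝓘(ℝ, EX) g t.1 (D.anchor t.1 (D.dE t.1 (D.leafToIncl G))) = 0 := by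
    rw [D.anchor_leafToIncl, map_zero]
  have h3 := D.barL_toLStar (D.leafBracket G K.1) t
  rw [leafToIncl_leafBracket] at h3
  have h4 : D.barL (D.leafBracket G K.1) (D.toLStar t) =
    D.incl.pairing t.1 (D.dE t.1 (D.bracketE (D.leafToIncl G) K)) t.2 := h3
  refine (map_neg (differential D.ILStar (D.leafSymbol f G) (D.toLStar t)) _).trans ?_
  refine (congrArg Neg.neg h1).trans ?_
  rw [h2, h4]
  change -(0 - differential 𝓘(ℝ, EX) f t.1 (D.field K t.1) + _) = _
  ring

namespace AdmissibleHamiltonian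

variable (H : D.AdmissibleHamiltonian)

theorem verticalPart_bar_alpha (U : VField 𝓘(ℝ, EX) X) (t : D.EStar) :
    verticalPart t (differential D.IEStar (D.bar fun x => H.alpha x (U x)) t) =
      D.incl.pairingL t.1 (H.alpha t.1 (U t.1)) :=
  verticalPart_differential (H.mdifferentiableAt_bar_alpha U t) _ 0 fun _ => (add_zero _).symm

theorem dE_eq_alpha {K : H.horizontal} {x : X} {u : TangentSpace 𝓘(ℝ, EX) x}
    (h : D.field K.1 x = u) : D.dE x K.1 = H.alpha x u := by
  rw [← h, H.alpha_field]

theorem exists_horLift {w' : BivectorField D.IEStar D.EStar} (h : D.IsSternbergWeinstein w')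
    (n : D.LStar) :
    ∃ L : TangentSpace 𝓘(ℝ, EX) n.1 →ₗ[ℝ] TangentSpace D.ILStar n, ∀ (K : H.horizontal) f G,
      differential D.ILStar (D.leafSymbol f G) n (L (D.field K.1 n.1)) =
        differential 𝓘(ℝ, EX) f n.1 (D.field K.1 n.1) - D.barL (D.leafBracket G K.1.1) n := by
  obtain ⟨t, rfl⟩ := D.toLStar_surjective n
  refine ⟨-((mfderiv D.IEStar D.ILStar D.toLStar t).toLinearMap ∘ₗ w'.sharp t ∘ₗ
    differentialAt D.IEStar t ∘ₗ D.incl.barMap ∘ₗ H.horizontal.subtype ∘ₗ H.horizontalLift t.1),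
    fun K f G => ?_⟩
  refine h.leafSymbol_sharp (K := K.1) ?_ f G
  refine (D.incl.verticalPart_barMap _ t).trans (congrArg _ ?_)
  -- The chosen lift of the field of `K` may differ from `K`, but both are horizontal with the same
  -- vector at the point, hence have the same differential there.
  exact (H.dE_eq_alpha (H.field_horizontalLift t.1 (D.field K.1 t.1))).trans (H.alpha_field K t.1)

variable {H}

theorem IsHor.apply {w' : BivectorField D.IEStar D.EStar} (h : D.IsSternbergWeinstein w')
    {hor : ∀ n : D.LStar, TangentSpace 𝓘(ℝ, EX) n.1 →ₗ[ℝ] TangentSpace D.ILStar n}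
    (hh : H.IsHor w' hor) (n : D.LStar) (K : H.horizontal) (f : C^∞⟮𝓘(ℝ, EX), X; 𝓘(ℝ, ℝ), ℝ⟯)
    (G : D.leaf.vanishing) :
    differential D.ILStar (D.leafSymbol f G) n (hor n (D.field K.1 n.1)) =
      differential 𝓘(ℝ, EX) f n.1 (D.field K.1 n.1) - D.barL (D.leafBracket G K.1.1) n := by
  obtain ⟨t, rfl⟩ := D.toLStar_surjective n
  refine (congrArg _ (hh (D.field K.1) t)).trans ?_
  refine h.leafSymbol_sharp (K := K.1) ?_ f G
  exact (H.verticalPart_bar_alpha _ t).trans (congrArg _ (H.alpha_field K t.1))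

/-- An arbitrary field `U` is replaced at each point by a horizontal function with the same value,
because `bar (α_H U)` and `bar dK` then have the same vertical part. -/
theorem isHor_of_apply {w' : BivectorField D.IEStar D.EStar} (h : D.IsSternbergWeinstein w')
    {hor : ∀ n : D.LStar, TangentSpace 𝓘(ℝ, EX) n.1 →ₗ[ℝ] TangentSpace D.ILStar n}
    (hh : ∀ n (K : H.horizontal) f G,
      differential D.ILStar (D.leafSymbol f G) n (hor n (D.field K.1 n.1)) =
        differential 𝓘(ℝ, EX) f n.1 (D.field K.1 n.1) - D.barL (D.leafBracket G K.1.1) n) :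
    H.IsHor w' hor := by
  intro U t
  obtain ⟨K, hK⟩ := H.exists_horizontal t.1 (U t.1)
  refine tangent_ext fun b => ?_
  obtain ⟨f, G, rfl⟩ := exists_differential_leafSymbol_eq _ b
  have h1 := h.leafSymbol_sharp (K := K.1) ((H.verticalPart_bar_alpha U t).trans
    (congrArg _ (H.dE_eq_alpha hK).symm)) f G
  refine Eq.trans ?_ h1.symm
  refine Eq.trans ?_ (hh (D.toLStar t) K f G)
  exact congrArg (fun u => differential D.ILStar (D.leafSymbol f G) (D.toLStar t)
    (hor (D.toLStar t) u)) hK.symm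

theorem existsUnique_isHor {w' : BivectorField D.IEStar D.EStar} (h : D.IsSternbergWeinstein w') :
    ∃! hor, H.IsHor w' hor := by
  choose hor hhor using H.exists_horLift h
  have h0 := isHor_of_apply h hhor
  refine ⟨hor, h0, fun hor' h' => funext fun n => LinearMap.ext fun u => tangent_ext fun b => ?_⟩
  obtain ⟨K, rfl⟩ := H.exists_horizontal n.1 u
  obtain ⟨f, G, rfl⟩ := exists_differential_leafSymbol_eq n b
  exact (h'.apply h n K f G).trans (h0.apply h n K f G).symm

end AdmissibleHamiltonian

end LagrangianInLeaf

end Setting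

/-! ### Auxiliary linear maps on covectors. -/

section Linear

theorem ContinuousLinearMap.add_apply_map_add {V : Type*} [NormedAddCommGroup V] [NormedSpace ℝ V]
    (S : (V →L[ℝ] ℝ) →L[ℝ] V) (a b a' b' : V →L[ℝ] ℝ) :
    (a + b) (S (a' + b')) = a (S a') + a (S b') + (b (S a') + b (S b')) := by
  rw [map_add, _root_.add_apply, map_add, map_add]

/-- The evaluation of covectors at a tangent vector. -/
def evalCovector {E M : Type*} [NormedAddCommGroup E] [NormedSpace ℝ E] [TopologicalSpace M]
    [ChartedSpace E M] (p : M) (u : TangentSpace 𝓘(ℝ, E) p) :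
    (TangentSpace 𝓘(ℝ, E) p →L[ℝ] ℝ) →L[ℝ] ℝ :=
  (ContinuousLinearMap.apply ℝ ℝ (show E from u) : (E →L[ℝ] ℝ) →L[ℝ] ℝ)

end Linear

/-! ### The lift to `L_X^π` and covectors adapted to it. -/

section Setting

universe uS
variable {EZ Z ES : Type*} {S : Type uS} {EX X : Type*}
  [NormedAddCommGroup EZ] [NormedSpace ℝ EZ] [FiniteDimensional ℝ EZ]
  [TopologicalSpace Z] [ChartedSpace EZ Z] [IsManifold 𝓘(ℝ, EZ) ∞ Z] [T2Space Z]
  [NormedAddCommGroup ES] [NormedSpace ℝ ES] [FiniteDimensional ℝ ES]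
  [TopologicalSpace S] [ChartedSpace ES S] [IsManifold 𝓘(ℝ, ES) ∞ S]
  [NormedAddCommGroup EX] [NormedSpace ℝ EX] [FiniteDimensional ℝ EX]
  [TopologicalSpace X] [ChartedSpace EX X] [IsManifold 𝓘(ℝ, EX) ∞ X] [T2Space X]

namespace LagrangianInLeaf

variable {D : LagrangianInLeaf EZ Z ES S EX X}

theorem mfderiv_pr₁_apply (q : D.LPi) (Y : EX × ((EX →L[ℝ] ℝ) × D.leaf.NormalFiber)) :
    (mfderiv D.ILPi D.ICot D.pr₁ q Y : EX × (EX →L[ℝ] ℝ)) = (Y.1, Y.2.1) := by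
  let L : (EX × ((EX →L[ℝ] ℝ) × D.leaf.NormalFiber)) →L[ℝ] EX × (EX →L[ℝ] ℝ) :=
    (ContinuousLinearMap.id ℝ EX).prodMap (ContinuousLinearMap.fst ℝ _ _)
  refine (mfderiv_apply_of_chart (J := D.ICot) (q := D.pr₁ q) rfl
    (D.contMDiff_pr₁.mdifferentiable (by simp) q)
    (g := fun q' => L (extChartAt D.ILPi q q')) (.of_forall fun q' => ?_) Y).trans
    (valueDeriv_comp_extChartAt L q Y)
  rw [extChartAt_totalSpace_apply, extChartAt_totalSpace_apply]
  rfl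

theorem mfderiv_pr₂_apply (q : D.LPi) (Y : EX × ((EX →L[ℝ] ℝ) × D.leaf.NormalFiber)) :
    (mfderiv D.ILPi D.ILStar D.pr₂ q Y : EX × D.leaf.NormalFiber) = (Y.1, Y.2.2) := by
  let L : (EX × ((EX →L[ℝ] ℝ) × D.leaf.NormalFiber)) →L[ℝ] EX × D.leaf.NormalFiber :=
    (ContinuousLinearMap.id ℝ EX).prodMap (ContinuousLinearMap.snd ℝ _ _)
  refine (mfderiv_apply_of_chart (J := D.ILStar) (q := D.pr₂ q) rfl
    (D.contMDiff_pr₂.mdifferentiable (by simp) q)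
    (g := fun q' => L (extChartAt D.ILPi q q')) (.of_forall fun q' => ?_) Y).trans
    (valueDeriv_comp_extChartAt L q Y)
  rw [extChartAt_totalSpace_apply, extChartAt_totalSpace_apply]
  rfl

theorem barL_zero : D.barL 0 = 0 := ContMDiffMap.ext fun n => by
  rw [barL_apply, map_zero, map_zero]
  rfl

theorem leafBracket_zero (F : C^∞⟮𝓘(ℝ, EZ), Z; 𝓘(ℝ, ℝ), ℝ⟯) : D.leafBracket 0 F = 0 :=
  Subtype.ext (LinearMap.map_zero₂ D.w.bracketₗ F)

/-- For `G = 0` the formula for `hor` reduces to the action of `u` on functions of the base, so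
`hor` lifts `u`. -/
theorem AdmissibleHamiltonian.IsHor.mfderiv_proj {H : D.AdmissibleHamiltonian}
    {w' : BivectorField D.IEStar D.EStar} (h : D.IsSternbergWeinstein w')
    {hor : ∀ n : D.LStar, TangentSpace 𝓘(ℝ, EX) n.1 →ₗ[ℝ] TangentSpace D.ILStar n}
    (hh : H.IsHor w' hor) (n : D.LStar) (u : TangentSpace 𝓘(ℝ, EX) n.1) :
    mfderiv D.ILStar 𝓘(ℝ, EX) (TotalSpace.proj : D.LStar → X) n (hor n u) = u := by
  refine mfderiv_proj_eq_of_basePullback fun f => ?_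
  obtain ⟨K, rfl⟩ := H.exists_horizontal n.1 u
  have h1 := hh.apply h n K f 0
  have h2 : D.leafSymbol f 0 = basePullback (F := D.leaf.NormalFiber) (V := D.LDual) f := by
    unfold leafSymbol
    rw [barL_zero, add_zero]
  rw [leafBracket_zero, barL_zero, h2] at h1
  exact h1.trans (sub_zero (G := ℝ) _)

/-- The horizontal lift from `T*X` to `L_X^π`. -/
def horPiLift (hor : ∀ n : D.LStar, TangentSpace 𝓘(ℝ, EX) n.1 →ₗ[ℝ] TangentSpace D.ILStar n)
    (q : D.LPi) : TangentSpace D.ICot (D.pr₁ q) →L[ℝ] TangentSpace D.ILPi q :=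
  let h : EX →ₗ[ℝ] EX × D.leaf.NormalFiber := hor (D.pr₂ q)
  let h' : EX →L[ℝ] D.leaf.NormalFiber :=
    LinearMap.toContinuousLinearMap (LinearMap.snd ℝ EX D.leaf.NormalFiber ∘ₗ h)
  show EX × (EX →L[ℝ] ℝ) →L[ℝ] EX × ((EX →L[ℝ] ℝ) × D.leaf.NormalFiber) from
    (ContinuousLinearMap.fst ℝ _ _).prod
      ((ContinuousLinearMap.snd ℝ _ _).prod (h' ∘L ContinuousLinearMap.fst ℝ _ _))

/-- In the chart, `pr₁` fixes the base and cotangent components and `pr₂` the base and `L_X*`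
components. The base component is prescribed twice, consistently because `hor` projects to the
identity. -/
theorem existsUnique_isHorPi
    {hor : ∀ n : D.LStar, TangentSpace 𝓘(ℝ, EX) n.1 →ₗ[ℝ] TangentSpace D.ILStar n}
    (hproj : ∀ n u, mfderiv D.ILStar 𝓘(ℝ, EX) (TotalSpace.proj : D.LStar → X) n (hor n u) = u) :
    ∃! horPi, D.IsHorPi hor horPi := by
  refine ⟨horPiLift hor, fun q Y => ⟨?_, ?_⟩, fun horPi h => ?_⟩
  · exact mfderiv_pr₁_apply q (horPiLift hor q Y)
  · refine (mfderiv_pr₂_apply q (horPiLift hor q Y)).trans ?_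
    have h1 : (mfderiv D.ICot 𝓘(ℝ, EX) (TotalSpace.proj : CotangentSpace 𝓘(ℝ, EX) X → X)
      (D.pr₁ q) Y : EX) = (Y : EX × (EX →L[ℝ] ℝ)).1 := mfderiv_proj_apply _ Y
    have h2 : (hor (D.pr₂ q) (Y : EX × (EX →L[ℝ] ℝ)).1 : EX × D.leaf.NormalFiber).1 =
      (Y : EX × (EX →L[ℝ] ℝ)).1 := (mfderiv_proj_apply _ _).symm.trans (hproj (D.pr₂ q) _)
    refine Eq.trans ?_ (congrArg (hor (D.pr₂ q)) h1).symm
    exact Prod.ext h2.symm rfl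
  · funext q
    refine ContinuousLinearMap.ext fun Y => ?_
    have h1 := (mfderiv_pr₁_apply q (horPi q Y)).symm.trans (h q Y).1
    have h2 := (mfderiv_pr₂_apply q (horPi q Y)).symm.trans (h q Y).2
    have h3 : (mfderiv D.ICot 𝓘(ℝ, EX) (TotalSpace.proj : CotangentSpace 𝓘(ℝ, EX) X → X)
      (D.pr₁ q) Y : EX) = (Y : EX × (EX →L[ℝ] ℝ)).1 := mfderiv_proj_apply _ Y
    have h4 := h2.trans (congrArg (hor (D.pr₂ q)) h3)
    have key : ∀ A B : EX × ((EX →L[ℝ] ℝ) × D.leaf.NormalFiber), A.1 = B.1 → A.2.1 = B.2.1 →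
        A.2.2 = B.2.2 → A = B := fun A B h h' h'' => Prod.ext h (Prod.ext h' h'')
    exact key _ _ (congrArg (Prod.fst : EX × (EX →L[ℝ] ℝ) → EX) h1)
      (congrArg (Prod.snd : EX × (EX →L[ℝ] ℝ) → (EX →L[ℝ] ℝ)) h1)
      (congrArg (Prod.snd : EX × D.leaf.NormalFiber → D.leaf.NormalFiber) h4)

namespace AdmissibleHamiltonian

variable (H : D.AdmissibleHamiltonian)

/-- The differential of the function on `L_X^π` given by the momentum of the vector field of `K`
and by `f ∘ π + bar G`. -/
def piCovector (q : D.LPi) (f : C^∞⟮𝓘(ℝ, EX), X; 𝓘(ℝ, ℝ), ℝ⟯) (K : H.horizontal)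
    (G : D.leaf.vanishing) : TangentSpace D.ILPi q →L[ℝ] ℝ :=
  (differential D.ICot (momentum fun x => D.field K.1 x) (D.pr₁ q)).comp
      (mfderiv D.ILPi D.ICot D.pr₁ q) +
    (differential D.ILStar (D.leafSymbol f G) (D.pr₂ q)).comp (mfderiv D.ILPi D.ILStar D.pr₂ q)

theorem mdifferentiableAt_momentum_field (K : D.incl.vanishing) (ξ : CotangentSpace 𝓘(ℝ, EX) X) :
    MDifferentiableAt D.ICot 𝓘(ℝ, ℝ) (momentum fun x => D.field K x) ξ :=
  (contMDiffAt_momentum (VField.contMDiffAt_vecCoord (D.field K) _)).mdifferentiableAt (by simp)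

theorem verticalPart_momentum_pr₁ (K : D.incl.vanishing) (q : D.LPi) :
    verticalPart q ((differential D.ICot (momentum fun x => D.field K x) (D.pr₁ q)).comp
      (mfderiv D.ILPi D.ICot D.pr₁ q)) =
      evalCovector q.1 (D.field K q.1) ∘L
      ContinuousLinearMap.fst ℝ (TangentSpace 𝓘(ℝ, EX) q.1 →L[ℝ] ℝ) (D.LDual q.1) := by
  have h1 := differential_comp (mdifferentiableAt_momentum_field K (D.pr₁ q))
    (D.contMDiff_pr₁.mdifferentiable (by simp) q)
  rw [← h1]
  refine verticalPart_differential ?_ _ 0 fun v => (add_zero _).symm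
  exact MDifferentiableAt.comp q (mdifferentiableAt_momentum_field K (D.pr₁ q))
    (D.contMDiff_pr₁.mdifferentiable (by simp) q)

theorem verticalPart_barL_pr₂ (G : D.leaf.vanishing) (q : D.LPi) :
    verticalPart q ((differential D.ILStar (D.barL G) (D.pr₂ q)).comp
      (mfderiv D.ILPi D.ILStar D.pr₂ q)) =
      (D.leaf.pairingL (D.lag.map q.1) (D.leaf.dConormal (D.lag.map q.1) G)) ∘L
      ContinuousLinearMap.snd ℝ (TangentSpace 𝓘(ℝ, EX) q.1 →L[ℝ] ℝ) (D.LDual q.1) := by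
  have h1 := differential_comp ((D.barL G).mdiffAt (D.pr₂ q))
    (D.contMDiff_pr₂.mdifferentiable (by simp) q)
  rw [← h1]
  refine verticalPart_differential ?_ _ 0 fun v => (add_zero _).symm
  exact MDifferentiableAt.comp q ((D.barL G).mdiffAt (D.pr₂ q))
    (D.contMDiff_pr₂.mdifferentiable (by simp) q)

theorem apply_cotangentPart (q : D.LPi) (a : TangentSpace D.ILPi q →L[ℝ] ℝ)
    (c : TangentSpace 𝓘(ℝ, EX) q.1 →L[ℝ] ℝ) :
    c (D.cotangentPart q a) = verticalPart q a (c, 0) :=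
  (Module.apply_evalEquiv_symm_apply (R := ℝ) (M := TangentSpace 𝓘(ℝ, EX) q.1) c.toLinearMap _).trans
    (congrArg (fun c' : TangentSpace 𝓘(ℝ, EX) q.1 →L[ℝ] ℝ => verticalPart q a (c', 0))
      (ContinuousLinearMap.ext fun _ => rfl))

/-- `K` is chosen to match the `T_x X` part and `G` the `L_x` part. This settles the vertical part
of `a`, and the rest comes from a function `f` on the base. -/
theorem exists_piCovector_eq (q : D.LPi) (a : TangentSpace D.ILPi q →L[ℝ] ℝ) :
    ∃ f K G, a = H.piCovector q f K G ∧ D.cotangentPart q a = D.field K.1 q.1 ∧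
      D.isotropyPart q a = D.leaf.dConormal (D.lag.map q.1) G := by
  obtain ⟨K, hK⟩ := H.exists_horizontal q.1 (D.cotangentPart q a)
  obtain ⟨G, hG⟩ := D.dL_surjective q.1 (D.isotropyPart q a)
  have hv : verticalPart q ((differential D.ICot (momentum fun x => D.field K.1 x) (D.pr₁ q)).comp
      (mfderiv D.ILPi D.ICot D.pr₁ q) + (differential D.ILStar (D.barL G) (D.pr₂ q)).comp
      (mfderiv D.ILPi D.ILStar D.pr₂ q)) = verticalPart q a := by
    refine ContinuousLinearMap.ext fun v => ?_
    have h1 := DFunLike.congr_fun (verticalPart_momentum_pr₁ K.1 q) v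
    have h2 := DFunLike.congr_fun (verticalPart_barL_pr₂ G q) v
    refine (congrArg₂ (· + ·) h1 h2).trans ?_
    have h3 : v.1 (D.field K.1 q.1) = verticalPart q a (v.1, 0) :=
      (congrArg v.1 hK).trans (apply_cotangentPart q a v.1)
    have h4 : D.leaf.pairingL (D.lag.map q.1) (D.leaf.dConormal (D.lag.map q.1) G) v.2 =
        verticalPart q a (0, v.2) := by
      rw [hG]
      exact DFunLike.congr_fun (D.leaf.pairingL_toConormal (D.lag.map q.1) _) v.2
    refine (congrArg₂ (· + ·) h3 h4).trans ?_
    refine (map_add (verticalPart q a) _ _).symm.trans (congrArg _ ?_)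
    exact Prod.ext (add_zero _) (zero_add _)
  obtain ⟨f, hf⟩ := exists_eq_differential_add a _ hv
  refine ⟨f, K, G, hf.trans ?_, hK.symm, hG.symm⟩
  have h5 := differential_comp
    ((basePullback (F := D.leaf.NormalFiber) (V := D.LDual) f).mdiffAt (D.pr₂ q))
    (D.contMDiff_pr₂.mdifferentiable (by simp) q)
  unfold piCovector
  rw [differential_leafSymbol, ContinuousLinearMap.add_comp]
  refine (congrArg (· + _) h5).trans ?_
  abel

/-- Under `ψ_H` the momentum of the field of `K` becomes `bar dK` and the function of `G` becomes
`bar dG`. So covectors of `L_X^π` turn into exact symbols, whose brackets are known. -/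
theorem piCovector_comp_psi (t : D.EStar) (f : C^∞⟮𝓘(ℝ, EX), X; 𝓘(ℝ, ℝ), ℝ⟯) (K : H.horizontal)
    (G : D.leaf.vanishing) :
    (H.piCovector (H.psi t) f K G).comp (mfderiv D.IEStar D.ILPi H.psi t) =
      differential D.IEStar (D.exactSymbol (f, K.1 + D.leafToIncl G)) t := by
  have hψ := H.contMDiff_psi.mdifferentiable (by simp) t
  have h1 := mfderiv_comp t (g := D.pr₁) (f := H.psi)
    (D.contMDiff_pr₁.mdifferentiable (by simp) (H.psi t)) hψ
  have h2 : mfderiv D.IEStar D.ILStar D.toLStar t = _ := mfderiv_comp t (g := D.pr₂) (f := H.psi)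
    (D.contMDiff_pr₂.mdifferentiable (by simp) (H.psi t)) hψ
  have h3 := differential_comp (f := momentum fun x => D.field K.1 x)
    (g := fun s => D.pr₁ (H.psi s)) (mdifferentiableAt_momentum_field K.1 (D.pr₁ (H.psi t)))
    (H.contMDiff_pr₁_psi.mdifferentiable (by simp) t)
  have h4 : (fun s => momentum (fun x => D.field K.1 x) (D.pr₁ (H.psi s))) =
      D.exactSymbol (0, K.1) :=
    funext fun s => (H.momentum_field_pr₁_psi K s).trans (zero_add _).symm
  have h5 := differential_leafSymbol_comp f G t
  rw [h2] at h5
  have h6 := map_add (differentialAt D.IEStar t ∘ₗ D.exactSymbol) (0, K.1) (f, D.leafToIncl G)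
  have h7 : ((0, K.1) + (f, D.leafToIncl G) : C^∞⟮𝓘(ℝ, EX), X; 𝓘(ℝ, ℝ), ℝ⟯ × D.incl.vanishing) =
    (f, K.1 + D.leafToIncl G) := Prod.ext (zero_add _) rfl
  rw [h7] at h6
  refine Eq.trans ?_ h6.symm
  refine Eq.trans ?_ (congrArg₂ (· + ·) (h3.symm.trans
    (congrArg (fun g : D.EStar → ℝ => differential D.IEStar g t) h4)) h5)
  refine (ContinuousLinearMap.add_comp _ _ _).trans (congrArg₂ (· + ·) ?_ rfl)
  exact congrArg (fun A => ContinuousLinearMap.comp (differential D.ICot (momentum fun x =>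
    D.field K.1 x) (D.pr₁ (H.psi t))) A) h1.symm

variable {H}

/-- The momentum part is unchanged because `pr₁` undoes the lift; the part on `L_X*` sees only the
base component and becomes a covector `c` of `X`. -/
theorem piCovector_comp_horPi
    {hor : ∀ n : D.LStar, TangentSpace 𝓘(ℝ, EX) n.1 →ₗ[ℝ] TangentSpace D.ILStar n}
    {horPi : ∀ q : D.LPi, TangentSpace D.ICot (D.pr₁ q) →L[ℝ] TangentSpace D.ILPi q}
    (h : D.IsHorPi hor horPi) (q : D.LPi) (f : C^∞⟮𝓘(ℝ, EX), X; 𝓘(ℝ, ℝ), ℝ⟯) (K : H.horizontal)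
    (G : D.leaf.vanishing) :
    ∃ c : TangentSpace 𝓘(ℝ, EX) (D.pr₁ q).1 →L[ℝ] ℝ,
      (∀ u, c u = differential D.ILStar (D.leafSymbol f G) (D.pr₂ q) (hor (D.pr₂ q) u)) ∧
      (H.piCovector q f K G).comp (horPi q) =
        differential D.ICot (momentum fun x => D.field K.1 x) (D.pr₁ q) +
          c.comp (mfderiv D.ICot 𝓘(ℝ, EX) (TotalSpace.proj : CotangentSpace 𝓘(ℝ, EX) X → X)
            (D.pr₁ q)) := by
  refine ⟨LinearMap.toContinuousLinearMap
    ((differential D.ILStar (D.leafSymbol f G) (D.pr₂ q)).toLinearMap ∘ₗ hor (D.pr₂ q)),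
    fun u => rfl, ContinuousLinearMap.ext fun Y => ?_⟩
  exact congrArg₂ (· + ·)
    (congrArg (differential D.ICot (momentum fun x => D.field K.1 x) (D.pr₁ q)) (h q Y).1)
    (congrArg (differential D.ILStar (D.leafSymbol f G) (D.pr₂ q)) (h q Y).2)

/-- The restricted covectors have the form `d(momentum) + π*c`. Two momenta give the momentum of the
Lie bracket, a momentum and `π*c'` give `c'` on the field, and two covectors from the base give
zero. -/
theorem liftedCanonicalTensor_piCovector {w' : BivectorField D.IEStar D.EStar}
    (hw : D.IsSternbergWeinstein w')
    {hor : ∀ n : D.LStar, TangentSpace 𝓘(ℝ, EX) n.1 →ₗ[ℝ] TangentSpace D.ILStar n}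
    (hh : H.IsHor w' hor)
    {horPi : ∀ q : D.LPi, TangentSpace D.ICot (D.pr₁ q) →L[ℝ] TangentSpace D.ILPi q}
    (h : D.IsHorPi hor horPi) (q : D.LPi) (f f' : C^∞⟮𝓘(ℝ, EX), X; 𝓘(ℝ, ℝ), ℝ⟯)
    (K K' : H.horizontal) (G G' : D.leaf.vanishing) :
    D.liftedCanonicalTensor horPi q (H.piCovector q f K G) (H.piCovector q f' K' G') =
      q.2.1 (D.anchor q.1 (D.dE q.1 (D.bracketE K.1 K'.1))) +
      (differential 𝓘(ℝ, EX) f' q.1 (D.field K.1 q.1) - D.barL (D.leafBracket G' K.1.1) (D.pr₂ q)) -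
      (differential 𝓘(ℝ, EX) f q.1 (D.field K'.1 q.1) -
        D.barL (D.leafBracket G K'.1.1) (D.pr₂ q)) := by
  obtain ⟨c, hc, hcov⟩ := piCovector_comp_horPi h q f K G
  obtain ⟨c', hc', hcov'⟩ := piCovector_comp_horPi h q f' K' G'
  have hU := VField.contMDiffAt_vecCoord (D.field K.1) q.1
  have hU' := VField.contMDiffAt_vecCoord (D.field K'.1) q.1
  have e1 := (differential_momentum_canonicalSharp_momentum (ξ := D.pr₁ q) hU hU').trans
    (congrArg q.2.1 (D.mlieBracket_field K.1 K'.1 q.1))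
  have e2 := (differential_momentum_canonicalSharp_comp_proj (ξ := D.pr₁ q) hU c').trans
    ((hc' _).trans (hh.apply hw (D.pr₂ q) K f' G'))
  have e3 := (congrArg c (proj_canonicalSharp_momentum (ξ := D.pr₁ q) hU')).trans
    ((map_neg c _).trans (congrArg Neg.neg ((hc _).trans (hh.apply hw (D.pr₂ q) K' f G))))
  have e4 := (congrArg c (proj_canonicalSharp_comp_proj (ξ := D.pr₁ q) c')).trans (map_zero c)
  unfold liftedCanonicalTensor
  rw [hcov, hcov']
  refine (ContinuousLinearMap.add_apply_map_add (V := EX × (EX →L[ℝ] ℝ))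
    (canonicalSharp 𝓘(ℝ, EX) (D.pr₁ q)) _ _ _ _).trans ?_
  refine (congrArg₂ (· + ·) (congrArg₂ (· + ·) e1 e2) (congrArg₂ (· + ·) e3 e4)).trans ?_
  exact (congrArg (_ + ·) (add_zero (M := ℝ) _)).trans (sub_eq_add_neg (G := ℝ) _ _).symm

end AdmissibleHamiltonian

end LagrangianInLeaf

end Setting

/-! ### The formula for the push-forward. -/

section Setting

universe uS
variable {EZ Z ES : Type*} {S : Type uS} {EX X : Type*}
  [NormedAddCommGroup EZ] [NormedSpace ℝ EZ] [FiniteDimensional ℝ EZ]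
  [TopologicalSpace Z] [ChartedSpace EZ Z] [IsManifold 𝓘(ℝ, EZ) ∞ Z] [T2Space Z]
  [NormedAddCommGroup ES] [NormedSpace ℝ ES] [FiniteDimensional ℝ ES]
  [TopologicalSpace S] [ChartedSpace ES S] [IsManifold 𝓘(ℝ, ES) ∞ S]
  [NormedAddCommGroup EX] [NormedSpace ℝ EX] [FiniteDimensional ℝ EX]
  [TopologicalSpace X] [ChartedSpace EX X] [IsManifold 𝓘(ℝ, EX) ∞ X] [T2Space X]

namespace LagrangianInLeaf

variable {D : LagrangianInLeaf EZ Z ES S EX X}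

namespace AdmissibleHamiltonian

variable {H : D.AdmissibleHamiltonian}

/-- Split `d{K,K'}` along `E_X = α_H(TX) ⊕ L_X`: the first component of `ψ_H` evaluates the `α_H`
part, the second the `L_X` part, and the latter is the curvature. -/
theorem IsCurvature.apply_add_pairing
    {Φ : ∀ x, TangentSpace 𝓘(ℝ, EX) x →ₗ[ℝ] TangentSpace 𝓘(ℝ, EX) x →ₗ[ℝ] D.LFiber x}
    (h : H.IsCurvature Φ) (K K' : H.horizontal) (t : D.EStar) :
    (H.psi t).2.1 (D.anchor t.1 (D.dE t.1 (D.bracketE K.1 K'.1))) +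
      D.leaf.pairing (D.lag.map t.1) (Φ t.1 (D.field K.1 t.1) (D.field K'.1 t.1)) (H.psi t).2.2 =
      D.incl.pairing t.1 (D.dE t.1 (D.bracketE K.1 K'.1)) t.2 := by
  set l := D.dE t.1 (D.bracketE K.1 K'.1) with hl
  rw [h.apply_field]
  have h1 := D.pairing_normalProj t.1 (H.sub_alpha_anchor_mem t.1 l) t.2
  have h2 : D.incl.pairing t.1 (l - H.alpha t.1 (D.anchor t.1 l)) t.2 =
      D.incl.pairing t.1 l t.2 - D.incl.pairing t.1 (H.alpha t.1 (D.anchor t.1 l)) t.2 :=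
    eq_sub_of_add_eq ((LinearMap.map_add₂ (D.incl.pairing t.1) _ _ _).symm.trans
      (congrArg (fun m => D.incl.pairing t.1 m t.2) (sub_add_cancel l _)))
  refine (congrArg (D.incl.pairing t.1 (H.alpha t.1 (D.anchor t.1 l)) t.2 + ·)
    (h1.trans h2)).trans ?_
  exact add_sub_cancel (G := ℝ) _ _

/-- The functions `G`, `G'` vanish on the leaf and have zero anchor, so `f` and `f'` interact only
with `K'` and `K`. -/
theorem exactBracket_add_leafToIncl (t : D.EStar) (f f' : C^∞⟮𝓘(ℝ, EX), X; 𝓘(ℝ, ℝ), ℝ⟯)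
    (K K' : D.incl.vanishing) (G G' : D.leaf.vanishing) :
    D.exactBracket t (f, K + D.leafToIncl G) (f', K' + D.leafToIncl G') =
      differential 𝓘(ℝ, EX) f' t.1 (D.field K t.1) - differential 𝓘(ℝ, EX) f t.1 (D.field K' t.1) +
      (D.incl.pairing t.1 (D.dE t.1 (D.bracketE K K')) t.2 -
      D.incl.pairing t.1 (D.dE t.1 (D.bracketE (D.leafToIncl G') K)) t.2 +
      (D.incl.pairing t.1 (D.dE t.1 (D.bracketE (D.leafToIncl G) K')) t.2 +
      D.incl.pairing t.1 (D.dE t.1 (D.bracketE (D.leafToIncl G) (D.leafToIncl G'))) t.2)) := by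
  have h1 : ∀ (K : D.incl.vanishing) (G : D.leaf.vanishing),
      D.anchor t.1 (D.dE t.1 (K + D.leafToIncl G)) = D.field K t.1 := fun K G => by
    rw [map_add, map_add, D.anchor_leafToIncl, add_zero]
    rfl
  have h2 : D.incl.pairing t.1 (D.dE t.1 (D.bracketE K (D.leafToIncl G'))) t.2 =
      -D.incl.pairing t.1 (D.dE t.1 (D.bracketE (D.leafToIncl G') K)) t.2 := by
    have h3 : ∀ F, D.incl.pairing t.1 (D.dE t.1 (D.bracketE F F)) t.2 = 0 := fun F => by
      rw [D.dE_bracketE_self, map_zero]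
      rfl
    have h4 := h3 (K + D.leafToIncl G')
    simp only [map_add, LinearMap.add_apply, h3] at h4
    linarith
  rw [exactBracket_apply, h1, h1]
  simp only [map_add, LinearMap.add_apply, h2]
  ring

theorem apply_pushforward_sharp {w' : BivectorField D.IEStar D.EStar}
    (hw : D.IsSternbergWeinstein w') {wH : BivectorField D.ILPi D.LPi}
    (hH : IsPushforward H.psi w' wH) (t : D.EStar) (f f' : C^∞⟮𝓘(ℝ, EX), X; 𝓘(ℝ, ℝ), ℝ⟯)
    (K K' : H.horizontal) (G G' : D.leaf.vanishing) :
    H.piCovector (H.psi t) f K G (wH.sharp (H.psi t) (H.piCovector (H.psi t) f' K' G')) =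
      D.exactBracket t (f, K.1 + D.leafToIncl G) (f', K'.1 + D.leafToIncl G') := by
  have h1 := hw.apply_sharp t (f, K.1 + D.leafToIncl G) (f', K'.1 + D.leafToIncl G')
  rw [← H.piCovector_comp_psi, ← H.piCovector_comp_psi] at h1
  exact (congrArg (H.piCovector (H.psi t) f K G) (hH t _)).trans h1

/-- Both sides are evaluated on adapted covectors. The canonical tensor and the curvature together
account for `{K,K'}`, the horizontal lift for the mixed terms, and the Lie–Poisson tensor for
`{G,G'}`. -/
theorem pushforward_formula {w' : BivectorField D.IEStar D.EStar}
    {br : ∀ x, D.LFiber x →ₗ[ℝ] D.LFiber x →ₗ[ℝ] D.LFiber x}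
    {Φ : ∀ x, TangentSpace 𝓘(ℝ, EX) x →ₗ[ℝ] TangentSpace 𝓘(ℝ, EX) x →ₗ[ℝ] D.LFiber x}
    (hw : D.IsSternbergWeinstein w') (hbr : D.IsIsotropyBracket br) (hΦ : H.IsCurvature Φ)
    {wH : BivectorField D.ILPi D.LPi} (hH : IsPushforward H.psi w' wH)
    {hor : ∀ n : D.LStar, TangentSpace 𝓘(ℝ, EX) n.1 →ₗ[ℝ] TangentSpace D.ILStar n}
    (hh : H.IsHor w' hor)
    {horPi : ∀ q : D.LPi, TangentSpace D.ICot (D.pr₁ q) →L[ℝ] TangentSpace D.ILPi q}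
    (h : D.IsHorPi hor horPi) (q : D.LPi) (a b : TangentSpace D.ILPi q →L[ℝ] ℝ) :
    a (wH.sharp q b) = D.liftedCanonicalTensor horPi q a b + D.verticalTensor Φ q a b +
      D.liePoissonTensor br q a b := by
  obtain ⟨Ψ, hΨ⟩ := H.exists_diffeomorph_psi
  obtain ⟨t, rfl⟩ : ∃ t, H.psi t = q := ⟨Ψ.symm q, by rw [← hΨ]; exact Ψ.apply_symm_apply q⟩
  obtain ⟨f, K, G, ha, hu, hl⟩ := H.exists_piCovector_eq (H.psi t) a
  obtain ⟨f', K', G', hb, hu', hl'⟩ := H.exists_piCovector_eq (H.psi t) b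
  have e1 := (congrArg₂ (fun a b => a (wH.sharp (H.psi t) b)) ha hb).trans
    (apply_pushforward_sharp hw hH t f f' K K' G G')
  have e2 := (congrArg₂ (D.liftedCanonicalTensor horPi (H.psi t)) ha hb).trans
    (liftedCanonicalTensor_piCovector hw hh h (H.psi t) f f' K K' G G')
  have e3 := hΦ.apply_add_pairing K K' t
  have e4 : D.verticalTensor Φ (H.psi t) a b = D.leaf.pairing (D.lag.map t.1)
      (Φ t.1 (D.field K.1 t.1) (D.field K'.1 t.1)) (H.psi t).2.2 :=
    congrArg₂ (fun u u' => D.leaf.pairing (D.lag.map t.1) (Φ t.1 u u') (H.psi t).2.2) hu hu'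
  have hG : br t.1 (D.leaf.dConormal (D.lag.map t.1) G) (D.leaf.dConormal (D.lag.map t.1) G') =
      D.leaf.dConormal (D.lag.map t.1) (D.leafBracket G G'.1) :=
    Subtype.ext (hbr t.1 G.1 G'.1 (D.leaf.differential_mem_conormal G.2 _)
      (D.leaf.differential_mem_conormal G'.2 _))
  have hbar : ∀ (G : D.leaf.vanishing) (F : D.incl.vanishing),
      D.barL (D.leafBracket G F.1) (D.toLStar t) =
        D.incl.pairing t.1 (D.dE t.1 (D.bracketE (D.leafToIncl G) F)) t.2 :=
    fun G F => D.barL_toLStar (D.leafBracket G F.1) t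
  have e5 : D.liePoissonTensor br (H.psi t) a b =
      D.incl.pairing t.1 (D.dE t.1 (D.bracketE (D.leafToIncl G) (D.leafToIncl G'))) t.2 :=
    (congrArg₂ (fun l l' => D.leaf.pairing (D.lag.map t.1) (br t.1 l l') (H.psi t).2.2) hl hl').trans
      ((congrArg (fun l => D.leaf.pairing (D.lag.map t.1) l (H.psi t).2.2) hG).trans
        (hbar G (D.leafToIncl G')))
  have e6 := hbar G K'.1
  have e7 := hbar G' K.1
  have e8 := exactBracket_add_leafToIncl t f f' K.1 K'.1 G G'
  -- `A`, `B` are the derivatives of `f'`, `f`; `P + Q` is the split bracket `{K,K'}`; `R`, `S` are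
  -- the brackets of `G` with `K'` and of `G'` with `K`; `T` is the isotropy term.
  have key : ∀ A B P Q R S T : ℝ, A - B + ((P + Q) - S + (R + T)) =
      P + (A - S) - (B - R) + Q + T := by
    intros
    ring
  rw [← e3, ← e5, ← e6, ← e7] at e8
  refine (e1.trans e8).trans (Eq.trans ?_
    (congrArg₂ (· + ·) (congrArg₂ (· + ·) e2 e4) rfl).symm)
  exact key _ _ _ _ _ _ _

end AdmissibleHamiltonian

end LagrangianInLeaf

end Setting

end

theorem mainTheorem4
    {EZ Z ES S EX X : Type*}
    [NormedAddCommGroup EZ] [NormedSpace ℝ EZ] [FiniteDimensional ℝ EZ]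
    [TopologicalSpace Z] [ChartedSpace EZ Z] [IsManifold 𝓘(ℝ, EZ) ∞ Z]
    [T2Space Z] [SecondCountableTopology Z]
    [NormedAddCommGroup ES] [NormedSpace ℝ ES] [FiniteDimensional ℝ ES]
    [TopologicalSpace S] [ChartedSpace ES S] [IsManifold 𝓘(ℝ, ES) ∞ S]
    [T2Space S] [SecondCountableTopology S]
    [NormedAddCommGroup EX] [NormedSpace ℝ EX] [FiniteDimensional ℝ EX]
    [TopologicalSpace X] [ChartedSpace EX X] [IsManifold 𝓘(ℝ, EX) ∞ X]
    [T2Space X] [SecondCountableTopology X]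
    (D : LagrangianInLeaf EZ Z ES S EX X) (H : D.AdmissibleHamiltonian) :
    (∃! w' : BivectorField D.IEStar D.EStar, D.IsSternbergWeinstein w') ∧
    (∃! br : ∀ x, D.LFiber x →ₗ[ℝ] D.LFiber x →ₗ[ℝ] D.LFiber x, D.IsIsotropyBracket br) ∧
    (∃! Φ : ∀ x, TangentSpace 𝓘(ℝ, EX) x →ₗ[ℝ] TangentSpace 𝓘(ℝ, EX) x →ₗ[ℝ] D.LFiber x,
      H.IsCurvature Φ) ∧
    (∃ Ψ : Diffeomorph D.IEStar D.ILPi D.EStar D.LPi ∞, ⇑Ψ = H.psi) ∧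
    ∀ w' br Φ, D.IsSternbergWeinstein w' → D.IsIsotropyBracket br → H.IsCurvature Φ →
      (∃! wH : BivectorField D.ILPi D.LPi, IsPushforward H.psi w' wH) ∧
      (∃! hor, H.IsHor w' hor) ∧
      ∀ wH hor, IsPushforward H.psi w' wH → H.IsHor w' hor →
        (∃! horPi, D.IsHorPi hor horPi) ∧
        ∀ horPi, D.IsHorPi hor horPi →
          ∀ (q : D.LPi) (a b : TangentSpace D.ILPi q →L[ℝ] ℝ),
            a (wH.sharp q b) = D.liftedCanonicalTensor horPi q a b +
              D.verticalTensor Φ q a b + D.liePoissonTensor br q a b := by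
  refine ⟨D.existsUnique_isSternbergWeinstein, D.existsUnique_isIsotropyBracket,
    H.existsUnique_isCurvature, H.exists_diffeomorph_psi, fun w' br Φ hw hbr hΦ => ⟨?_, ?_, ?_⟩⟩
  · obtain ⟨Ψ, hΨ⟩ := H.exists_diffeomorph_psi
    rw [← hΨ]
    exact existsUnique_isPushforward Ψ w'
  · exact LagrangianInLeaf.AdmissibleHamiltonian.existsUnique_isHor hw
  · exact fun wH hor hH hh => ⟨LagrangianInLeaf.existsUnique_isHorPi (hh.mfderiv_proj hw),
      fun horPi h q a b => LagrangianInLeaf.AdmissibleHamiltonian.pushforward_formula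
        hw hbr hΦ hH hh h q a b⟩
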